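/- Notation. $\mathfrak{su}(3)$ is the Lie algebra of traceless skew-Hermitian $3\times3$ matrices with inner product $\langle X|Y\rangle=\mathrm{tr}(X^\dagger Y)$; $E_j=i\lambda_j/\sqrt2$ ($1\le j\le 8$, $\lambda_j$ the Gell-Mann matrices) is an orthonormal basis, with coordinates $x_j$ and structure constants $[E_k,E_j]=\sum_l c^l_{kj}E_l$. For $p,q\in\mathbb N_0$, $\omega_{(p,q)}=p\varpi_1+q\varpi_2=\frac i3\,\mathrm{diag}(2p+q,-p+q,-p-2q)$ is the dominant weight $(p,q)$. Let $\xi=\frac{i}{\sqrt6}\,\mathrm{diag}(2x+y,-x+y,-x-2y)$ with $x,y\ge0$, $x^2+xy+y^2=1$, be a unit vector of the closed Weyl chamber such that $R\xi$ is a dominant weight for some $R>0$; let $r(\xi)$ be the least such $R$ and let $(p_1,q_1)$ be given by $\omega_{(p_1,q_1)}=r(\xi)\,\xi$. Let $\mathcal O_\xi=\{\mathrm{Ad}_g\xi: g\in SU(3)\}$, let $Poly(\mathcal O_\xi)$ be the space of restrictions to $\mathcal O_\xi$ of complex polynomials on $\mathfrak{su}(3)$, with $SU(3)$-action $f^g(\varsigma)=f(\mathrm{Ad}_{g^{-1}}\varsigma)$,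 with the inner product $\langle f_1|f_2\rangle_\xi=\int_{\mathcal O_\xi}\overline{f_1}f_2\,d\varsigma$ for the invariant probability measure induced by the Haar measure of $SU(3)$, and with the Poisson bracket induced by $\{F,G\}=\sum_{j,k,l}c^l_{kj}x_l\,\partial_jF\,\partial_kG$. For each $s\in\mathbb N=\{1,2,\dots\}$ let $\mathcal H_s$ be a finite-dimensional Hilbert space with a continuous irreducible unitary representation $\pi_s$ of $SU(3)$ of highest weight $(sp_1,sq_1)$, and write $A^g=\pi_s(g)A\pi_s(g)^{-1}$ for operators $A$ on $\mathcal H_s$. A *symbol correspondence* $W^s:\mathcal B(\mathcal H_s)\to Poly(\mathcal O_\xi)$, $A\mapsto W^s_A$, is an injective linear map with $W^s_{A^g}=(W^s_A)^g$, $W^s_{A^\dagger}=\overline{W^s_A}$ and $\int_{\mathcal O_\xi}W^s_A\,d\varsigma=\mathrm{tr}(A)/\dim\mathcal H_s$. A $\xi$-*ray of symbol correspondences* is a sequence $(W^s)_{s\in\mathbb N}$ of these. On its image $W^s$ induces the twisted product $W^s_{A}\star^sW^s_{A'}=W^s_{AA'}$ (each $f\in Poly(\mathcal O_\xi)$ lies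 in the image for all large $s$). The ray is *of Poisson type* if, uniformly on $\mathcal O_\xi$ as $s\to\infty$, $$f_1\star^sf_2\to f_1f_2,\qquad s\,r(\xi)\,(f_1\star^sf_2-f_2\star^sf_1)\to i\{f_1,f_2\}\qquad\text{for all } f_1,f_2\in Poly(\mathcal O_\xi).$$ The *Berezin correspondence* $B^s$ is given by $B^s_A(\mathrm{Ad}_g\xi)=\mathrm{tr}(A\,\Pi_s^{\,g})$, where $\Pi_s$ is the orthogonal projection of $\mathcal H_s$ onto its highest weight subspace. For each irrep (dominant weight) $a\in\mathbb N_0^2$, fix an orthonormal basis $(X^a_\gamma)_\gamma$ of the space of highest weight vectors of weight $a$ in $Poly(\mathcal O_\xi)$ and, for each $s$, an orthonormal basis $(e^{s,a}_\sigma)_\sigma$, for $\mathrm{tr}(A^\dagger A')$, of the space of highest weight vectors of weight $a$ in $\mathcal B(\mathcal H_s)$. The *characteristic matrix* $\mathbf C^s_\xi(a)$ of $W^s$ has the entries $\mathbf C^s_\xi(a)_{\gamma\sigma}=\big\langle X^a_\gamma\,\big|\,W^s_{\sqrt{\dim\mathcal H_s}\,e^{s,a}_\sigma}\big\rangle_\xi$;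 let $\mathbf B^s_\xi(a)$ be that of $B^s$, for the same bases. **Theorem.** For every such $\xi$, every $\xi$-ray of symbol correspondences $(W^s)_{s\in\mathbb N}$ and every choice of the bases, the ray is of Poisson type if and only if $$\lim_{s\to\infty}\big(\mathbf C^s_\xi(a)-\mathbf B^s_\xi(a)\big)=0\qquad\text{for every irrep } a .$$ -/

import Mathlib

open Filter Topology MeasureTheory
open scoped Matrix ComplexConjugate

noncomputable section

namespace Quark

/-! ### The group `SU(3)`, its Lie algebra and its Haar measure -/

/-- Complex `3 × 3` matrices. -/
abbrev Mat3 : Type := Matrix (Fin 3) (Fin 3) ℂ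

/-- The group `SU(3)`, with the topology induced from the matrices. -/
abbrev SU3 : Type := Matrix.specialUnitaryGroup (Fin 3) ℂ

/-- The Lie algebra `su(3)` of traceless skew-Hermitian matrices. -/
def su3 : Submodule ℝ Mat3 where
  carrier := {A | Aᴴ = -A ∧ A.trace = 0}
  zero_mem' := by simp
  add_mem' := by
    rintro A B ⟨hA, hA'⟩ ⟨hB, hB'⟩
    refine ⟨?_, ?_⟩
    · rw [Matrix.conjTranspose_add, hA, hB]; abel
    · rw [Matrix.trace_add, hA', hB', add_zero]
  smul_mem' := by
    rintro c A ⟨hA, hA'⟩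
    refine ⟨?_, ?_⟩
    · rw [Matrix.conjTranspose_smul, hA]; simp
    · rw [Matrix.trace_smul, hA', smul_zero]

theorem exp_mem_SU3 {A : Mat3} (hA : A ∈ su3) :
    NormedSpace.exp A ∈ Matrix.specialUnitaryGroup (Fin 3) ℂ := by
  obtain ⟨h1, h2⟩ := hA
  rw [Matrix.mem_specialUnitaryGroup_iff]
  refine ⟨?_, ?_⟩
  · rw [Matrix.mem_unitaryGroup_iff, Matrix.star_eq_conjTranspose, ← Matrix.exp_conjTranspose, h1,
      ← Matrix.exp_add_of_commute _ _ (Commute.refl A).neg_right, add_neg_cancel]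
    exact NormedSpace.exp_zero
  · have hH : ((-Complex.I) • A).IsHermitian := by
      rw [Matrix.IsHermitian, Matrix.conjTranspose_smul, h1]
      simp
    have hS := hH.spectral_theorem
    rw [Unitary.conjStarAlgAut_apply] at hS
    set U : Mat3 := (hH.eigenvectorUnitary : Mat3) with hU
    set D : Fin 3 → ℂ := RCLike.ofReal ∘ hH.eigenvalues with hD
    have hUU : U * star U = 1 := Unitary.coe_mul_star_self hH.eigenvectorUnitary
    have hUU' : star U * U = 1 := Unitary.coe_star_mul_self hH.eigenvectorUnitary
    have hinv : U⁻¹ = star U := Matrix.inv_eq_right_inv hUU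
    have hunit : IsUnit U := ⟨⟨U, star U, hUU, hUU'⟩, rfl⟩
    have hA2 : A = U * Matrix.diagonal (Complex.I • D) * U⁻¹ := by
      have : A = Complex.I • ((-Complex.I) • A) := by
        rw [smul_smul]; simp
      rw [this, hS, hinv, Matrix.diagonal_smul]
      simp
    have htr : ∑ i, Complex.I * D i = 0 := by
      have := h2
      rw [hA2, Matrix.trace_mul_comm, ← mul_assoc, hinv, hUU', one_mul, Matrix.trace_diagonal] at this
      simpa using this
    rw [hA2, Matrix.exp_conj _ _ hunit, Matrix.det_mul, Matrix.det_mul, mul_right_comm,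
      ← Matrix.det_mul, hinv, hUU, Matrix.det_one, one_mul, Matrix.exp_diagonal, Matrix.det_diagonal]
    have : ∀ i, NormedSpace.exp (Complex.I • D) i = Complex.exp (Complex.I * D i) := by
      intro i
      rw [Pi.coe_exp, Complex.exp_eq_exp_ℂ]
      rfl
    simp_rw [this]
    rw [← Complex.exp_sum, htr, Complex.exp_zero]

/-- The exponential map `su(3) → SU(3)`. -/
def expSU3 (A : su3) : SU3 := ⟨NormedSpace.exp (A : Mat3), exp_mem_SU3 A.2⟩

instance : MeasurableSpace SU3 := borel SU3

instance : BorelSpace SU3 := ⟨rfl⟩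

instance : IsTopologicalGroup SU3 where
  continuous_inv := by
    refine Continuous.subtype_mk ?_ _
    exact continuous_star.comp continuous_subtype_val

instance : CompactSpace SU3 := by
  refine isCompact_iff_compactSpace.mp ?_
  have hsub : ((Matrix.specialUnitaryGroup (Fin 3) ℂ : Submonoid Mat3) : Set Mat3) ⊆
      Set.pi Set.univ fun _ => Set.pi Set.univ fun _ => Metric.closedBall (0 : ℂ) 1 := by
    intro A hA i _ j _
    rw [mem_closedBall_zero_iff]
    exact entry_norm_bound_of_unitary hA.1 i j
  refine IsCompact.of_isClosed_subset
    (isCompact_univ_pi fun _ => isCompact_univ_pi fun _ => isCompact_closedBall _ _) ?_ hsub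
  have : ((Matrix.specialUnitaryGroup (Fin 3) ℂ : Submonoid Mat3) : Set Mat3) =
      {A | A * star A = 1} ∩ {A | A.det = 1} := by
    ext A
    simp [Matrix.mem_specialUnitaryGroup_iff, Matrix.mem_unitaryGroup_iff]
  rw [this]
  exact (isClosed_eq (by fun_prop) continuous_const).inter
    (isClosed_eq (by fun_prop) continuous_const)

/-- The Haar probability measure of `SU(3)`. -/
def haarSU3 : Measure SU3 := Measure.haarMeasure ⊤

/-! ### Weights and highest weight vectors -/

section Weights

variable {V : Type*} [AddCommGroup V] [Module ℂ V]

/-- The weight space of `ρ` for the weight `a = (a₁, a₂)`, that is `a₁ ϖ₁ + a₂ ϖ₂`: on the diagonal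
torus this weight is the character `diag (t₀, t₁, t₂) ↦ t₀ ^ (a₁ + a₂) * t₁ ^ a₂`
(recall `t₀ t₁ t₂ = 1`). -/
def weightSpace (ρ : Representation ℂ SU3 V) (a : ℕ × ℕ) : Submodule ℂ V where
  carrier := {v | ∀ t : SU3, (t : Mat3).IsDiag →
    ρ t v = ((t : Mat3) 0 0 ^ (a.1 + a.2) * (t : Mat3) 1 1 ^ a.2) • v}
  zero_mem' := by simp
  add_mem' := by
    intro v w hv hw t ht
    rw [map_add, hv t ht, hw t ht, smul_add]
  smul_mem' := by
    intro c v hv t ht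
    rw [map_smul, hv t ht, smul_comm]

/-- The element `E_{jk} - E_{kj}` of `su(3)`. -/
def rootRe (j k : Fin 3) : su3 :=
  ⟨Matrix.single j k 1 - Matrix.single k j 1, by
    refine ⟨?_, ?_⟩
    · simp
    · by_cases h : j = k
      · subst h; simp
      · simp [Matrix.trace_sub, Matrix.trace_single_eq_of_ne, h, Ne.symm h]⟩

/-- The element `i (E_{jk} + E_{kj})` of `su(3)`, for `j ≠ k`. -/
def rootIm (j k : Fin 3) (h : j ≠ k) : su3 :=
  ⟨Complex.I • (Matrix.single j k 1 + Matrix.single k j 1), by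
    refine ⟨?_, ?_⟩
    · rw [Matrix.conjTranspose_smul, Matrix.conjTranspose_add, Matrix.conjTranspose_single,
        Matrix.conjTranspose_single, add_comm]
      simp only [star_one, Complex.star_def, Complex.conj_I, neg_smul]
    · simp [Matrix.trace_add, Matrix.trace_single_eq_of_ne, h, Ne.symm h]⟩

variable [TopologicalSpace V]

/-- `w` is the derivative at `t = 0` of `t ↦ ρ (exp (t A)) v`. -/
def HasLieAction (ρ : Representation ℂ SU3 V) (A : su3) (v w : V) : Prop :=
  Tendsto (fun t : ℝ => ((t⁻¹ : ℝ) : ℂ) • (ρ (expSU3 (t • A)) v - v)) (𝓝[≠] 0) (𝓝 w)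

/-- `v` is zero or a highest weight vector of weight `a`: it lies in the weight space of `a` and is
annihilated by the raising operators
`E_{jk} = ((E_{jk} - E_{kj}) - i (i (E_{jk} + E_{kj}))) / 2`, `j < k`,
of the complexified derived representation. -/
def IsHighest (ρ : Representation ℂ SU3 V) (a : ℕ × ℕ) (v : V) : Prop :=
  v ∈ weightSpace ρ a ∧
    ∀ j k : Fin 3, ∀ h : j < k, ∃ x y : V,
      HasLieAction ρ (rootRe j k) v x ∧ HasLieAction ρ (rootIm j k h.ne) v y ∧
        x - Complex.I • y = 0

/-- `x` is a basis of the space of highest weight vectors of weight `a` of the subspace `S`,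
orthonormal for the inner product `ip`. -/
structure IsHighestBasis (ρ : Representation ℂ SU3 V) (S : Submodule ℂ V) (ip : V → V → ℂ)
    (a : ℕ × ℕ) {n : ℕ} (x : Fin n → V) : Prop where
  mem : ∀ i, x i ∈ S
  highest : ∀ i, IsHighest ρ a (x i)
  orthonormal : ∀ i j, ip (x i) (x j) = if i = j then 1 else 0
  spans : ∀ v ∈ S, IsHighest ρ a v → v ∈ Submodule.span ℂ (Set.range x)

end Weights

/-! ### Adjoint orbits, polynomials and the Poisson bracket -/

/-- The dominant weight `p ϖ₁ + q ϖ₂` as an element of `su(3)`. -/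
def domWeight (p q : ℕ) : Mat3 :=
  (Complex.I / 3) • Matrix.diagonal ![2 * (p : ℂ) + q, -(p : ℂ) + q, -(p : ℂ) - 2 * q]

/-- The point `ξ_{(x,y)}`. -/
def xiPoint (x y : ℝ) : Mat3 :=
  (Complex.I / (Real.sqrt 6 : ℂ)) •
    Matrix.diagonal ![2 * (x : ℂ) + y, -(x : ℂ) + y, -(x : ℂ) - 2 * y]

/-- The intersection of the unit sphere with the closed principal Weyl chamber. -/
def chamberArc : Set Mat3 :=
  {ξ | ∃ x y : ℝ, 0 ≤ x ∧ 0 ≤ y ∧ x ^ 2 + x * y + y ^ 2 = 1 ∧ ξ = xiPoint x y}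

/-- The `R > 0` for which `R ξ` is a dominant weight. -/
def integralScales (ξ : Mat3) : Set ℝ :=
  {R | 0 < R ∧ ∃ p q : ℕ, (R : ℂ) • ξ = domWeight p q}

/-- The points of the arc that represent the rational orbits. -/
def rationalArc : Set Mat3 := {ξ ∈ chamberArc | (integralScales ξ).Nonempty}

/-- The integral radius `r(ξ)`, the least `R > 0` for which `R ξ` is a dominant weight. -/
def integralRadius (ξ : Mat3) : ℝ := sInf (integralScales ξ)

/-- The adjoint orbit of `ξ`. -/
def adOrbit (ξ : Mat3) : Set Mat3 := Set.range fun g : SU3 => (g : Mat3) * ξ * ((g⁻¹ : SU3) : Mat3)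

/-- The point `Ad_g ξ` of the orbit. -/
def orbitPt (ξ : Mat3) (g : SU3) : adOrbit ξ := ⟨(g : Mat3) * ξ * ((g⁻¹ : SU3) : Mat3), g, rfl⟩

/-- The adjoint action on an orbit. -/
instance (ξ : Mat3) : MulAction SU3 (adOrbit ξ) where
  smul g x := ⟨(g : Mat3) * (x : Mat3) * ((g⁻¹ : SU3) : Mat3), by
    obtain ⟨_, h, rfl⟩ := x
    exact ⟨g * h, by simp [mul_assoc]⟩⟩
  one_smul x := Subtype.ext (by
    change ((1 : SU3) : Mat3) * (x : Mat3) * (((1 : SU3)⁻¹ : SU3) : Mat3) = x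
    simp)
  mul_smul g h x := Subtype.ext (by
    change ((g * h : SU3) : Mat3) * (x : Mat3) * (((g * h)⁻¹ : SU3) : Mat3) =
      (g : Mat3) * ((h : Mat3) * (x : Mat3) * ((h⁻¹ : SU3) : Mat3)) * ((g⁻¹ : SU3) : Mat3)
    simp [mul_assoc])

/-- The action `(f^g)(ς) = f(Ad_{g⁻¹} ς)` on functions on the orbit. -/
def funRep (ξ : Mat3) : Representation ℂ SU3 (adOrbit ξ → ℂ) where
  toFun g :=
    { toFun := fun f x => f (g⁻¹ • x)
      map_add' := fun _ _ => rfl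
      map_smul' := fun _ _ => rfl }
  map_one' := by
    ext f x
    simp
  map_mul' g h := by
    refine LinearMap.ext fun f => funext fun x => ?_
    simp [mul_smul]

/-- The invariant integral on the orbit, induced by the Haar probability measure. -/
def orbitIntegral (ξ : Mat3) (f : adOrbit ξ → ℂ) : ℂ := ∫ g, f (orbitPt ξ g) ∂haarSU3

/-- The `L²` inner product on the orbit, antilinear in the first argument. -/
def orbitInner (ξ : Mat3) (f₁ f₂ : adOrbit ξ → ℂ) : ℂ :=
  orbitIntegral ξ fun x => conj (f₁ x) * f₂ x

/-- The Gell-Mann matrices `λ₁, …, λ₈`, indexed from `0`. -/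
def gellMann : Fin 8 → Mat3 :=
  ![!![0, 1, 0; 1, 0, 0; 0, 0, 0],
    !![0, -Complex.I, 0; Complex.I, 0, 0; 0, 0, 0],
    !![1, 0, 0; 0, -1, 0; 0, 0, 0],
    !![0, 0, 1; 0, 0, 0; 1, 0, 0],
    !![0, 0, -Complex.I; 0, 0, 0; Complex.I, 0, 0],
    !![0, 0, 0; 0, 0, 1; 0, 1, 0],
    !![0, 0, 0; 0, 0, -Complex.I; 0, Complex.I, 0],
    ((Real.sqrt 3 : ℂ)⁻¹) • !![1, 0, 0; 0, 1, 0; 0, 0, -2]]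

/-- The orthonormal basis `E_j = i λ_j / √2` of `su(3)` for the inner product `tr (X† Y)`. -/
def basisE (j : Fin 8) : Mat3 := (Complex.I / (Real.sqrt 2 : ℂ)) • gellMann j

/-- The coordinate `x_j` of a matrix with respect to the basis `E_j`. -/
def coordE (j : Fin 8) (X : Mat3) : ℂ := ((basisE j)ᴴ * X).trace

/-- The structure constants `c^l_{kj}` given by `[E_k, E_j] = ∑ l, c^l_{kj} E_l`. -/
def structConst (l k j : Fin 8) : ℂ := coordE l (basisE k * basisE j - basisE j * basisE k)

/-- Complex polynomials on `su(3)`, in the coordinates `x_j`. -/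
abbrev PolySU3 : Type := MvPolynomial (Fin 8) ℂ

/-- The Poisson bracket `{F, G} = ∑ c^l_{kj} x_l ∂_j F ∂_k G` on `su(3)`. -/
def poissonBracket (F G : PolySU3) : PolySU3 :=
  ∑ j, ∑ k, ∑ l, MvPolynomial.C (structConst l k j) * MvPolynomial.X l *
    MvPolynomial.pderiv j F * MvPolynomial.pderiv k G

/-- Restriction of polynomials to the orbit. -/
def restrict (ξ : Mat3) : PolySU3 →ₗ[ℂ] (adOrbit ξ → ℂ) where
  toFun F x := MvPolynomial.eval (fun j => coordE j (x : Mat3)) F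
  map_add' _ _ := by ext; simp
  map_smul' _ _ := by ext; simp

/-- The space `Poly(𝒪_ξ)`. -/
def polyOrbit (ξ : Mat3) : Submodule ℂ (adOrbit ξ → ℂ) := LinearMap.range (restrict ξ)

/-! ### Quark systems and symbol correspondences -/

section Systems

variable {H : Type*} [NormedAddCommGroup H] [InnerProductSpace ℂ H] [CompleteSpace H]

/-- The representation on the Hilbert space underlying a unitary representation. -/
def hilbRep (π : SU3 →* unitary (H →L[ℂ] H)) : Representation ℂ SU3 H where
  toFun g := ((π g : H →L[ℂ] H) : H →ₗ[ℂ] H)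
  map_one' := by ext; simp
  map_mul' g h := by ext; simp

/-- The action `A^g = π(g) A π(g)⁻¹` on operators. -/
def opRep (π : SU3 →* unitary (H →L[ℂ] H)) : Representation ℂ SU3 (H →L[ℂ] H) where
  toFun g :=
    { toFun := fun A => (π g : H →L[ℂ] H) * A * ((π g⁻¹ : unitary (H →L[ℂ] H)) : H →L[ℂ] H)
      map_add' := fun A B => by rw [mul_add, add_mul]
      map_smul' := fun c A => by simp }
  map_one' := by
    refine LinearMap.ext fun A => ?_
    simp
  map_mul' g h := by
    refine LinearMap.ext fun A => ?_
    simp [mul_assoc]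

/-- The quantum quark system `(p, q)`: `π` is a continuous irreducible unitary representation of
`SU(3)` on the (finite dimensional) Hilbert space `H` with highest weight `p ϖ₁ + q ϖ₂`. -/
structure IsQuarkSystem (π : SU3 →* unitary (H →L[ℂ] H)) (p q : ℕ) : Prop where
  continuous : ∀ v : H, Continuous fun g => (π g : H →L[ℂ] H) v
  irreducible : (hilbRep π).IsIrreducible
  highest : ∃ v : H, v ≠ 0 ∧ IsHighest (hilbRep π) (p, q) v

/-- The trace of an operator. -/
def opTrace (A : H →L[ℂ] H) : ℂ := LinearMap.trace ℂ H (A : H →ₗ[ℂ] H)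

/-- The Hilbert-Schmidt inner product `tr (A† B)`. -/
def opInner (A B : H →L[ℂ] H) : ℂ := opTrace (star A * B)

/-- Symbol correspondences `ℬ(H) → Poly(𝒪_ξ)`. -/
structure IsSymbolCorrespondence (ξ : Mat3) (π : SU3 →* unitary (H →L[ℂ] H))
    (W : (H →L[ℂ] H) →ₗ[ℂ] (adOrbit ξ → ℂ)) : Prop where
  mem_poly : ∀ A, W A ∈ polyOrbit ξ
  injective : Function.Injective W
  equivariant : ∀ g A, W (opRep π g A) = funRep ξ g (W A)
  real : ∀ A x, W (star A) x = conj (W A x)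
  normalized : ∀ A, orbitIntegral ξ (W A) = opTrace A / (Module.finrank ℂ H : ℂ)

/-- The twisted product `W(A) ⋆ W(B) = W(A B)` on the image of an injective `W`
(its values at functions outside of the image are irrelevant). -/
def twistedProduct {ξ : Mat3} (W : (H →L[ℂ] H) →ₗ[ℂ] (adOrbit ξ → ℂ)) (f₁ f₂ : adOrbit ξ → ℂ) :
    adOrbit ξ → ℂ :=
  W (Function.invFun W f₁ * Function.invFun W f₂)

/-- The orthogonal projection onto the weight space of the highest weight `(p, q)`. -/
def highestProj [FiniteDimensional ℂ H] (π : SU3 →* unitary (H →L[ℂ] H)) (p q : ℕ) :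
    H →L[ℂ] H :=
  (weightSpace (hilbRep π) (p, q)).starProjection

/-- The Berezin correspondence `B_A(Ad_g ξ) = tr (A Π^g)`, where `Π` is the projection onto the
highest weight subspace. At each point of the orbit some `g` is chosen; for a quark system `(p, q)`
with `p ϖ₁ + q ϖ₂` a positive multiple of `ξ` the value does not depend on the choice. -/
def berezin [FiniteDimensional ℂ H] (ξ : Mat3) (π : SU3 →* unitary (H →L[ℂ] H)) (p q : ℕ) :
    (H →L[ℂ] H) →ₗ[ℂ] (adOrbit ξ → ℂ) where
  toFun A x := opTrace (A * opRep π x.2.choose (highestProj π p q))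
  map_add' A B := by
    ext x
    simp only [opTrace, add_mul, ContinuousLinearMap.toLinearMap_add, map_add, Pi.add_apply]
  map_smul' c A := by
    ext x
    simp only [opTrace, smul_mul_assoc, ContinuousLinearMap.toLinearMap_smul, map_smul,
      Pi.smul_apply, RingHom.id_apply]

/-- The characteristic matrix of `W`, for orthonormal bases `X` and `e` of the highest weight
vectors, of a given weight, in `Poly(𝒪_ξ)` and in `ℬ(H)`: its column `σ` consists of the coordinates
of the symbol of `√(dim H) e_σ` with respect to `X`. -/
def charMatrix {ξ : Mat3} (W : (H →L[ℂ] H) →ₗ[ℂ] (adOrbit ξ → ℂ)) {m n : ℕ}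
    (X : Fin m → adOrbit ξ → ℂ) (e : Fin n → (H →L[ℂ] H)) : Matrix (Fin m) (Fin n) ℂ :=
  Matrix.of fun γ σ =>
    orbitInner ξ (X γ) (W ((Real.sqrt (Module.finrank ℂ H) : ℂ) • e σ))

end Systems

/-- Rays of Poisson type: for all functions `F`, `G` in `Poly(𝒪_ξ)`, restrictions of polynomials
on `su(3)`, uniformly on the orbit, `F ⋆ˢ G → F G` and `s r(ξ) (F ⋆ˢ G - G ⋆ˢ F) → i {F, G}`. -/
def IsPoissonType (ξ : Mat3) {H : ℕ+ → Type*} [∀ s, NormedAddCommGroup (H s)]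
    [∀ s, InnerProductSpace ℂ (H s)] [∀ s, CompleteSpace (H s)]
    (W : ∀ s, (H s →L[ℂ] H s) →ₗ[ℂ] (adOrbit ξ → ℂ)) : Prop :=
  ∀ F G : PolySU3,
    TendstoUniformly (fun s => twistedProduct (W s) (restrict ξ F) (restrict ξ G))
      (restrict ξ F * restrict ξ G) atTop ∧
    TendstoUniformly
      (fun (s : ℕ+) => (((s : ℝ) * integralRadius ξ : ℝ) : ℂ) •
        (twistedProduct (W s) (restrict ξ F) (restrict ξ G) -
          twistedProduct (W s) (restrict ξ G) (restrict ξ F)))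
      (Complex.I • restrict ξ (poissonBracket F G)) atTop

end Quark

end

open Quark

set_option linter.unusedSectionVars false

noncomputable section

namespace Quark

/-! ### Haar measure and curves in `SU(3)` -/

/-! The bridge between the quantum and the classical side is `NCPoly`, the free algebra on the nine
matrix units. A noncommutative polynomial u has a classical symbol `symb ξ u`, in which a matrix Z
becomes the function x ↦ -tr(xZ) on the orbit, and a quantization Q_s(u) = `rayQuant ξ π s u`, in
which Z becomes -i/(s r(ξ)) times dπ_s(Z). Both are equivariant algebra homomorphisms, every
function in Poly(𝒪_ξ) is a classical symbol, and [Q_s(u), Q_s(w)] is exactly -i/(s r(ξ)) Q_s(z) for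
a polynomial z, independent of s, with the symbol -{u, w} (`exists_commutator`).

Diagonal matrices act on the highest weight vector by scalars of order s, raising operators kill it,
and lowering operators give vectors of norm only O(√s). After division by s, the coherent states
π_s(g)v are therefore eigenvectors of Q_s(u) up to O(s^(-1/2)), with the eigenvalue `symb ξ u` at
Ad_g ξ (`exists_norm_rayQuant_coherent_le`). For products this needs a bound of ‖Q_s(u)‖ uniform in
s, which comes from the Casimir operator. Averaging over the coherent states shows that the Berezin
symbols of Q_s(u) tend to the classical symbol, and that tr(Q_s(u)† Q_s(w))/dim tends to the inner
product of the classical symbols.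

Both sides of the equivalence are compared with the condition `HasSymbolLimit`: W^s(Q_s(u)) → `symb
ξ u` for every u. The functions W^s(Q_s(u)), s ∈ ℕ, lie in one finite dimensional space of
polynomials, so that pointwise and uniform convergence agree.

Characteristic matrices: let D be the matrix of the coefficients, relative to √dim e_σ, of the
quantizations of lifts of the X_γ. By the trace limit D†D → 1. The matrices CD and BD contain the
inner products of the X_γ with the two kinds of symbols of these quantizations, so the limit
condition says (C - B)D → 0, which is the same as C - B → 0 (`hasSymbolLimit_of_charMatrix`,
`charMatrix_of_hasSymbolLimit`).

From symbol limits to the Poisson type: a given f equals W^s(Q_s(w_s)) for large s, with w_s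
convergent in a finite dimensional space. Twisted products and commutators are then symbols of w_s
w'_s and of the polynomials z_s, whose limits are known (`isPoissonType_of_hasSymbolLimit`).

From the Poisson type to symbol limits: the condition on products propagates the limit from
generators to all polynomials. For a generator Z, equivariance makes W^s([dπ_s(Z), A]) exactly the
Poisson bracket of W^s(A) with the function of Z. Thus the limiting brackets of W^s(Q_s(Z)) with the
coordinates are those of the classical function. They determine a function on the orbit up to a
constant, and the constant is fixed by the trace (`hasSymbolLimit_lin`). -/

instance : IsProbabilityMeasure haarSU3 := by
  constructor
  have := Measure.haarMeasure_self (G := SU3) (K₀ := ⊤)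
  simpa [haarSU3] using this

instance : haarSU3.IsHaarMeasure := by unfold haarSU3; infer_instance

theorem integrable_haar_of_continuous {E : Type*} [NormedAddCommGroup E] [SecondCountableTopology E]
    {f : SU3 → E} (hf : Continuous f) : Integrable f haarSU3 := by
  borelize E
  exact hf.integrable_of_hasCompactSupport (HasCompactSupport.of_compactSpace f)

theorem continuous_entry (i j : Fin 3) : Continuous fun g : SU3 => (g : Mat3) i j :=
  (continuous_subtype_val).matrix_elem i j

theorem coe_inv_eq (g : SU3) : ((g⁻¹ : SU3) : Mat3) = (g : Mat3)ᴴ := rfl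

theorem coe_mul_inv (g : SU3) : (g : Mat3) * ((g⁻¹ : SU3) : Mat3) = 1 := by
  have : ((g * g⁻¹ : SU3) : Mat3) = 1 := by simp
  simpa only [Submonoid.coe_mul] using this

theorem coe_inv_mul (g : SU3) : ((g⁻¹ : SU3) : Mat3) * (g : Mat3) = 1 := by
  have : ((g⁻¹ * g : SU3) : Mat3) = 1 := by simp
  simpa only [Submonoid.coe_mul] using this

/-- A curve in `SU(3)` through `1` with the velocity `Z` at the time `0`. -/
def HasVelocity (γ : ℝ → SU3) (Z : Mat3) : Prop :=
  γ 0 = 1 ∧ ∀ i j, HasDerivAt (fun t => (γ t : Mat3) i j) (Z i j) 0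

/-- A function on `SU(3)` whose derivatives at `1` along curves depend linearly on the velocity. -/
def IsSmoothAtOne {E : Type*} [NormedAddCommGroup E] [NormedSpace ℝ E] (a : SU3 → E) : Prop :=
  ∃ ℓ : Mat3 →ₗ[ℝ] E, ∀ γ Z, HasVelocity γ Z → HasDerivAt (fun t => a (γ t)) (ℓ Z) 0

theorem isSmoothAtOne_const {E : Type*} [NormedAddCommGroup E] [NormedSpace ℝ E] (c : E) :
    IsSmoothAtOne fun _ => c :=
  ⟨0, fun _ _ _ => by simpa using hasDerivAt_const _ _⟩

theorem IsSmoothAtOne.mul {a b : SU3 → ℂ} (ha : IsSmoothAtOne a) (hb : IsSmoothAtOne b) :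
    IsSmoothAtOne fun g => a g * b g := by
  obtain ⟨l, hl⟩ := ha
  obtain ⟨k, hk⟩ := hb
  refine ⟨(LinearMap.mulRight ℝ (b 1)) ∘ₗ l + (LinearMap.mulLeft ℝ (a 1)) ∘ₗ k, fun γ Z h => ?_⟩
  have := (hl γ Z h).fun_mul (hk γ Z h)
  simp only [h.1] at this
  exact this

theorem IsSmoothAtOne.conj {a : SU3 → ℂ} (ha : IsSmoothAtOne a) :
    IsSmoothAtOne fun g => conj (a g) := by
  obtain ⟨l, hl⟩ := ha
  refine ⟨(Complex.conjCLE : ℂ →ₗ[ℝ] ℂ) ∘ₗ l, fun γ Z h => ?_⟩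
  have := (hl γ Z h).star
  simpa using this

theorem IsSmoothAtOne.sum {E : Type*} [NormedAddCommGroup E] [NormedSpace ℝ E] {ι : Type*}
    [Fintype ι] {a : ι → SU3 → E} (ha : ∀ i, IsSmoothAtOne (a i)) :
    IsSmoothAtOne fun g => ∑ i, a i g := by
  choose l hl using ha
  refine ⟨∑ i, l i, fun γ Z h => ?_⟩
  simpa using HasDerivAt.fun_sum (u := Finset.univ) fun i _ => hl i γ Z h

theorem IsSmoothAtOne.smul_const {E : Type*} [NormedAddCommGroup E] [NormedSpace ℂ E]
    {a : SU3 → ℂ} (ha : IsSmoothAtOne a) (v : E) :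
    IsSmoothAtOne fun g => a g • v := by
  obtain ⟨l, hl⟩ := ha
  refine ⟨((LinearMap.toSpanSingleton ℂ E v).restrictScalars ℝ) ∘ₗ l, fun γ Z h => ?_⟩
  simpa using (hl γ Z h).smul_const v

theorem isSmoothAtOne_entry (i j : Fin 3) : IsSmoothAtOne fun g : SU3 => (g : Mat3) i j :=
  ⟨{ toFun := fun Z => Z i j, map_add' := fun _ _ => rfl, map_smul' := fun _ _ => rfl },
    fun _ _ h => h.2 i j⟩

/-- Continuous functions for which `φ (h⁻¹ g)` is a finite sum of products of functions of `h`,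
smooth at `1`, and of functions of `g`. -/
def IsSeparable (φ : C(SU3, ℂ)) : Prop :=
  ∃ (n : ℕ) (a : Fin n → SU3 → ℂ) (b : Fin n → C(SU3, ℂ)),
    (∀ i, IsSmoothAtOne (a i)) ∧ ∀ h g, φ (h⁻¹ * g) = ∑ i, a i h * b i g

theorem IsSeparable.of_fintype {φ : C(SU3, ℂ)} {ι : Type*} [Fintype ι] (a : ι → SU3 → ℂ)
    (b : ι → C(SU3, ℂ)) (ha : ∀ i, IsSmoothAtOne (a i))
    (h : ∀ h g, φ (h⁻¹ * g) = ∑ i, a i h * b i g) : IsSeparable φ := by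
  let e := Fintype.equivFin ι
  refine ⟨Fintype.card ι, fun i => a (e.symm i), fun i => b (e.symm i), fun i => ha _, ?_⟩
  intro x g
  rw [h, ← e.symm.sum_comp]

/-- The algebra of separable functions. -/
def separableAlgebra : StarSubalgebra ℂ C(SU3, ℂ) where
  carrier := {φ | IsSeparable φ}
  mul_mem' := by
    rintro φ ψ ⟨n, a, b, ha, h⟩ ⟨m, c, d, hc, k⟩
    refine IsSeparable.of_fintype (ι := Fin n × Fin m) (fun i g => a i.1 g * c i.2 g)
      (fun i => b i.1 * d i.2) (fun i => (ha _).mul (hc _)) fun x g => ?_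
    rw [ContinuousMap.mul_apply, h, k, Finset.sum_mul_sum, Fintype.sum_prod_type]
    refine Finset.sum_congr rfl fun i _ => Finset.sum_congr rfl fun j _ => ?_
    simp only [ContinuousMap.mul_apply]; ring
  add_mem' := by
    rintro φ ψ ⟨n, a, b, ha, h⟩ ⟨m, c, d, hc, k⟩
    refine IsSeparable.of_fintype (ι := Fin n ⊕ Fin m) (Sum.elim a c) (Sum.elim b d) ?_
      fun x g => ?_
    · rintro (i | i)
      exacts [ha i, hc i]
    · simp [h, k]
  algebraMap_mem' c :=
    IsSeparable.of_fintype (ι := Unit) (fun _ _ => c) (fun _ => 1)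
      (fun _ => isSmoothAtOne_const c) fun x g => by simp
  star_mem' := by
    rintro φ ⟨n, a, b, ha, h⟩
    refine ⟨n, fun i g => conj (a i g), fun i => star (b i), fun i => (ha i).conj, fun x g => ?_⟩
    simp [h]

/-- Unitarity turns the entries of h⁻¹ into conjugates of the entries of h. -/
theorem entry_mem_separableAlgebra (i j : Fin 3) :
    (⟨fun g : SU3 => (g : Mat3) i j, continuous_entry i j⟩ : C(SU3, ℂ)) ∈ separableAlgebra := by
  refine IsSeparable.of_fintype (ι := Fin 3) (fun k g => conj ((g : Mat3) k i))
      (fun k => ⟨fun g : SU3 => (g : Mat3) k j, continuous_entry k j⟩)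
      (fun k => (isSmoothAtOne_entry k i).conj) fun x g => ?_
  simp only [ContinuousMap.coe_mk, Submonoid.coe_mul, coe_inv_eq, Matrix.mul_apply,
    Matrix.conjTranspose_apply]
  rfl

/-- Stone–Weierstrass; the matrix entries separate the points. -/
theorem separableAlgebra_dense : separableAlgebra.topologicalClosure = ⊤ := by
  refine ContinuousMap.starSubalgebra_topologicalClosure_eq_top_of_separatesPoints _ ?_
  intro x y hxy
  by_contra hcon
  refine hxy (Subtype.ext (Matrix.ext fun i j => ?_))
  by_contra hne
  exact hcon ⟨_, ⟨_, entry_mem_separableAlgebra i j, rfl⟩, hne⟩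

/-! ### Continuous finite dimensional representations are smooth. -/

section Rep

variable {H : Type*} [NormedAddCommGroup H] [InnerProductSpace ℂ H] [CompleteSpace H]
  [FiniteDimensional ℂ H]

theorem continuous_rep {π : SU3 →* unitary (H →L[ℂ] H)}
    (hc : ∀ v : H, Continuous fun g => (π g : H →L[ℂ] H) v) :
    Continuous fun g => (π g : H →L[ℂ] H) :=
  continuous_clm_apply.2 hc

theorem norm_rep_le (π : SU3 →* unitary (H →L[ℂ] H)) (g : SU3) : ‖(π g : H →L[ℂ] H)‖ ≤ 1 :=
  ContinuousLinearMap.opNorm_le_bound _ zero_le_one fun x => by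
    rw [ContinuousLinearMap.norm_map_of_mem_unitary (π g).2, one_mul]

/-- The smearing `∫ φ(g) π(g) dg`. -/
def smear (π : SU3 →* unitary (H →L[ℂ] H)) (φ : SU3 → ℂ) : H →L[ℂ] H :=
  ∫ g, φ g • (π g : H →L[ℂ] H) ∂haarSU3

theorem integrable_smear {π : SU3 →* unitary (H →L[ℂ] H)}
    (hc : ∀ v : H, Continuous fun g => (π g : H →L[ℂ] H) v) (φ : C(SU3, ℂ)) :
    Integrable (fun g => φ g • (π g : H →L[ℂ] H)) haarSU3 :=
  have : SecondCountableTopology (H →L[ℂ] H) := by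
    have := FiniteDimensional.proper ℂ (H →L[ℂ] H)
    infer_instance
  integrable_haar_of_continuous (φ.continuous.smul (continuous_rep hc))

/-- Some separable function acts as the identity. -/
theorem exists_smear_eq_one {π : SU3 →* unitary (H →L[ℂ] H)}
    (hc : ∀ v : H, Continuous fun g => (π g : H →L[ℂ] H) v) :
    ∃ φ : C(SU3, ℂ), IsSeparable φ ∧ smear π φ = 1 := by
  let Q : C(SU3, ℂ) →ₗ[ℂ] (H →L[ℂ] H) :=
    { toFun := fun φ => smear π φ
      map_add' := fun φ ψ => by
        simp only [smear, ContinuousMap.add_apply, add_smul]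
        exact integral_add (integrable_smear hc φ) (integrable_smear hc ψ)
      map_smul' := fun c φ => by
        simp only [smear, ContinuousMap.smul_apply, smul_assoc, RingHom.id_apply]
        exact integral_smul _ _ }
  have hQ : ∀ φ, ‖Q φ‖ ≤ ‖φ‖ := fun φ => by
    refine (norm_integral_le_of_norm_le_const (C := ‖φ‖) (ae_of_all _ fun g => ?_)).trans ?_
    · rw [norm_smul]
      exact (mul_le_of_le_one_right (norm_nonneg _) (norm_rep_le π g)).trans (φ.norm_coe_le_norm g)
    · simp
  let S := (separableAlgebra.toSubalgebra.toSubmodule).map Q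
  -- The image of the dense algebra is a subspace of a finite dimensional space, hence closed. So it
  -- is enough to approximate the identity, and the approximation gives it exactly.
  have hS : IsClosed (S : Set (H →L[ℂ] H)) := S.closed_of_finiteDimensional
  suffices (1 : H →L[ℂ] H) ∈ S by
    obtain ⟨φ, h1, h2⟩ := this
    exact ⟨φ, h1, h2⟩
  suffices (1 : H →L[ℂ] H) ∈ closure (S : Set (H →L[ℂ] H)) by rwa [hS.closure_eq] at this
  rw [Metric.mem_closure_iff]
  intro ε hε
  let U : Set SU3 := {g | ‖(π g : H →L[ℂ] H) - 1‖ < ε / 2}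
  have hU : IsOpen U :=
    isOpen_lt ((continuous_rep hc).sub continuous_const).norm continuous_const
  have h1U : (1 : SU3) ∈ U := by simp [U, hε]
  obtain ⟨f, hf0, hf1, hf⟩ := exists_continuous_zero_one_of_isClosed hU.isClosed_compl
    (isClosed_singleton (x := (1 : SU3))) (by simpa using h1U)
  have hpos : 0 < ∫ g, f g ∂haarSU3 := by
    refine f.continuous.integral_pos_of_hasCompactSupport_nonneg_nonzero
      (HasCompactSupport.of_compactSpace _) (fun x => (hf x).1) (x := 1) ?_
    rw [hf1 rfl]; simp
  set I := ∫ g, f g ∂haarSU3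
  -- A bump function of total mass 1 supported where π is within ε/2 of the identity; its smearing
  -- is equally close to the identity.
  let φ : C(SU3, ℂ) := ⟨fun g => ((I⁻¹ * f g : ℝ) : ℂ), by fun_prop⟩
  have hφ : ‖Q φ - 1‖ ≤ ε / 2 := by
    have h1 : (1 : H →L[ℂ] H) = ∫ g, φ g • (1 : H →L[ℂ] H) ∂haarSU3 := by
      rw [integral_smul_const]
      simp only [φ, ContinuousMap.coe_mk]
      rw [integral_complex_ofReal, integral_const_mul, inv_mul_cancel₀ hpos.ne']
      simp
    have h2 : Q φ - 1 = ∫ g, φ g • ((π g : H →L[ℂ] H) - 1) ∂haarSU3 := by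
      nth_rewrite 1 [h1]
      simp only [smul_sub]
      rw [integral_sub (integrable_smear hc φ)]
      · rfl
      · exact (integrable_haar_of_continuous φ.continuous).smul_const _
    have h3 : ∫ g, I⁻¹ * f g * (ε / 2) ∂haarSU3 = ε / 2 := by
      rw [integral_mul_const, integral_const_mul, inv_mul_cancel₀ hpos.ne', one_mul]
    rw [h2, ← h3]
    refine norm_integral_le_of_norm_le ?_ (ae_of_all _ fun g => ?_)
    · exact integrable_haar_of_continuous (by fun_prop)
    · have hnn : 0 ≤ I⁻¹ * f g := mul_nonneg (inv_nonneg.2 hpos.le) (hf g).1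
      have : ‖φ g‖ = I⁻¹ * f g := by
        simp only [φ, ContinuousMap.coe_mk]
        rw [Complex.norm_real, Real.norm_of_nonneg hnn]
      rw [norm_smul, this]
      by_cases hg : g ∈ U
      · exact mul_le_mul_of_nonneg_left (le_of_lt hg) hnn
      · rw [hf0 hg]; simp
  have hd : φ ∈ closure (separableAlgebra : Set C(SU3, ℂ)) := by
    have : φ ∈ separableAlgebra.topologicalClosure := by
      rw [separableAlgebra_dense]; trivial
    exact this
  obtain ⟨ψ, hψ, hψφ⟩ := Metric.mem_closure_iff.1 hd (ε / 2) (half_pos hε)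
  refine ⟨Q ψ, ⟨ψ, hψ, rfl⟩, ?_⟩
  rw [dist_comm, dist_eq_norm]
  have : Q ψ - 1 = Q (ψ - φ) + (Q φ - 1) := by rw [map_sub]; abel
  rw [this]
  refine (norm_add_le _ _).trans_lt ?_
  rw [dist_comm, dist_eq_norm] at hψφ
  linarith [hQ (ψ - φ)]

/-- If φ is separable and acts as the identity, then π(h) = ∫ φ(g) π(hg) dg = ∫ φ(h⁻¹g) π(g) dg, by
invariance of the Haar measure. Separability makes the last integral a finite combination of fixed
operators whose coefficients are smooth in h at 1. -/
theorem isSmoothAtOne_rep {π : SU3 →* unitary (H →L[ℂ] H)}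
    (hc : ∀ v : H, Continuous fun g => (π g : H →L[ℂ] H) v) :
    IsSmoothAtOne fun g => (π g : H →L[ℂ] H) := by
  obtain ⟨φ, ⟨n, a, b, ha, hab⟩, hφ⟩ := exists_smear_eq_one hc
  have key : ∀ h, (π h : H →L[ℂ] H) = ∑ i, a i h • smear π (b i) := fun h => by
    have h1 : (π h : H →L[ℂ] H) = ∫ g, φ g • ((π h : H →L[ℂ] H) * (π g : H →L[ℂ] H)) ∂haarSU3 := by
      have := ContinuousLinearMap.integral_comp_comm
        (ContinuousLinearMap.mul ℂ (H →L[ℂ] H) (π h : H →L[ℂ] H)) (integrable_smear hc φ)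
      simp only [ContinuousLinearMap.mul_apply', mul_smul_comm] at this
      rw [this]
      change _ = (π h : H →L[ℂ] H) * smear π φ
      rw [hφ, mul_one]
    have h2 := integral_mul_left_eq_self (μ := haarSU3)
      (fun g => φ (h⁻¹ * g) • (π g : H →L[ℂ] H)) h
    simp only [inv_mul_cancel_left, map_mul, Submonoid.coe_mul] at h2
    rw [h1, h2]
    simp only [hab, Finset.sum_smul]
    rw [integral_finsetSum]
    · refine Finset.sum_congr rfl fun i _ => ?_
      simp only [mul_smul]
      exact integral_smul (a i h) fun g => b i g • (π g : H →L[ℂ] H)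
    · intro i _
      simpa only [mul_smul, Pi.smul_def] using (integrable_smear hc (b i)).smul (a i h)
  have : (fun g => (π g : H →L[ℂ] H)) = fun h => ∑ i, a i h • smear π (b i) := funext key
  rw [this]
  exact IsSmoothAtOne.sum fun i => (ha i).smul_const _

end Rep

/-! ### The derived representation -/

section ExpCurve

attribute [local instance] Matrix.linftyOpNormedRing Matrix.linftyOpNormedAlgebra

theorem hasDerivAt_exp_smul (Y : Mat3) (t : ℝ) :
    HasDerivAt (fun u : ℝ => NormedSpace.exp (u • Y)) (NormedSpace.exp (t • Y) * Y) t :=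
  hasDerivAt_exp_smul_const Y t

theorem hasDerivAt_matrix_entry {f : ℝ → Mat3} {f' : Mat3} {t : ℝ} (h : HasDerivAt f f' t)
    (i j : Fin 3) : HasDerivAt (fun u => f u i j) (f' i j) t := by
  let l : Mat3 →ₗ[ℝ] ℂ :=
    { toFun := fun Z => Z i j, map_add' := fun _ _ => rfl, map_smul' := fun _ _ => rfl }
  have := l.toContinuousLinearMap.hasFDerivAt.comp_hasDerivAt t h
  exact this

theorem hasVelocity_expSU3 (Y : su3) : HasVelocity (fun t => expSU3 (t • Y)) (Y : Mat3) := by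
  constructor
  · simp [expSU3, NormedSpace.exp_zero]
  · intro i j
    have := hasDerivAt_matrix_entry (hasDerivAt_exp_smul (Y : Mat3) 0) i j
    rw [zero_smul, NormedSpace.exp_zero, one_mul] at this
    exact this

theorem expSU3_add (Y : su3) (s t : ℝ) :
    expSU3 ((s + t) • Y) = expSU3 (s • Y) * expSU3 (t • Y) := by
  refine Subtype.ext ?_
  simp only [expSU3, Submonoid.coe_mul, add_smul, Submodule.coe_add, Submodule.coe_smul]
  exact Matrix.exp_add_of_commute _ _
    (((Commute.refl (Y : Mat3)).smul_left s).smul_right t)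

theorem expSU3_zero : expSU3 0 = 1 := by
  refine Subtype.ext ?_
  simp [expSU3, NormedSpace.exp_zero]

theorem expSU3_inv (Y : su3) : (expSU3 Y)⁻¹ = expSU3 (-Y) := by
  have h := expSU3_add Y 1 (-1)
  have h' : (-1 : ℝ) • Y = -Y := Subtype.ext (by simp)
  rw [add_neg_cancel, h', one_smul, zero_smul, expSU3_zero] at h
  exact inv_eq_of_mul_eq_one_right h.symm

/-- The derivative of `t ↦ ℓ (exp (tY) Z exp (-tY))` for a linear map `ℓ`. -/
theorem hasDerivAt_linear_conj {E : Type*} [NormedAddCommGroup E] [NormedSpace ℝ E]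
    (l : Mat3 →ₗ[ℝ] E) (Y : su3) (Z : Mat3) :
    HasDerivAt (fun t : ℝ => l ((expSU3 (t • Y) : Mat3) * Z * (((expSU3 (t • Y))⁻¹ : SU3) : Mat3)))
      (l ((Y : Mat3) * Z - Z * (Y : Mat3))) 0 := by
  have h1 := hasDerivAt_exp_smul (Y : Mat3) 0
  have h2 := hasDerivAt_exp_smul (-(Y : Mat3)) 0
  have h3 := (h1.fun_mul (hasDerivAt_const 0 Z)).fun_mul h2
  have h4 := l.toContinuousLinearMap.hasFDerivAt.comp_hasDerivAt 0 h3
  simp only [expSU3_inv]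
  convert! h4 using 1
  · funext t
    simp [expSU3]
  · rw [zero_smul, zero_smul, NormedSpace.exp_zero]
    simp only [one_mul, mul_zero, add_zero, mul_one, mul_neg, sub_eq_add_neg]
    rfl

end ExpCurve

/-- The projection of a matrix to `su(3)`. -/
def skewPart : Mat3 →ₗ[ℝ] Mat3 where
  toFun Z := (1 / 2 : ℂ) • (Z - Zᴴ) - ((Z - Zᴴ).trace / 6) • (1 : Mat3)
  map_add' Z Z' := by
    simp only [Matrix.conjTranspose_add, Matrix.trace_add, Matrix.trace_sub]
    module
  map_smul' c Z := by
    have : (c • Z)ᴴ = c • Zᴴ := by simp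
    simp only [this, Matrix.trace_sub, Matrix.trace_smul, RingHom.id_apply, ← smul_sub]
    rw [smul_comm, smul_sub c ((1 / 2 : ℂ) • (Z - Zᴴ)), ← smul_assoc c (_ / 6 : ℂ),
      smul_div_assoc]

theorem skewPart_apply (Z : Mat3) :
    skewPart Z = (1 / 2 : ℂ) • (Z - Zᴴ) - ((Z - Zᴴ).trace / 6) • (1 : Mat3) := rfl

theorem skewPart_mem (Z : Mat3) : skewPart Z ∈ su3 := by
  constructor
  · simp only [skewPart_apply, Matrix.conjTranspose_sub, Matrix.conjTranspose_smul,
      Matrix.conjTranspose_conjTranspose, Matrix.conjTranspose_one, Matrix.trace_sub]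
    rw [Matrix.trace_conjTranspose]
    simp only [star_div₀, star_sub, star_star, star_one, star_ofNat]
    module
  · simp only [skewPart_apply, Matrix.trace_sub, Matrix.trace_smul, Matrix.trace_one]
    simp only [Fintype.card_fin, smul_eq_mul]
    push_cast; ring

theorem skewPart_of_mem {Y : Mat3} (hY : Y ∈ su3) : skewPart Y = Y := by
  rw [skewPart_apply, hY.1, Matrix.trace_sub, Matrix.trace_neg, hY.2]
  simp only [sub_neg_eq_add, neg_zero, zero_div, zero_smul, sub_zero]
  module

theorem skewPart_I_smul_of_mem {Y : Mat3} (hY : Y ∈ su3) : skewPart (Complex.I • Y) = 0 := by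
  rw [skewPart_apply, Matrix.conjTranspose_smul, hY.1, Matrix.trace_sub]
  simp

theorem eq_skewPart_add (Z : Mat3) :
    Z = skewPart Z + Complex.I • skewPart (-(Complex.I • Z)) + (Z.trace / 3) • (1 : Mat3) := by
  simp only [skewPart_apply, Matrix.conjTranspose_smul, Matrix.conjTranspose_neg, Matrix.trace_sub,
    Matrix.trace_neg, Matrix.trace_smul, Complex.star_def, Complex.conj_I]
  match_scalars
  · linear_combination (1 / 2 : ℂ) * Complex.I_sq
  · linear_combination (1 / 2 : ℂ) * Complex.I_sq
  · simp only [smul_eq_mul]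
    linear_combination (-Z.trace / 6 - Zᴴ.trace / 6) * Complex.I_sq

/-- Complex linear equations between matrices need to be checked only on `su(3)` and at `1`. -/
theorem su3_induction {P : Mat3 → Prop} (hsu : ∀ Y : su3, P (Y : Mat3)) (h1 : P 1)
    (hadd : ∀ Z Z', P Z → P Z' → P (Z + Z')) (hsmul : ∀ (c : ℂ) Z, P Z → P (c • Z)) (Z : Mat3) :
    P Z := by
  rw [eq_skewPart_add Z]
  exact hadd _ _ (hadd _ _ (hsu ⟨_, skewPart_mem _⟩) (hsmul _ _ (hsu ⟨_, skewPart_mem _⟩)))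
    (hsmul _ _ h1)

section Rep

variable {H : Type*} [NormedAddCommGroup H] [InnerProductSpace ℂ H] [CompleteSpace H]

open Classical in
/-- The derivative of `π` at `1`. -/
def lieR (π : SU3 →* unitary (H →L[ℂ] H)) : Mat3 →ₗ[ℝ] (H →L[ℂ] H) :=
  if h : IsSmoothAtOne fun g => (π g : H →L[ℂ] H) then h.choose else 0

/-- The derived representation, extended complex linearly to all matrices, with value `0` at
the identity matrix. -/
def lieD (π : SU3 →* unitary (H →L[ℂ] H)) : Mat3 →ₗ[ℂ] (H →L[ℂ] H) where
  toFun Z := lieR π (skewPart Z) + Complex.I • lieR π (skewPart (-(Complex.I • Z)))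
  map_add' Z Z' := by
    simp only [smul_add, neg_add, map_add]
    abel
  map_smul' c Z := by
    have hc : ∀ Z : Mat3, c • Z = c.re • Z + c.im • (Complex.I • Z) := fun Z => by
      nth_rewrite 1 [← Complex.re_add_im c]
      rw [add_smul, mul_smul]
      rfl
    have hc' : ∀ A : H →L[ℂ] H, c • A = c.re • A + c.im • (Complex.I • A) := fun A => by
      nth_rewrite 1 [← Complex.re_add_im c]
      rw [add_smul, mul_smul]
      rfl
    have h2 : -(Complex.I • c • Z) = c.re • (-(Complex.I • Z)) + c.im • Z := by
      rw [hc Z, smul_add, smul_comm Complex.I c.im, smul_smul Complex.I, smul_comm Complex.I c.re,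
        Complex.I_mul_I]
      module
    rw [h2, hc Z, RingHom.id_apply, hc']
    simp only [map_add, map_smul, map_neg, smul_add, smul_neg]
    rw [smul_smul Complex.I Complex.I, Complex.I_mul_I]
    simp only [smul_comm Complex.I c.re, smul_comm Complex.I c.im]
    module

theorem lieD_of_mem (π : SU3 →* unitary (H →L[ℂ] H)) {Y : Mat3} (hY : Y ∈ su3) :
    lieD π Y = lieR π Y := by
  change lieR π (skewPart Y) + Complex.I • lieR π (skewPart (-(Complex.I • Y))) = _
  rw [map_neg, skewPart_I_smul_of_mem hY, skewPart_of_mem hY]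
  simp

theorem lieD_one (π : SU3 →* unitary (H →L[ℂ] H)) : lieD π 1 = 0 := by
  have h1 : skewPart 1 = 0 := by simp [skewPart_apply]
  have h2 : skewPart (-(Complex.I • 1)) = 0 := by
    rw [skewPart_apply]
    simp only [Matrix.conjTranspose_neg, Matrix.conjTranspose_smul, Matrix.conjTranspose_one,
      Complex.star_def, Complex.conj_I, Matrix.trace_sub, Matrix.trace_neg, Matrix.trace_smul,
      Matrix.trace_one, Fintype.card_fin, smul_eq_mul]
    match_scalars
    ring
  change lieR π (skewPart 1) + Complex.I • lieR π (skewPart (-(Complex.I • 1))) = _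
  rw [h1, h2]
  simp

variable [FiniteDimensional ℂ H] {π : SU3 →* unitary (H →L[ℂ] H)}
  (hc : ∀ v : H, Continuous fun g => (π g : H →L[ℂ] H) v)

include hc

/-- Continuity excludes the default value of `lieR`. Its linear map comes from a choice that is
determined only by velocities in `su3`, which is why `lieD` evaluates it at values of `skewPart`
only. -/
theorem hasDerivAt_rep {γ : ℝ → SU3} {Y : su3} (h : HasVelocity γ Y) :
    HasDerivAt (fun t => (π (γ t) : H →L[ℂ] H)) (lieD π Y) 0 := by
  rw [lieD_of_mem π Y.2, lieR, dif_pos (isSmoothAtOne_rep hc)]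
  exact (isSmoothAtOne_rep hc).choose_spec γ Y h

/-- For Z in `su3`, differentiate π(g exp(tZ) g⁻¹) in two ways; the rest is complex linearity. -/
theorem lieD_conj (g : SU3) (Z : Mat3) :
    lieD π ((g : Mat3) * Z * ((g⁻¹ : SU3) : Mat3)) =
      (π g : H →L[ℂ] H) * lieD π Z * (π g⁻¹ : H →L[ℂ] H) := by
  induction Z using su3_induction with
  | hsu Y =>
    have hmem : (g : Mat3) * Y * ((g⁻¹ : SU3) : Mat3) ∈ su3 := by
      refine ⟨?_, ?_⟩
      · rw [coe_inv_eq]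
        simp [Y.2.1, mul_assoc]
      · rw [Matrix.trace_mul_comm, ← mul_assoc, coe_inv_mul, one_mul, Y.2.2]
    have hv : HasVelocity (fun t => g * expSU3 (t • Y) * g⁻¹)
        ((⟨_, hmem⟩ : su3) : Mat3) := by
      have := hasVelocity_expSU3 Y
      constructor
      · simp [expSU3_zero]
      · intro i j
        simp only [Submonoid.coe_mul, Matrix.mul_apply]
        refine HasDerivAt.fun_sum fun l _ => HasDerivAt.mul_const ?_ _
        exact HasDerivAt.fun_sum fun k _ => (this.2 k l).const_mul _
    have h1 := hasDerivAt_rep hc hv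
    have h2 := ((hasDerivAt_rep hc (hasVelocity_expSU3 Y)).const_mul (π g : H →L[ℂ] H)).mul_const
      (π g⁻¹ : H →L[ℂ] H)
    simp only [map_mul, Submonoid.coe_mul] at h1
    exact h1.unique h2
  | h1 => rw [mul_one, coe_mul_inv, lieD_one]; simp
  | hadd Z Z' h h' => rw [mul_add, add_mul, map_add, h, h', map_add, mul_add, add_mul]
  | hsmul c Z h =>
    rw [Matrix.mul_smul, Matrix.smul_mul, map_smul, h, map_smul, mul_smul_comm, smul_mul_assoc]

theorem hasDerivAt_rep_conj (Y : su3) (A : H →L[ℂ] H) :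
    HasDerivAt (fun t : ℝ => (π (expSU3 (t • Y)) : H →L[ℂ] H) * A * (π (expSU3 (t • Y))⁻¹ : H →L[ℂ] H))
      (lieD π Y * A - A * lieD π Y) 0 := by
  have h1 := hasDerivAt_rep hc (hasVelocity_expSU3 Y)
  have h2 := hasDerivAt_rep hc (hasVelocity_expSU3 (-Y))
  have h3 := (h1.mul_const A).fun_mul h2
  have h0 : (0 : ℝ) • -Y = 0 := Subtype.ext (by simp)
  have h0' : (0 : ℝ) • Y = 0 := Subtype.ext (by simp)
  have hn : lieD π ((-Y : su3) : Mat3) = -lieD π Y := by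
    rw [← map_neg]; rfl
  rw [h0, h0', hn, expSU3_zero, map_one] at h3
  convert! h3 using 1
  · funext t
    have : t • -Y = -(t • Y) := Subtype.ext (by simp)
    rw [this, expSU3_inv]
  · simp [sub_eq_add_neg]

/-- This is the derivative at t = 0 of `lieD_conj` along g = exp(tY). -/
theorem lieD_commutator (Z Z' : Mat3) :
    lieD π (Z * Z' - Z' * Z) = lieD π Z * lieD π Z' - lieD π Z' * lieD π Z := by
  induction Z using su3_induction with
  | hsu Y =>
    have h1 := hasDerivAt_rep_conj hc Y (lieD π Z')
    have h2 := hasDerivAt_linear_conj ((lieD π).restrictScalars ℝ) Y Z'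
    simp only [LinearMap.coe_restrictScalars, lieD_conj hc] at h2
    exact (h1.unique h2).symm
  | h1 => simp [lieD_one]
  | hadd Z W h h' =>
    rw [add_mul, mul_add, add_sub_add_comm, map_add, h, h', map_add, add_mul, mul_add]
    abel
  | hsmul c Z h =>
    rw [Matrix.mul_smul, Matrix.smul_mul, ← smul_sub, map_smul, h, map_smul, mul_smul_comm,
      smul_mul_assoc, smul_sub]

theorem star_lieD (Z : Mat3) : star (lieD π Z) = lieD π Zᴴ := by
  induction Z using su3_induction with
  | hsu Y =>
    have h1 := (hasDerivAt_rep hc (hasVelocity_expSU3 Y)).star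
    have h2 := hasDerivAt_rep hc (hasVelocity_expSU3 (-Y))
    have h3 : (fun t : ℝ => (π (expSU3 (t • -Y)) : H →L[ℂ] H)) =
        fun t => star (π (expSU3 (t • Y)) : H →L[ℂ] H) := by
      funext t
      rw [smul_neg, ← expSU3_inv, map_inv]
      rfl
    rw [h3] at h2
    rw [h1.unique h2, Y.2.1]
    rfl
  | h1 => simp [lieD_one]
  | hadd Z W h h' => rw [map_add, star_add, h, h', Matrix.conjTranspose_add, map_add]
  | hsmul c Z h => rw [map_smul, star_smul, h, Matrix.conjTranspose_smul, map_smul]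

theorem hasDerivAt_rep_exp (Y : su3) (t : ℝ) :
    HasDerivAt (fun t : ℝ => (π (expSU3 (t • Y)) : H →L[ℂ] H))
      ((π (expSU3 (t • Y)) : H →L[ℂ] H) * lieD π Y) t := by
  have h1 := (hasDerivAt_rep hc (hasVelocity_expSU3 Y)).const_mul (π (expSU3 (t • Y)) : H →L[ℂ] H)
  have h2 := HasDerivAt.comp_add_const (x := t) (a := -t) (by simpa using h1)
  convert! h2 using 1
  funext u
  rw [← Submonoid.coe_mul, ← map_mul, ← expSU3_add]
  simp

theorem hasLieAction_lieD (Y : su3) (v : H) : HasLieAction (hilbRep π) Y v (lieD π Y v) := by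
  have h1 := (((ContinuousLinearMap.apply ℂ H v).restrictScalars ℝ).hasFDerivAt).comp_hasDerivAt
    (0 : ℝ) (hasDerivAt_rep hc (hasVelocity_expSU3 Y))
  have := h1.tendsto_slope_zero
  have h0 : (0 : ℝ) • Y = 0 := Subtype.ext (by simp)
  simp only [Function.comp_apply, zero_add, h0, expSU3_zero, map_one] at this
  exact this

end Rep

/-! ### Surjectivity of the exponential map -/

/-- The circle is infinite and the spectrum is finite. The scalar c moves the eigenvalue -1, at
which the Cayley transform is undefined, out of the spectrum. -/
theorem exists_unit_det_one_add_ne_zero (g : Mat3) :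
    ∃ c : ℂ, ‖c‖ = 1 ∧ (1 + c • g).det ≠ 0 := by
  have hfin : (g.charpoly.roots.toFinset : Set ℂ).Finite := Finset.finite_toSet _
  have hinf : (Metric.sphere (0 : ℂ) 1).Infinite := by
    -- The points exp(in) are distinct because π is irrational.
    refine Set.infinite_of_injective_forall_mem (f := fun n : ℕ => Complex.exp (Complex.I * n)) ?_ ?_
    · intro m n h
      rw [Complex.exp_eq_exp_iff_exists_int] at h
      obtain ⟨k, hk⟩ := h
      have h1 : (m : ℝ) = n + k * (2 * Real.pi) := by
        have h2 : Complex.I * (m : ℂ) = Complex.I * (n + k * (2 * Real.pi)) := by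
          rw [hk]; ring
        have := mul_left_cancel₀ Complex.I_ne_zero h2
        exact_mod_cast this
      by_contra hne
      have hk0 : (k : ℝ) ≠ 0 := by
        intro h0
        rw [h0] at h1
        exact hne (by simpa using h1)
      have h3 : Real.pi = ((m : ℤ) - n : ℤ) / ((2 * k : ℤ) : ℝ) := by
        field_simp
        push_cast
        field_simp
        linarith
      exact irrational_pi ⟨(((m : ℤ) - n : ℤ) / ((2 * k : ℤ)) : ℚ), by rw [h3]; push_cast; ring⟩
    · intro n
      simp [mul_comm Complex.I, ← Complex.ofReal_natCast, Complex.norm_exp_ofReal_mul_I]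
  obtain ⟨z, hz, hz'⟩ := (hinf.sdiff hfin).nonempty
  have hzn : ‖z‖ = 1 := by simpa using hz
  have hz0 : z ≠ 0 := by
    intro h; rw [h] at hzn; simp at hzn
  refine ⟨-z⁻¹, by simp [hzn], fun h => hz' ?_⟩
  have hroot : g.charpoly.eval z = 0 := by
    rw [Matrix.eval_charpoly]
    have : Matrix.scalar (Fin 3) z - g = z • (1 + (-z⁻¹) • g) := by
      rw [smul_add, smul_smul, mul_neg, mul_inv_cancel₀ hz0]
      simp [Matrix.smul_one_eq_diagonal, sub_eq_add_neg]
    rw [this, Matrix.det_smul, h, mul_zero]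
  simp only [Finset.mem_coe, Multiset.mem_toFinset]
  exact (Polynomial.mem_roots (Matrix.charpoly_monic g).ne_zero).2 hroot

/-- Unitary matrices are diagonalised by unitary matrices (by the Cayley transform). -/
theorem exists_unitary_diagonal {g : Mat3} (hg : gᴴ * g = 1) :
    ∃ (U : Mat3) (d : Fin 3 → ℂ), U * Uᴴ = 1 ∧ Uᴴ * U = 1 ∧ g = U * Matrix.diagonal d * Uᴴ := by
  obtain ⟨c, hc, hdet⟩ := exists_unit_det_one_add_ne_zero g
  have hcc : star c * c = 1 := by
    rw [Complex.star_def, ← Complex.normSq_eq_conj_mul_self, Complex.normSq_eq_norm_sq, hc]; simp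
  have hc0 : c ≠ 0 := by
    intro h; rw [h] at hc; simp at hc
  set h : Mat3 := c • g with hh
  have hu : hᴴ * h = 1 := by
    rw [hh, Matrix.conjTranspose_smul, Matrix.smul_mul, Matrix.mul_smul, smul_smul, hcc, hg, one_smul]
  have hunit : IsUnit (1 + h).det := isUnit_iff_ne_zero.2 hdet
  have hK : (1 + h) * (1 + h)⁻¹ = 1 := Matrix.mul_nonsing_inv _ hunit
  have hK' : (1 + h)⁻¹ * (1 + h) = 1 := Matrix.nonsing_inv_mul _ hunit
  set A : Mat3 := Complex.I • ((1 - h) * (1 + h)⁻¹) with hA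
  have hAK : A * (1 + h) = Complex.I • (1 - h) := by
    rw [hA, Matrix.smul_mul, mul_assoc, hK', mul_one]
  have hherm : A.IsHermitian := by
    -- Both sides are polynomial in h and its adjoint, so that the relation `hu` suffices; the
    -- invertible outer factors are cancelled afterwards.
    have e1 : (1 + h)ᴴ * A * (1 + h) = (1 + h)ᴴ * Aᴴ * (1 + h) := by
      have : (1 + h)ᴴ * Aᴴ = (Complex.I • (1 - h))ᴴ := by rw [← Matrix.conjTranspose_mul, hAK]
      rw [this, mul_assoc, hAK]
      simp only [Matrix.conjTranspose_add, Matrix.conjTranspose_one, Matrix.conjTranspose_smul,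
        Matrix.conjTranspose_sub, Complex.star_def, Complex.conj_I, Matrix.mul_smul, neg_smul]
      rw [← smul_neg, Matrix.smul_mul]
      congr 1
      simp only [add_mul, mul_sub, neg_mul, sub_mul, mul_add, hu, one_mul, mul_one]
      abel
    have hKs : IsUnit (1 + h)ᴴ.det := by
      rw [Matrix.det_conjTranspose]
      exact hunit.star
    have e2 := congrArg (fun M => (1 + h)ᴴ⁻¹ * (M * (1 + h)⁻¹)) e1
    simp only [mul_assoc, hK, mul_one] at e2
    rw [Matrix.nonsing_inv_mul_cancel_left _ _ hKs, Matrix.nonsing_inv_mul_cancel_left _ _ hKs] at e2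
    exact e2.symm
  have hS := hherm.spectral_theorem
  rw [Unitary.conjStarAlgAut_apply] at hS
  set U : Mat3 := (hherm.eigenvectorUnitary : Mat3) with hU
  have hUU : U * Uᴴ = 1 := Unitary.coe_mul_star_self hherm.eigenvectorUnitary
  have hUU' : Uᴴ * U = 1 := Unitary.coe_star_mul_self hherm.eigenvectorUnitary
  set D := Matrix.diagonal (RCLike.ofReal ∘ hherm.eigenvalues : Fin 3 → ℂ) with hD
  have hUA : Uᴴ * A = D * Uᴴ := by
    rw [hS, Matrix.star_eq_conjTranspose, ← mul_assoc, ← mul_assoc, hUU', one_mul]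
  have hmain : (D + Complex.I • 1) * (Uᴴ * h * U) = Complex.I • 1 - D := by
    have h1 : A * h + Complex.I • h = Complex.I • 1 - A := by
      rw [mul_add, mul_one, smul_sub] at hAK
      rw [eq_sub_iff_add_eq, add_right_comm, add_comm (A * h), hAK]
      abel
    have h2 := congrArg (fun M => Uᴴ * M * U) h1
    simp only [mul_add, add_mul, mul_sub, sub_mul, ← mul_assoc, hUA, Matrix.mul_smul,
      Matrix.smul_mul, mul_one] at h2
    rw [mul_assoc D Uᴴ U, hUU', mul_one] at h2
    rw [add_mul, Matrix.smul_mul, one_mul, ← h2]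
    simp only [mul_assoc]
  have hdiag : (Uᴴ * g * U).IsDiag := by
    intro j k hjk
    have h1 := congrFun (congrFun hmain j) k
    have h2 : Complex.I • (1 : Mat3) = Matrix.diagonal fun _ => Complex.I :=
      Matrix.smul_one_eq_diagonal _
    rw [h2, hD, Matrix.diagonal_add, Matrix.diagonal_mul, Matrix.sub_apply,
      Matrix.diagonal_apply_ne _ hjk, Matrix.diagonal_apply_ne _ hjk, sub_zero, hh, Matrix.mul_smul,
      Matrix.smul_mul, Matrix.smul_apply, smul_eq_mul] at h1
    -- The eigenvalues of the Cayley transform are real, so adding i never gives zero and the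
    -- off-diagonal entries of `hmain` can be divided by this factor.
    have h3 : ((RCLike.ofReal ∘ hherm.eigenvalues : Fin 3 → ℂ) j + Complex.I) ≠ 0 := by
      intro h0
      have := congrArg Complex.im h0
      simp at this
    exact ((mul_eq_zero.1 ((mul_eq_zero.1 h1).resolve_left h3)).resolve_left hc0)
  refine ⟨U, Matrix.diag (Uᴴ * g * U), hUU, hUU', ?_⟩
  rw [hdiag.diagonal_diag]
  calc g = (U * Uᴴ) * g * (U * Uᴴ) := by rw [hUU, one_mul, mul_one]
    _ = _ := by simp only [mul_assoc]

/-- The element of `su(3)` with the diagonal entries `iθ₀`, `iθ₁`, `-i(θ₀ + θ₁)`. -/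
def torusElt (θ₀ θ₁ : ℝ) : su3 :=
  ⟨Matrix.diagonal ![Complex.I * θ₀, Complex.I * θ₁, -(Complex.I * (θ₀ + θ₁))], by
    refine ⟨?_, ?_⟩
    · rw [Matrix.diagonal_conjTranspose, Matrix.diagonal_neg]
      congr 1
      funext i
      fin_cases i <;> simp
    · rw [Matrix.trace_diagonal, Fin.sum_univ_three]
      simp; ring⟩

theorem exp_torusElt (θ₀ θ₁ : ℝ) : (expSU3 (torusElt θ₀ θ₁) : Mat3) =
    Matrix.diagonal ![Complex.exp (Complex.I * θ₀), Complex.exp (Complex.I * θ₁),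
      Complex.exp (-(Complex.I * (θ₀ + θ₁)))] := by
  simp only [expSU3, torusElt]
  rw [Matrix.exp_diagonal]
  congr 1
  funext i
  rw [Pi.coe_exp]
  fin_cases i <;> simp [Complex.exp_eq_exp_ℂ]

theorem eq_exp_torusElt {d : Fin 3 → ℂ} (hd : ∀ i, ‖d i‖ = 1) (hp : d 0 * d 1 * d 2 = 1) :
    Matrix.diagonal d = (expSU3 (torusElt (d 0).arg (d 1).arg) : Mat3) := by
  rw [exp_torusElt]
  have h : ∀ i, Complex.exp (Complex.I * (d i).arg) = d i := fun i => by
    have := Complex.norm_mul_exp_arg_mul_I (d i)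
    rw [hd i] at this
    rw [mul_comm]
    simpa using this
  congr 1
  funext i
  fin_cases i
  · exact (h 0).symm
  · exact (h 1).symm
  · change d 2 = Complex.exp (-(Complex.I * (((d 0).arg : ℂ) + ((d 1).arg : ℂ))))
    rw [Complex.exp_neg, mul_add, Complex.exp_add, h, h]
    exact eq_inv_of_mul_eq_one_right hp

theorem exists_torusElt_of_isDiag {t : SU3} (ht : (t : Mat3).IsDiag) :
    t = expSU3 (torusElt ((t : Mat3) 0 0).arg ((t : Mat3) 1 1).arg) := by
  refine Subtype.ext ?_
  have hd := ht.diagonal_diag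
  have h1 : (t : Mat3)ᴴ * (t : Mat3) = 1 := coe_inv_mul t
  have h2 : (t : Mat3).det = 1 := (Matrix.mem_specialUnitaryGroup_iff.1 t.2).2
  rw [← hd] at h1 h2
  rw [Matrix.diagonal_conjTranspose, Matrix.diagonal_mul_diagonal] at h1
  rw [Matrix.det_diagonal, Fin.prod_univ_three] at h2
  rw [← hd]
  refine eq_exp_torusElt (d := Matrix.diag (t : Mat3)) (fun i => ?_) h2
  have := congrFun (congrFun h1 i) i
  simp only [Matrix.diagonal_apply_eq, Matrix.one_apply_eq, Pi.star_apply] at this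
  rw [Complex.star_def, ← Complex.normSq_eq_conj_mul_self, Complex.normSq_eq_norm_sq] at this
  have h3 : ‖Matrix.diag (t : Mat3) i‖ ^ 2 = 1 := by exact_mod_cast this
  exact (pow_eq_one_iff_of_nonneg (norm_nonneg _) two_ne_zero).1 h3

/-- A unitary change of basis makes the element diagonal, and diagonal elements have logarithms
given by the arguments of their entries. The third argument is taken as minus the sum of the other
two, to keep the trace zero. -/
theorem expSU3_surjective : Function.Surjective expSU3 := by
  intro g
  obtain ⟨U, d, hU, hU', hgd⟩ := exists_unitary_diagonal (g := (g : Mat3)) (coe_inv_mul g)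
  have h1 : Matrix.diagonal d = Uᴴ * (g : Mat3) * U := by
    rw [hgd]
    simp only [mul_assoc, hU', mul_one]
    rw [← mul_assoc, hU', one_mul]
  have hdiag : Matrix.diagonal d ∈ Matrix.specialUnitaryGroup (Fin 3) ℂ := by
    rw [h1, Matrix.mem_specialUnitaryGroup_iff]
    constructor
    · rw [Matrix.mem_unitaryGroup_iff', Matrix.star_eq_conjTranspose]
      simp only [Matrix.conjTranspose_mul, Matrix.conjTranspose_conjTranspose]
      have : (g : Mat3)ᴴ * (g : Mat3) = 1 := coe_inv_mul g
      calc Uᴴ * ((g : Mat3)ᴴ * U) * (Uᴴ * (g : Mat3) * U)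
          = Uᴴ * ((g : Mat3)ᴴ * (U * Uᴴ) * (g : Mat3)) * U := by simp only [mul_assoc]
        _ = 1 := by rw [hU, mul_one, this, mul_one, hU']
    · rw [Matrix.det_mul, Matrix.det_mul, mul_right_comm, ← Matrix.det_mul, hU', Matrix.det_one,
        one_mul]
      exact (Matrix.mem_specialUnitaryGroup_iff.1 g.2).2
  have h2 := exists_torusElt_of_isDiag (t := ⟨_, hdiag⟩) (Matrix.isDiag_diagonal d)
  set Y := torusElt _ _
  have hinv : U⁻¹ = Uᴴ := Matrix.inv_eq_right_inv hU
  have hunit : IsUnit U := ⟨⟨U, Uᴴ, hU, hU'⟩, rfl⟩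
  have hmem : U * (Y : Mat3) * Uᴴ ∈ su3 := by
    refine ⟨?_, ?_⟩
    · simp [Y.2.1, mul_assoc]
    · rw [Matrix.trace_mul_comm, ← mul_assoc, hU', one_mul, Y.2.2]
  refine ⟨⟨_, hmem⟩, Subtype.ext ?_⟩
  have h3 : Matrix.diagonal d = NormedSpace.exp (Y : Mat3) := congrArg Subtype.val h2
  change NormedSpace.exp (U * (Y : Mat3) * Uᴴ) = (g : Mat3)
  rw [← hinv, Matrix.exp_conj _ _ hunit, ← h3, hinv, hgd]

/-! ### Highest weight vectors in unitary representations -/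

/-- The coroot `E_{jj} - E_{kk}`. -/
def coroot (j k : Fin 3) : Mat3 := Matrix.single j j 1 - Matrix.single k k 1

theorem torusElt_eq (θ₀ θ₁ : ℝ) : (torusElt θ₀ θ₁ : Mat3) =
    (Complex.I * θ₀) • coroot 0 1 + (Complex.I * (θ₀ + θ₁)) • coroot 1 2 := by
  ext i j
  fin_cases i <;> fin_cases j <;> simp [torusElt, coroot] ; try ring

theorem smul_torusElt (t θ₀ θ₁ : ℝ) : t • torusElt θ₀ θ₁ = torusElt (t * θ₀) (t * θ₁) := by
  refine Subtype.ext ?_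
  rw [Submodule.coe_smul, torusElt_eq, torusElt_eq, smul_add, ← smul_assoc, ← smul_assoc]
  simp only [Complex.real_smul]
  push_cast
  congr 2 <;> ring

section Equivariant

variable {V V' : Type*} [AddCommGroup V] [Module ℂ V] [AddCommGroup V'] [Module ℂ V']

theorem map_mem_weightSpace {ρ : Representation ℂ SU3 V} {ρ' : Representation ℂ SU3 V'}
    (L : V →ₗ[ℂ] V') (hL : ∀ g v, L (ρ g v) = ρ' g (L v)) {a : ℕ × ℕ} {v : V}
    (hv : v ∈ weightSpace ρ a) : L v ∈ weightSpace ρ' a := by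
  intro t ht
  rw [← hL, hv t ht, map_smul]

variable [TopologicalSpace V] [TopologicalSpace V']

theorem HasLieAction.map {ρ : Representation ℂ SU3 V} {ρ' : Representation ℂ SU3 V'}
    {L : V →ₗ[ℂ] V'} (hL : ∀ g v, L (ρ g v) = ρ' g (L v)) (hLc : Continuous L) {Y : su3} {v w : V}
    (h : HasLieAction ρ Y v w) : HasLieAction ρ' Y (L v) (L w) := by
  have := (hLc.tendsto w).comp h
  refine this.congr fun t => ?_
  simp [hL]

theorem IsHighest.map {ρ : Representation ℂ SU3 V} {ρ' : Representation ℂ SU3 V'}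
    {L : V →ₗ[ℂ] V'} (hL : ∀ g v, L (ρ g v) = ρ' g (L v)) (hLc : Continuous L) {a : ℕ × ℕ} {v : V}
    (h : IsHighest ρ a v) : IsHighest ρ' a (L v) := by
  refine ⟨map_mem_weightSpace L hL h.1, fun j k hjk => ?_⟩
  obtain ⟨x, y, hx, hy, hxy⟩ := h.2 j k hjk
  refine ⟨L x, L y, hx.map hL hLc, hy.map hL hLc, ?_⟩
  rw [← map_smul, ← map_sub, hxy, map_zero]

theorem HasLieAction.unique [T2Space V] {ρ : Representation ℂ SU3 V} {Y : su3} {v w w' : V}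
    (h : HasLieAction ρ Y v w) (h' : HasLieAction ρ Y v w') : w = w' :=
  tendsto_nhds_unique h h'

end Equivariant

theorem rootRe_sub_rootIm (j k : Fin 3) (h : j ≠ k) :
    (rootRe j k : Mat3) - Complex.I • (rootIm j k h : Mat3) = (2 : ℂ) • Matrix.single j k 1 := by
  simp only [rootRe, rootIm, smul_smul, Complex.I_mul_I]
  module

section Rep

variable {H : Type*} [NormedAddCommGroup H] [InnerProductSpace ℂ H] [CompleteSpace H]

theorem lieD_torusElt_apply {π : SU3 →* unitary (H →L[ℂ] H)} {v : H} {l₁ l₂ : ℂ} (h1 : lieD π (coroot 0 1) v = l₁ • v)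
    (h2 : lieD π (coroot 1 2) v = l₂ • v) (θ₀ θ₁ : ℝ) :
    lieD π (torusElt θ₀ θ₁ : Mat3) v = (Complex.I * (l₁ * θ₀ + l₂ * (θ₀ + θ₁))) • v := by
  rw [torusElt_eq, map_add, map_smul, map_smul]
  simp only [add_apply, smul_apply, h1, h2]
  module

variable [FiniteDimensional ℂ H] {π : SU3 →* unitary (H →L[ℂ] H)}
  (hc : ∀ v : H, Continuous fun g => (π g : H →L[ℂ] H) v)

include hc

theorem lieD_single_commutator (i j k l : Fin 3) :
    lieD π (Matrix.single i j 1) * lieD π (Matrix.single k l 1) -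
      lieD π (Matrix.single k l 1) * lieD π (Matrix.single i j 1) =
    (if j = k then lieD π (Matrix.single i l 1) else 0) -
      (if l = i then lieD π (Matrix.single k j 1) else 0) := by
  rw [← lieD_commutator hc, map_sub]
  congr 1
  · split_ifs with h
    · subst h; simp
    · rw [Matrix.single_mul_single_of_ne _ _ _ _ h, map_zero]
  · split_ifs with h
    · subst h; simp
    · rw [Matrix.single_mul_single_of_ne _ _ _ _ h, map_zero]

theorem adjoint_lieD_single (j k : Fin 3) (x y : H) :
    inner ℂ (lieD π (Matrix.single j k 1) x) y = inner ℂ x (lieD π (Matrix.single k j 1) y) := by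
  have := star_lieD hc (Matrix.single j k 1)
  rw [Matrix.conjTranspose_single, star_one, ContinuousLinearMap.star_eq_adjoint] at this
  rw [← this, ContinuousLinearMap.adjoint_inner_right]

/-- The function t ↦ π(exp(tY)) exp(-t dπ(Y)) has derivative zero. -/
theorem rep_exp_eq_exp (Y : su3) :
    (π (expSU3 Y) : H →L[ℂ] H) = NormedSpace.exp (lieD π Y) := by
  let f : ℝ → (H →L[ℂ] H) := fun t => (π (expSU3 (t • Y)) : H →L[ℂ] H) *
    NormedSpace.exp (t • -lieD π Y)
  have hf : ∀ t, HasDerivAt f 0 t := fun t => by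
    have h1 := hasDerivAt_rep_exp hc Y t
    have h2 := hasDerivAt_exp_smul_const' (𝕂 := ℝ) (-lieD π Y) t
    convert! h1.fun_mul h2 using 1
    simp [mul_assoc]
  have h := is_const_of_deriv_eq_zero (fun t => (hf t).differentiableAt) (fun t => (hf t).deriv) 1 0
  have h0 : (0 : ℝ) • Y = 0 := Subtype.ext (by simp)
  simp only [f, one_smul, zero_smul, h0, expSU3_zero, map_one, NormedSpace.exp_zero] at h
  let _ : NormedAlgebra ℚ (H →L[ℂ] H) := NormedAlgebra.restrictScalars ℚ ℂ _
  have h3 : NormedSpace.exp (-lieD π Y) * NormedSpace.exp (lieD π (Y : Mat3)) = 1 := by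
    rw [← NormedSpace.exp_add_of_commute (Commute.refl (lieD π (Y : Mat3))).neg_left,
      neg_add_cancel, NormedSpace.exp_zero]
  calc (π (expSU3 Y) : H →L[ℂ] H)
      = (π (expSU3 Y) : H →L[ℂ] H) * (NormedSpace.exp (-lieD π Y) *
          NormedSpace.exp (lieD π (Y : Mat3))) := by rw [h3, mul_one]
    _ = _ := by rw [← mul_assoc, h]; simp

/-- Every g is an exponential, and N is closed, so it contains the limit of the exponential series
applied to x. -/
theorem rep_mem_of_lieD_mem {N : Submodule ℂ H} (hN : ∀ Z, ∀ x ∈ N, lieD π Z x ∈ N) (g : SU3)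
    {x : H} (hx : x ∈ N) : (π g : H →L[ℂ] H) x ∈ N := by
  obtain ⟨Y, rfl⟩ := expSU3_surjective g
  rw [rep_exp_eq_exp hc]
  have h1 := NormedSpace.exp_series_hasSum_exp' (𝕂 := ℂ) (lieD π (Y : Mat3))
  have h2 := h1.mapL (ContinuousLinearMap.apply ℂ H x)
  have hcl : IsClosed (N : Set H) := N.closed_of_finiteDimensional
  refine hcl.mem_of_tendsto h2 (Eventually.of_forall fun s => N.sum_mem fun n _ => ?_)
  have : ∀ n : ℕ, (lieD π (Y : Mat3) ^ n) x ∈ N := fun n => by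
    induction n with
    | zero => simpa using hx
    | succ n ih => rw [pow_succ']; exact hN _ _ ih
  simpa using N.smul_mem _ (this n)

theorem rep_exp_apply_of_eigenvector (Y : su3) {v : H} {μ : ℂ} (h : lieD π Y v = μ • v) :
    (π (expSU3 Y) : H →L[ℂ] H) v = Complex.exp μ • v := by
  rw [rep_exp_eq_exp hc]
  have h1 := (NormedSpace.exp_series_hasSum_exp' (𝕂 := ℂ) (lieD π (Y : Mat3))).mapL
    (ContinuousLinearMap.apply ℂ H v)
  have h2 := (NormedSpace.exp_series_hasSum_exp' (𝕂 := ℂ) μ).smul_const v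
  have h3 : ∀ n : ℕ, (lieD π (Y : Mat3) ^ n) v = μ ^ n • v := fun n => by
    induction n with
    | zero => simp
    | succ n ih =>
      rw [pow_succ', mul_apply_eq_comp, ih, map_smul, h, smul_smul, pow_succ]
  rw [Complex.exp_eq_exp_ℂ]
  refine h1.unique ?_
  convert! h2 using 1
  funext n
  simp [h3, smul_smul]

/-- Differentiation of the torus action in one direction, exponentiation of the eigenvalues in the
other. -/
theorem mem_weightSpace_iff {a : ℕ × ℕ} {v : H} : v ∈ weightSpace (hilbRep π) a ↔
    lieD π (coroot 0 1) v = (a.1 : ℂ) • v ∧ lieD π (coroot 1 2) v = (a.2 : ℂ) • v := by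
  constructor
  · intro hv
    have key : ∀ θ₀ θ₁ : ℝ, lieD π (torusElt θ₀ θ₁ : Mat3) v =
        (Complex.I * ((a.1 : ℂ) * θ₀ + (a.2 : ℂ) * (θ₀ + θ₁))) • v := by
      intro θ₀ θ₁
      have h1 := (((ContinuousLinearMap.apply ℂ H v).restrictScalars ℝ).hasFDerivAt).comp_hasDerivAt
        (0 : ℝ) (hasDerivAt_rep hc (hasVelocity_expSU3 (torusElt θ₀ θ₁)))
      have h2 : HasDerivAt (fun t : ℝ => Complex.exp ((t : ℂ) *
          (Complex.I * ((a.1 : ℂ) * θ₀ + (a.2 : ℂ) * (θ₀ + θ₁)))) • v)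
          ((Complex.I * ((a.1 : ℂ) * θ₀ + (a.2 : ℂ) * (θ₀ + θ₁))) • v) 0 := by
        have := ((Complex.ofRealCLM.hasDerivAt (x := (0 : ℝ))).mul_const
          (Complex.I * ((a.1 : ℂ) * θ₀ + (a.2 : ℂ) * (θ₀ + θ₁)))).cexp.smul_const v
        simpa using this
      refine h1.unique (h2.congr_of_eventuallyEq (Eventually.of_forall fun t => ?_))
      have h3 := hv (expSU3 (t • torusElt θ₀ θ₁)) (by
        rw [smul_torusElt, exp_torusElt]; exact Matrix.isDiag_diagonal _)
      refine h3.trans ?_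
      congr 1
      rw [smul_torusElt, exp_torusElt]
      simp only [Matrix.diagonal_apply_eq, Matrix.cons_val_zero, Matrix.cons_val_one]
      rw [← Complex.exp_nat_mul, ← Complex.exp_nat_mul, ← Complex.exp_add]
      congr 1
      push_cast
      ring
    -- These angles give i times the coroots of the two simple roots.
    have e1 := key 1 (-1)
    have e2 := key 0 1
    rw [torusElt_eq] at e1 e2
    simp only [map_add, map_smul, add_apply, smul_apply] at e1 e2
    constructor
    · have := congrArg (fun x => (-Complex.I) • x) e1
      simpa [smul_smul, ← mul_assoc] using this
    · have := congrArg (fun x => (-Complex.I) • x) e2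
      simpa [smul_smul, ← mul_assoc] using this
  · rintro ⟨h1, h2⟩ t ht
    have ht' := exists_torusElt_of_isDiag ht
    have h3 := rep_exp_apply_of_eigenvector hc _ (lieD_torusElt_apply h1 h2
      ((t : Mat3) 0 0).arg ((t : Mat3) 1 1).arg)
    rw [← ht'] at h3
    refine h3.trans ?_
    congr 1
    have h4 := congrArg (fun g : SU3 => (g : Mat3)) ht'
    simp only [exp_torusElt] at h4
    have e0 : (t : Mat3) 0 0 = Complex.exp (Complex.I * ((t : Mat3) 0 0).arg) := by
      have := congrFun (congrFun h4 0) 0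
      simpa using this
    have e1 : (t : Mat3) 1 1 = Complex.exp (Complex.I * ((t : Mat3) 1 1).arg) := by
      have := congrFun (congrFun h4 1) 1
      simpa using this
    generalize ((t : Mat3) 0 0).arg = α at *
    generalize ((t : Mat3) 1 1).arg = β at *
    rw [e0, e1, ← Complex.exp_nat_mul, ← Complex.exp_nat_mul, ← Complex.exp_add]
    congr 1
    push_cast
    ring

theorem isHighest_iff {a : ℕ × ℕ} {v : H} : IsHighest (hilbRep π) a v ↔
    (lieD π (coroot 0 1) v = (a.1 : ℂ) • v ∧ lieD π (coroot 1 2) v = (a.2 : ℂ) • v) ∧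
      ∀ j k : Fin 3, j < k → lieD π (Matrix.single j k 1) v = 0 := by
  rw [IsHighest, mem_weightSpace_iff hc]
  refine and_congr_right fun _ => forall₃_congr fun j k hjk => ?_
  have key : lieD π (rootRe j k : Mat3) v - Complex.I • lieD π (rootIm j k hjk.ne : Mat3) v =
      (2 : ℂ) • lieD π (Matrix.single j k 1) v := by
    rw [← smul_apply, ← sub_apply, ← map_smul, ← map_sub,
      rootRe_sub_rootIm, map_smul]
    rfl
  constructor
  · rintro ⟨x, y, hx, hy, hxy⟩
    rw [hx.unique (hasLieAction_lieD hc _ v), hy.unique (hasLieAction_lieD hc _ v), key] at hxy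
    simpa using hxy
  · intro h
    exact ⟨_, _, hasLieAction_lieD hc _ v, hasLieAction_lieD hc _ v, by rw [key, h, smul_zero]⟩

end Rep

/-! ### Existence of highest weight vectors, complete reducibility and lifting. -/

section Rep

variable {H : Type*} [NormedAddCommGroup H] [InnerProductSpace ℂ H] [CompleteSpace H]
  [FiniteDimensional ℂ H]

theorem exists_eigenvector_mem (A : H →L[ℂ] H) {N : Submodule ℂ H} (hN : N ≠ ⊥)
    (hA : ∀ x ∈ N, A x ∈ N) : ∃ μ : ℂ, ∃ v ∈ N, v ≠ 0 ∧ A v = μ • v := by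
  have : Nontrivial N := Submodule.nontrivial_iff_ne_bot.2 hN
  obtain ⟨μ, hμ⟩ := Module.End.exists_eigenvalue ((A : H →ₗ[ℂ] H).restrict hA)
  obtain ⟨v, hv⟩ := hμ.exists_hasEigenvector
  refine ⟨μ, v, v.2, fun h => hv.2 (Subtype.ext h), ?_⟩
  exact congrArg Subtype.val hv.apply_eq_smul

theorem exists_max_eigenvector_mem (A : H →L[ℂ] H) {N : Submodule ℂ H} (hN : N ≠ ⊥)
    (hA : ∀ x ∈ N, A x ∈ N) : ∃ μ : ℂ, (∃ v ∈ N, v ≠ 0 ∧ A v = μ • v) ∧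
      ∀ ν : ℂ, (∃ v ∈ N, v ≠ 0 ∧ A v = ν • v) → ν.re ≤ μ.re := by
  have hfin : Set.Finite {ν : ℂ | ∃ v ∈ N, v ≠ 0 ∧ A v = ν • v} := by
    refine (Module.End.finite_hasEigenvalue (A : H →ₗ[ℂ] H)).subset ?_
    rintro ν ⟨v, _, hv, h⟩
    exact Module.End.hasEigenvalue_of_hasEigenvector (x := v)
      ⟨Module.End.mem_eigenspace_iff.2 h, hv⟩
  obtain ⟨μ, hμ, h⟩ := Set.exists_max_image _ Complex.re hfin (exists_eigenvector_mem A hN hA)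
  exact ⟨μ, hμ, h⟩

theorem coroot_eq_diagonal (j k : Fin 3) :
    coroot j k = Matrix.diagonal (Pi.single j 1 - Pi.single k 1) := by
  have h : Matrix.diagonal (Pi.single j 1 - Pi.single k 1 : Fin 3 → ℂ) =
      Matrix.diagonal (Pi.single j 1) - Matrix.diagonal (Pi.single k 1) := by
    rw [Matrix.diagonal_sub]; rfl
  rw [coroot, h, Matrix.diagonal_single, Matrix.diagonal_single]

variable {π : SU3 →* unitary (H →L[ℂ] H)}
  (hc : ∀ v : H, Continuous fun g => (π g : H →L[ℂ] H) v)

include hc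

theorem lieD_diagonal_apply_single (d : Fin 3 → ℂ) (j k : Fin 3) {v : H} {μ : ℂ}
    (h : lieD π (Matrix.diagonal d) v = μ • v) :
    lieD π (Matrix.diagonal d) (lieD π (Matrix.single j k 1) v) =
      (μ + (d j - d k)) • lieD π (Matrix.single j k 1) v := by
  have h1 := lieD_commutator hc (Matrix.diagonal d) (Matrix.single j k 1)
  have h2 : Matrix.diagonal d * Matrix.single j k 1 - Matrix.single j k 1 * Matrix.diagonal d =
      (d j - d k) • Matrix.single j k (1 : ℂ) := by
    ext a b
    simp only [Matrix.sub_apply, Matrix.diagonal_mul, Matrix.mul_diagonal, Matrix.smul_apply,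
      Matrix.single_apply, smul_eq_mul]
    split_ifs with hab
    · rw [hab.1, hab.2]; ring
    · ring
  rw [h2, map_smul] at h1
  have h3 := congrArg (fun B : H →L[ℂ] H => B v) h1
  simp only [smul_apply, sub_apply, mul_apply_eq_comp, h, map_smul] at h3
  rw [add_smul, h3]
  abel

/-- E_kj is the adjoint of E_jk, and E_jk E_kj v = [E_jk, E_kj] v because E_jk kills v. -/
theorem inner_lower_lower {v : H} {j k : Fin 3} (h : lieD π (Matrix.single j k 1) v = 0) :
    inner ℂ (lieD π (Matrix.single k j 1) v) (lieD π (Matrix.single k j 1) v) =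
      inner ℂ v (lieD π (coroot j k) v) := by
  rw [adjoint_lieD_single hc]
  have h1 := lieD_single_commutator hc j k k j
  rw [if_pos rfl, if_pos rfl, ← map_sub] at h1
  have h2 := congrArg (fun B : H →L[ℂ] H => B v) h1
  simp only [sub_apply, mul_apply_eq_comp, h, map_zero, sub_zero] at h2
  rw [h2, coroot]

/-- Integral multiples of 2π as angles give the identity of the torus, so exp(2πi l) = 1 and l is an
integer. -/
theorem exists_nat_of_coroot_eigenvalue {v : H} (hv : v ≠ 0) {l₁ l₂ : ℂ}
    (h1 : lieD π (coroot 0 1) v = l₁ • v) (h2 : lieD π (coroot 1 2) v = l₂ • v) (θ₀ θ₁ : ℤ)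
    (h0 : 0 ≤ (l₁ * θ₀ + l₂ * (θ₀ + θ₁)).re) :
    ∃ n : ℕ, l₁ * θ₀ + l₂ * (θ₀ + θ₁) = n := by
  set l := l₁ * θ₀ + l₂ * (θ₀ + θ₁) with hl
  have h3 := rep_exp_apply_of_eigenvector hc _ (lieD_torusElt_apply h1 h2
    (2 * Real.pi * θ₀) (2 * Real.pi * θ₁))
  have h4 : expSU3 (torusElt (2 * Real.pi * θ₀) (2 * Real.pi * θ₁)) = 1 := by
    refine Subtype.ext ?_
    rw [exp_torusElt]
    have e : ∀ n : ℤ, Complex.exp (Complex.I * ((2 * Real.pi * n : ℝ) : ℂ)) = 1 := fun n => by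
      rw [Complex.exp_eq_one_iff]
      exact ⟨n, by push_cast; ring⟩
    rw [mul_add, Complex.exp_neg, Complex.exp_add, e, e]
    ext i j
    fin_cases i <;> fin_cases j <;> simp
  rw [h4, map_one] at h3
  have h5 : Complex.exp (Complex.I * (l₁ * (2 * Real.pi * θ₀ : ℝ) +
      l₂ * ((2 * Real.pi * θ₀ : ℝ) + (2 * Real.pi * θ₁ : ℝ)))) = 1 := by
    have : (1 : ℂ) • v = Complex.exp (Complex.I * (l₁ * (2 * Real.pi * θ₀ : ℝ) +
      l₂ * ((2 * Real.pi * θ₀ : ℝ) + (2 * Real.pi * θ₁ : ℝ)))) • v := by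
      rw [one_smul]; exact h3
    exact (smul_left_injective ℂ hv this).symm
  rw [Complex.exp_eq_one_iff] at h5
  obtain ⟨n, hn⟩ := h5
  have h6 : l = n := by
    have h7 : (2 * Real.pi * Complex.I) * l = (2 * Real.pi * Complex.I) * n := by
      rw [hl, mul_comm _ (n : ℂ), ← hn]; push_cast; ring
    exact mul_left_cancel₀ Complex.two_pi_I_ne_zero h7
  rw [h6] at h0
  have h8 : 0 ≤ n := by
    have : (0 : ℝ) ≤ (n : ℤ) := by simpa using h0
    exact_mod_cast this
  exact ⟨n.toNat, by rw [h6]; exact_mod_cast (Int.toNat_of_nonneg h8).symm⟩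

theorem eigenvalue_coroot_nonneg {v : H} (hv : v ≠ 0) {j k : Fin 3} {l : ℂ}
    (h : lieD π (Matrix.single j k 1) v = 0) (hl : lieD π (coroot j k) v = l • v) :
    0 ≤ l.re := by
  have h1 := inner_lower_lower hc h
  rw [hl, inner_smul_right, inner_self_eq_norm_sq_to_K, inner_self_eq_norm_sq_to_K] at h1
  have hpos : 0 < ‖v‖ ^ 2 := by positivity
  have h2 : l = ((‖lieD π (Matrix.single k j 1) v‖ ^ 2 / ‖v‖ ^ 2 : ℝ) : ℂ) := by
    have h3 : ((‖v‖ ^ 2 : ℝ) : ℂ) ≠ 0 := by exact_mod_cast hpos.ne'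
    rw [Complex.ofReal_div, eq_div_iff h3]
    push_cast
    exact h1.symm
  rw [h2, Complex.ofReal_re]
  positivity

/-- Every nonzero invariant subspace contains a highest weight vector. -/
theorem exists_highest_mem {N : Submodule ℂ H} (hN : N ≠ ⊥)
    (hinv : ∀ Z, ∀ x ∈ N, lieD π Z x ∈ N) :
    ∃ a : ℕ × ℕ, ∃ v ∈ N, v ≠ 0 ∧ IsHighest (hilbRep π) a v := by
  -- The raising operators increase the eigenvalue of this diagonal matrix by a positive real
  -- number. An eigenvector in N whose eigenvalue has maximal real part is therefore killed by all
  -- of them.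
  let d : Fin 3 → ℂ := ![1, 0, -1]
  obtain ⟨μ, ⟨v₀, hv₀N, hv₀, hv₀μ⟩, hmax⟩ :=
    exists_max_eigenvector_mem (lieD π (Matrix.diagonal d)) hN (hinv _)
  let E : Submodule ℂ H :=
    N ⊓ Module.End.eigenspace ((lieD π (Matrix.diagonal d) : H →L[ℂ] H) : H →ₗ[ℂ] H) μ
  have hE : E ≠ ⊥ := fun h => hv₀ ((Submodule.mem_bot ℂ).1
    (h ▸ ⟨hv₀N, Module.End.mem_eigenspace_iff.2 hv₀μ⟩))
  have hcomm : lieD π (Matrix.diagonal d) * lieD π (coroot 0 1) =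
      lieD π (coroot 0 1) * lieD π (Matrix.diagonal d) := by
    rw [← sub_eq_zero, ← lieD_commutator hc, coroot_eq_diagonal, Matrix.diagonal_mul_diagonal,
      Matrix.diagonal_mul_diagonal]
    simp_rw [mul_comm]
    rw [sub_self, map_zero]
  -- A weight vector also has to be an eigenvector of both coroots. One of them is diagonalised
  -- inside the top eigenspace, and d is the sum of the two.
  obtain ⟨l₁, v, ⟨hvN, hvE⟩, hv, h1⟩ := exists_eigenvector_mem (lieD π (coroot 0 1)) hE (by
    rintro x ⟨hx, hx'⟩
    refine ⟨hinv _ _ hx, Module.End.mem_eigenspace_iff.2 ?_⟩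
    have h3 : lieD π (Matrix.diagonal d) x = μ • x := Module.End.mem_eigenspace_iff.1 hx'
    have h2 := congrArg (fun B : H →L[ℂ] H => B x) hcomm
    simp only [mul_apply_eq_comp, h3, map_smul] at h2
    exact h2)
  replace hvE : lieD π (Matrix.diagonal d) v = μ • v := Module.End.mem_eigenspace_iff.1 hvE
  have hd : Matrix.diagonal d = coroot 0 1 + coroot 1 2 := by
    ext i j
    fin_cases i <;> fin_cases j <;> simp [coroot, d]
  have h2 : lieD π (coroot 1 2) v = (μ - l₁) • v := by
    rw [hd, map_add, add_apply, h1] at hvE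
    rw [sub_smul, ← hvE]; abel
  have hraise : ∀ j k : Fin 3, j < k → lieD π (Matrix.single j k 1) v = 0 := by
    intro j k hjk
    by_contra hne
    have h3 := hmax _ ⟨_, hinv _ _ hvN, hne, lieD_diagonal_apply_single hc d j k hvE⟩
    have h4 : 0 < (d j - d k).re := by
      fin_cases j <;> fin_cases k <;> first | (exact absurd hjk (by decide)) | (simp [d])
    rw [Complex.add_re] at h3
    linarith
  have n1 := eigenvalue_coroot_nonneg hc hv (hraise 0 1 (by decide)) h1
  have n2 := eigenvalue_coroot_nonneg hc hv (hraise 1 2 (by decide)) h2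
  obtain ⟨m, hm⟩ := exists_nat_of_coroot_eigenvalue hc hv h1 h2 1 (-1) (by simpa using n1)
  obtain ⟨n, hn⟩ := exists_nat_of_coroot_eigenvalue hc hv h1 h2 0 1 (by simpa using n2)
  refine ⟨(m, n), v, hvN, hv, (isHighest_iff hc).2 ⟨⟨?_, ?_⟩, hraise⟩⟩
  · rw [h1, ← hm]; simp
  · rw [h2, ← hn]; simp

theorem lieD_mem_of_rep_mem {N : Submodule ℂ H} (hN : ∀ g, ∀ x ∈ N, (π g : H →L[ℂ] H) x ∈ N)
    (Z : Mat3) {x : H} (hx : x ∈ N) : lieD π Z x ∈ N := by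
  induction Z using su3_induction with
  | hsu Y =>
    have hcl : IsClosed (N : Set H) := N.closed_of_finiteDimensional
    refine hcl.mem_of_tendsto (hasLieAction_lieD hc Y x) (Eventually.of_forall fun t => ?_)
    exact N.smul_mem _ (N.sub_mem (hN _ _ hx) hx)
  | h1 => rw [lieD_one]; simp
  | hadd Z W h h' => rw [map_add]; exact N.add_mem h h'
  | hsmul c Z h => rw [map_smul]; exact N.smul_mem _ h

omit hc [FiniteDimensional ℂ H] in
theorem rep_mem_orthogonal {N : Submodule ℂ H} (hN : ∀ g, ∀ x ∈ N, (π g : H →L[ℂ] H) x ∈ N)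
    (g : SU3) {x : H} (hx : x ∈ Nᗮ) : (π g : H →L[ℂ] H) x ∈ Nᗮ := by
  rw [Submodule.mem_orthogonal] at hx ⊢
  intro u hu
  have h1 := ContinuousLinearMap.inner_map_map_of_mem_unitary (π g).2
    ((π g⁻¹ : H →L[ℂ] H) u) x
  have h2 : (π g : H →L[ℂ] H) ((π g⁻¹ : H →L[ℂ] H) u) = u := by
    rw [← mul_apply_eq_comp, ← Submonoid.coe_mul, ← map_mul]; simp
  rw [h2] at h1
  rw [h1]
  exact hx _ (hN _ _ hu)

/-- A unitary representation is spanned by the translates of its highest weight vectors. -/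
theorem span_translates_highest :
    Submodule.span ℂ {x : H | ∃ g a v, IsHighest (hilbRep π) a v ∧ x = (π g : H →L[ℂ] H) v} = ⊤ := by
  set S := Submodule.span ℂ {x : H | ∃ g a v, IsHighest (hilbRep π) a v ∧
    x = (π g : H →L[ℂ] H) v} with hS
  have hinv : ∀ g, ∀ x ∈ S, (π g : H →L[ℂ] H) x ∈ S := by
    intro g x hx
    have : S ≤ S.comap ((π g : H →L[ℂ] H) : H →ₗ[ℂ] H) := by
      refine Submodule.span_le.2 ?_
      rintro _ ⟨h, a, v, hv, rfl⟩
      refine Submodule.subset_span ⟨g * h, a, v, hv, ?_⟩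
      simp
    exact this hx
  by_contra hne
  have hperp : Sᗮ ≠ ⊥ := fun h => hne ((Submodule.orthogonal_eq_bot_iff).1 h)
  -- The orthogonal complement is invariant. If it were nonzero it would contain a highest weight
  -- vector, which lies in S as well.
  obtain ⟨a, v, hv, hv0, hhw⟩ := exists_highest_mem hc hperp fun Z x hx =>
    lieD_mem_of_rep_mem hc (fun g x hx => rep_mem_orthogonal hinv g hx) Z hx
  have hvS : v ∈ S := Submodule.subset_span ⟨1, a, v, hhw, by simp⟩
  exact hv0 (inner_self_eq_zero.1 (Submodule.inner_right_of_mem_orthogonal hvS hv))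

/-- Highest weight vectors in the image of an equivariant map lift to highest weight vectors. -/
theorem exists_highest_lift {V : Type*} [AddCommGroup V] [Module ℂ V] [TopologicalSpace V]
    [IsTopologicalAddGroup V] [ContinuousSMul ℂ V] [T2Space V]
    {ρ : Representation ℂ SU3 V} (L : H →ₗ[ℂ] V)
    (hL : ∀ g x, L ((π g : H →L[ℂ] H) x) = ρ g (L x)) {a : ℕ × ℕ} {x : H}
    (hx : IsHighest ρ a (L x)) :
    ∃ y : H, IsHighest (hilbRep π) a y ∧ L y = L x := by
  have hLc : Continuous L := L.continuous_of_finiteDimensional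
  let N := LinearMap.ker L
  have hN : ∀ g, ∀ x ∈ N, (π g : H →L[ℂ] H) x ∈ N := by
    intro g x hx
    rw [LinearMap.mem_ker] at hx ⊢
    rw [hL, hx, map_zero]
  have hD := fun Z x hx => lieD_mem_of_rep_mem hc
    (fun g x hx => rep_mem_orthogonal hN g hx) Z (x := x) hx
  have hzero : ∀ z ∈ Nᗮ, L z = 0 → z = 0 := by
    intro z hz h
    exact inner_self_eq_zero.1 (Submodule.inner_right_of_mem_orthogonal (K := N) h hz)
  -- The lift is the component of x orthogonal to the kernel. L is injective on this invariant
  -- complement, so the equations of a highest weight vector may be checked after applying L.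
  obtain ⟨n, hn, y, hy, hxy⟩ := Submodule.exists_add_mem_mem_orthogonal (K := N) x
  have hLy : L y = L x := by
    rw [hxy, map_add, LinearMap.mem_ker.1 hn, zero_add]
  refine ⟨y, ⟨?_, fun j k hjk => ?_⟩, hLy⟩
  · intro t ht
    rw [← sub_eq_zero]
    refine hzero _ (Submodule.sub_mem _ (rep_mem_orthogonal hN t hy) (Submodule.smul_mem _ _ hy)) ?_
    have h1 := hx.1 t ht
    rw [map_sub, map_smul]
    change L ((π t : H →L[ℂ] H) y) - _ = 0
    rw [hL, hLy, h1, sub_self]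
  · refine ⟨_, _, hasLieAction_lieD hc _ y, hasLieAction_lieD hc _ y, ?_⟩
    obtain ⟨u, w, hu, hw, huw⟩ := hx.2 j k hjk
    refine hzero _ (Submodule.sub_mem _ (hD _ _ hy) (Submodule.smul_mem _ _ (hD _ _ hy))) ?_
    have e1 := ((hasLieAction_lieD hc (rootRe j k) y).map (ρ' := ρ) hL hLc)
    have e2 := ((hasLieAction_lieD hc (rootIm j k hjk.ne) y).map (ρ' := ρ) hL hLc)
    rw [hLy] at e1 e2
    rw [map_sub, map_smul, e1.unique hu, e2.unique hw, huw]

end Rep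

/-! ### Irreducible representations and their coherent states -/

/-- The coefficients of the weight `p ϖ₁ + q ϖ₂` on the diagonal matrices. -/
def wt (p q : ℕ) : Fin 3 → ℝ := ![(2 * p + q) / 3, (-p + q) / 3, (-p - 2 * q) / 3]

theorem domWeight_eq (p q : ℕ) :
    domWeight p q = Complex.I • Matrix.diagonal fun i => (wt p q i : ℂ) := by
  ext i j
  fin_cases i <;> fin_cases j <;> simp [domWeight, wt] <;> ring

theorem abs_wt_le (p q : ℕ) (i : Fin 3) : |wt p q i| ≤ p + q := by
  have hp : (0 : ℝ) ≤ p := p.cast_nonneg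
  have hq : (0 : ℝ) ≤ q := q.cast_nonneg
  rw [abs_le]
  fin_cases i <;> simp [wt] <;> constructor <;> linarith

theorem wt_sub_nonneg (p q : ℕ) {j k : Fin 3} (h : j < k) : 0 ≤ wt p q j - wt p q k := by
  have hp : (0 : ℝ) ≤ p := p.cast_nonneg
  have hq : (0 : ℝ) ≤ q := q.cast_nonneg
  fin_cases j <;> fin_cases k <;> first | (exact absurd h (by decide)) | (simp [wt]; linarith)

theorem wt_sub_le (p q : ℕ) {j k : Fin 3} (h : j < k) : wt p q j - wt p q k ≤ p + q := by
  have hp : (0 : ℝ) ≤ p := p.cast_nonneg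
  have hq : (0 : ℝ) ≤ q := q.cast_nonneg
  fin_cases j <;> fin_cases k <;> first | (exact absurd h (by decide)) | (simp [wt]; linarith)

section Rep

variable {H : Type*} [NormedAddCommGroup H] [InnerProductSpace ℂ H] [CompleteSpace H]

theorem eq_top_of_irreducible {π : SU3 →* unitary (H →L[ℂ] H)} (hirr : (hilbRep π).IsIrreducible)
    {N : Submodule ℂ H} (hN : ∀ g, ∀ x ∈ N, (π g : H →L[ℂ] H) x ∈ N) (hne : N ≠ ⊥) : N = ⊤ := by
  let S : Subrepresentation (hilbRep π) := ⟨N, fun g x hx => hN g x hx⟩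
  rcases hirr.eq_bot_or_eq_top S with h | h
  · exact absurd (congrArg Subrepresentation.toSubmodule h) hne
  · exact congrArg Subrepresentation.toSubmodule h

/-- Schur's argument: some eigenspace is nonzero, and by invariance it is everything. Only
invariance of the eigenspaces is required, so that operators commuting with the Lie algebra are
covered as well. -/
theorem eq_smul_one_of_eigenspace_invariant [FiniteDimensional ℂ H]
    {π : SU3 →* unitary (H →L[ℂ] H)} (hirr : (hilbRep π).IsIrreducible) (A : H →L[ℂ] H)
    (hA : ∀ c : ℂ, ∀ g, ∀ x ∈ Module.End.eigenspace (A : H →ₗ[ℂ] H) c,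
      (π g : H →L[ℂ] H) x ∈ Module.End.eigenspace (A : H →ₗ[ℂ] H) c) : ∃ c : ℂ, A = c • 1 := by
  have hnt : (⊤ : Submodule ℂ H) ≠ ⊥ := fun h =>
    bot_ne_top (α := Subrepresentation (hilbRep π))
      (Subrepresentation.toSubmodule_injective h.symm)
  obtain ⟨c, v, _, hv, hcv⟩ := exists_eigenvector_mem A hnt fun x _ => Submodule.mem_top
  have h := eq_top_of_irreducible hirr (hA c)
    (fun h => hv ((Submodule.mem_bot ℂ).1 (h ▸ Module.End.mem_eigenspace_iff.2 hcv)))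
  refine ⟨c, ContinuousLinearMap.ext fun x => ?_⟩
  have hx : x ∈ Module.End.eigenspace (A : H →ₗ[ℂ] H) c := h ▸ Submodule.mem_top
  exact Module.End.mem_eigenspace_iff.1 hx

theorem eq_smul_one_of_commute [FiniteDimensional ℂ H] {π : SU3 →* unitary (H →L[ℂ] H)}
    (hirr : (hilbRep π).IsIrreducible) (A : H →L[ℂ] H)
    (hA : ∀ g, A * (π g : H →L[ℂ] H) = (π g : H →L[ℂ] H) * A) : ∃ c : ℂ, A = c • 1 := by
  refine eq_smul_one_of_eigenspace_invariant hirr A fun c g x hx => ?_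
  have hx' : A x = c • x := Module.End.mem_eigenspace_iff.1 hx
  refine Module.End.mem_eigenspace_iff.2 ?_
  have := congrArg (fun B : H →L[ℂ] H => B x) (hA g)
  simp only [mul_apply_eq_comp, hx', map_smul] at this
  exact this

/-- `v` is a highest weight vector of norm `1` for the weight `(p, q)`. -/
structure IsHighestUnit (π : SU3 →* unitary (H →L[ℂ] H)) (p q : ℕ) (v : H) : Prop where
  highest : IsHighest (hilbRep π) (p, q) v
  norm_eq : ‖v‖ = 1

theorem IsHighestUnit.ne_zero {π : SU3 →* unitary (H →L[ℂ] H)} {p q : ℕ} {v : H}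
    (hv : IsHighestUnit π p q v) : v ≠ 0 := fun h => by
  have := hv.norm_eq
  rw [h] at this
  simp at this

variable [FiniteDimensional ℂ H] {π : SU3 →* unitary (H →L[ℂ] H)} {p q : ℕ}

theorem IsQuarkSystem.exists_highestUnit (hq : IsQuarkSystem π p q) :
    ∃ v : H, IsHighestUnit π p q v := by
  obtain ⟨v, hv, hhw⟩ := hq.highest
  have hn : ‖v‖ ≠ 0 := norm_ne_zero_iff.2 hv
  refine ⟨((‖v‖⁻¹ : ℝ) : ℂ) • v, ?_, ?_⟩
  · rw [isHighest_iff hq.continuous] at hhw ⊢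
    obtain ⟨⟨h1, h2⟩, h3⟩ := hhw
    refine ⟨⟨?_, ?_⟩, fun j k hjk => ?_⟩
    · rw [map_smul, h1, smul_comm]
    · rw [map_smul, h2, smul_comm]
    · rw [map_smul, h3 j k hjk, smul_zero]
  · rw [norm_smul, Complex.norm_real, norm_inv, norm_norm, inv_mul_cancel₀ hn]

variable {v : H} (hq : IsQuarkSystem π p q) (hv : IsHighestUnit π p q v)

include hq hv

theorem lieD_raise {j k : Fin 3} (h : j < k) : lieD π (Matrix.single j k 1) v = 0 :=
  ((isHighest_iff hq.continuous).1 hv.highest).2 j k h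

theorem lieD_diagonal_highest (d : Fin 3 → ℂ) :
    lieD π (Matrix.diagonal d) v = (∑ i, (wt p q i : ℂ) * d i) • v := by
  obtain ⟨⟨h1, h2⟩, -⟩ := (isHighest_iff hq.continuous).1 hv.highest
  have hd : Matrix.diagonal d = ((2 * d 0 - d 1 - d 2) / 3) • coroot 0 1 +
      ((d 0 + d 1 - 2 * d 2) / 3) • coroot 1 2 + ((d 0 + d 1 + d 2) / 3) • (1 : Mat3) := by
    ext i j
    fin_cases i <;> fin_cases j <;> simp [coroot] <;> ring
  rw [hd, map_add, map_add, map_smul, map_smul, map_smul, lieD_one]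
  simp only [add_apply, smul_apply, h1, h2, Fin.sum_univ_three, wt, Matrix.cons_val_zero,
    Matrix.cons_val_one, Matrix.cons_val_two, smul_zero, add_zero, smul_smul, ← add_smul]
  congr 1
  simp
  ring

theorem lieD_coroot_highest (j k : Fin 3) :
    lieD π (coroot j k) v = ((wt p q j - wt p q k : ℝ) : ℂ) • v := by
  rw [coroot_eq_diagonal, lieD_diagonal_highest hq hv]
  congr 1
  simp [mul_sub, Finset.sum_sub_distrib, Pi.single_apply]

theorem norm_sq_lower {j k : Fin 3} (h : j < k) :
    ‖lieD π (Matrix.single k j 1) v‖ ^ 2 = wt p q j - wt p q k := by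
  have h1 := inner_lower_lower hq.continuous (lieD_raise hq hv h)
  rw [lieD_coroot_highest hq hv, inner_smul_right, inner_self_eq_norm_sq_to_K,
    inner_self_eq_norm_sq_to_K, hv.norm_eq] at h1
  have : ((‖lieD π (Matrix.single k j 1) v‖ ^ 2 : ℝ) : ℂ) = ((wt p q j - wt p q k : ℝ) : ℂ) := by
    simpa using h1
  exact_mod_cast this

/-- A subspace that contains the highest weight vector and is stable under the lowering operators
is everything. -/
theorem eq_top_of_lower_mem {M : Submodule ℂ H} (hvM : v ∈ M)
    (hM : ∀ j k : Fin 3, j < k → ∀ x ∈ M, lieD π (Matrix.single k j 1) x ∈ M) : M = ⊤ := by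
  let 𝒮 : Set (Submodule ℂ H) :=
    {M | v ∈ M ∧ ∀ j k : Fin 3, j < k → ∀ x ∈ M, lieD π (Matrix.single k j 1) x ∈ M}
  let N := sInf 𝒮
  have hvN : v ∈ N := (Submodule.mem_sInf).2 fun M hM => hM.1
  have hlow : ∀ j k : Fin 3, j < k → ∀ x ∈ N, lieD π (Matrix.single k j 1) x ∈ N :=
    fun j k hjk x hx => (Submodule.mem_sInf).2 fun M hM =>
      hM.2 j k hjk x ((Submodule.mem_sInf).1 hx M hM)
  -- N is the smallest subspace that contains v and is stable under lowering. Since ZEx = [Z, E]x +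
  -- EZx, the vectors of N that all Z map into N form another such subspace. By minimality N is
  -- stable under the whole Lie algebra.
  let N' : Submodule ℂ H :=
    { carrier := {x | x ∈ N ∧ ∀ Z, lieD π Z x ∈ N}
      zero_mem' := ⟨N.zero_mem, fun Z => by simp⟩
      add_mem' := fun {x y} hx hy => ⟨N.add_mem hx.1 hy.1, fun Z => by
        rw [map_add]; exact N.add_mem (hx.2 Z) (hy.2 Z)⟩
      smul_mem' := fun c x hx => ⟨N.smul_mem c hx.1, fun Z => by
        rw [map_smul]; exact N.smul_mem c (hx.2 Z)⟩ }
  have hsingle : ∀ i j : Fin 3, lieD π (Matrix.single i j 1) v ∈ N := by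
    intro i j
    rcases lt_trichotomy i j with h | h | h
    · rw [lieD_raise hq hv h]; exact N.zero_mem
    · subst h
      rw [← Matrix.diagonal_single, lieD_diagonal_highest hq hv]
      exact N.smul_mem _ hvN
    · exact hlow j i h v hvN
  have hN' : N' ∈ 𝒮 := by
    refine ⟨⟨hvN, fun Z => ?_⟩, fun j k hjk x hx => ⟨hlow j k hjk x hx.1, fun Z => ?_⟩⟩
    · rw [Matrix.matrix_eq_sum_single Z]
      simp only [map_sum, FunLike.coe_sum, Finset.sum_apply]
      refine N.sum_mem fun i _ => N.sum_mem fun j _ => ?_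
      have : Matrix.single i j (Z i j) = Z i j • Matrix.single i j (1 : ℂ) := by simp
      rw [this, map_smul]
      exact N.smul_mem _ (hsingle i j)
    · have h1 := congrArg (fun B : H →L[ℂ] H => B x)
        (lieD_commutator hq.continuous Z (Matrix.single k j 1))
      simp only [sub_apply, mul_apply_eq_comp] at h1
      rw [eq_sub_iff_add_eq.1 h1.symm.symm |>.symm]
      exact N.add_mem (hx.2 _) (hlow j k hjk _ (hx.2 Z))
  have hNN' : N ≤ N' := sInf_le hN'
  have hNtop : N = ⊤ := eq_top_of_irreducible hq.irreducible
    (fun g x hx => rep_mem_of_lieD_mem hq.continuous (fun Z x hx => (hNN' hx).2 Z) g hx)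
    (fun h => hv.ne_zero ((Submodule.mem_bot ℂ).1 (h ▸ hvN)))
  exact top_unique (hNtop ▸ sInf_le ⟨hvM, hM⟩)

/-- The diagonal matrix of the highest weight has the eigenvalue |ω|² at v, and lowering never
increases its eigenvalues. Hence v and the eigenspaces with an eigenvalue of smaller real part span
a subspace stable under lowering, which is everything, and the top eigenspace is the line of v. The
statement also covers weights on a wall of the chamber, where some lowering operators commute with
this matrix. -/
theorem mem_span_of_top_eigenvector {x : H}
    (hx : lieD π (Matrix.diagonal fun i => (wt p q i : ℂ)) x =
      ((∑ i, wt p q i ^ 2 : ℝ) : ℂ) • x) : x ∈ Submodule.span ℂ {v} := by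
  set d : Fin 3 → ℂ := fun i => (wt p q i : ℂ) with hd
  set S : H →ₗ[ℂ] H := ((lieD π (Matrix.diagonal d) : H →L[ℂ] H) : H →ₗ[ℂ] H) with hS
  set l : ℝ := ∑ i, wt p q i ^ 2 with hl
  let F : Submodule ℂ H := ⨆ ν : {ν : ℂ // ν.re < l}, Module.End.eigenspace S ν
  have hvl : lieD π (Matrix.diagonal d) v = (l : ℂ) • v := by
    rw [lieD_diagonal_highest hq hv, hl]
    congr 1
    push_cast
    exact Finset.sum_congr rfl fun i _ => by rw [hd]; ring
  have hM : Submodule.span ℂ {v} ⊔ F = ⊤ := by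
    refine eq_top_of_lower_mem hq hv
      (Submodule.mem_sup_left (Submodule.mem_span_singleton_self v)) ?_
    intro j k hjk
    change Submodule.span ℂ {v} ⊔ F ≤ (Submodule.span ℂ {v} ⊔ F).comap
      ((lieD π (Matrix.single k j 1) : H →L[ℂ] H) : H →ₗ[ℂ] H)
    have hnn := wt_sub_nonneg p q hjk
    refine sup_le ?_ (iSup_le ?_)
    · rw [Submodule.span_singleton_le_iff_mem, Submodule.mem_comap]
      -- If the lowering operator does not change the eigenvalue, the norm formula shows that it
      -- kills v.
      rcases hnn.eq_or_lt with h0 | h0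
      · have h1 := norm_sq_lower hq hv hjk
        rw [← h0] at h1
        have h2 : lieD π (Matrix.single k j 1) v = 0 := by simpa using h1
        rw [ContinuousLinearMap.coe_coe, h2]
        exact Submodule.zero_mem _
      · refine Submodule.mem_sup_right (Submodule.mem_iSup_of_mem ⟨l + (d k - d j), ?_⟩
          (Module.End.mem_eigenspace_iff.2 (lieD_diagonal_apply_single hq.continuous d k j hvl)))
        simp [hd]
        linarith
    · rintro ⟨ν, hν⟩ y hy
      have hy' : lieD π (Matrix.diagonal d) y = ν • y := Module.End.mem_eigenspace_iff.1 hy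
      refine Submodule.mem_sup_right (Submodule.mem_iSup_of_mem ⟨ν + (d k - d j), ?_⟩
          (Module.End.mem_eigenspace_iff.2 (lieD_diagonal_apply_single hq.continuous d k j hy')))
      simp [hd]
      linarith
  have hxM : x ∈ Submodule.span ℂ {v} ⊔ F := hM ▸ Submodule.mem_top
  obtain ⟨y, hy, f, hf, rfl⟩ := Submodule.mem_sup.1 hxM
  have hyl : y ∈ Module.End.eigenspace S l := by
    refine (Submodule.span_singleton_le_iff_mem v _).2 ?_ hy
    exact Module.End.mem_eigenspace_iff.2 hvl
  have hfl : f ∈ Module.End.eigenspace S l := by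
    have h1 := Submodule.sub_mem _ (Module.End.mem_eigenspace_iff.2 hx :
      y + f ∈ Module.End.eigenspace S l) hyl
    simpa using h1
  have hdis := Module.End.eigenspaces_iSupIndep S (l : ℂ)
  have hF : F ≤ ⨆ (ν : ℂ) (_ : ν ≠ l), Module.End.eigenspace S ν := by
    refine iSup_le fun ν => le_iSup₂_of_le ν.1 (fun h => ?_) le_rfl
    have := ν.2
    rw [h] at this
    simp at this
  have hf0 : f = 0 := by
    have := Submodule.disjoint_def.1 hdis f hfl (hF hf)
    exact this
  rw [hf0, add_zero]
  exact hy

theorem weightSpace_eq_span : weightSpace (hilbRep π) (p, q) = Submodule.span ℂ {v} := by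
  refine le_antisymm (fun x hx => mem_span_of_top_eigenvector hq hv ?_)
    ((Submodule.span_singleton_le_iff_mem v _).2 hv.highest.1)
  obtain ⟨h1, h2⟩ := (mem_weightSpace_iff hq.continuous).1 hx
  have hd : (Matrix.diagonal fun i => (wt p q i : ℂ)) = (wt p q 0 : ℂ) • coroot 0 1 +
      ((wt p q 0 : ℂ) + wt p q 1) • coroot 1 2 := by
    ext i j
    fin_cases i <;> fin_cases j <;> simp [coroot, wt]
    ring
  rw [hd, map_add, map_smul, map_smul, add_apply, smul_apply, smul_apply, h1, h2, smul_smul,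
    smul_smul, ← add_smul]
  congr 1
  simp [wt, Fin.sum_univ_three]
  ring

/-- If k fixes the weight, then π(k) commutes with its action, so π(k)v is again an eigenvector for
the simple top eigenvalue. -/
theorem rep_stabilizer_highest {k : SU3}
    (hk : (k : Mat3) * domWeight p q * ((k⁻¹ : SU3) : Mat3) = domWeight p q) :
    ∃ c : ℂ, ‖c‖ = 1 ∧ (π k : H →L[ℂ] H) v = c • v := by
  rw [domWeight_eq, Matrix.mul_smul, Matrix.smul_mul] at hk
  have hk' := smul_right_injective Mat3 Complex.I_ne_zero hk
  have hmem : (π k : H →L[ℂ] H) v ∈ Submodule.span ℂ {v} := by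
    refine mem_span_of_top_eigenvector hq hv ?_
    nth_rewrite 1 [← hk']
    rw [lieD_conj hq.continuous, mul_apply_eq_comp, mul_apply_eq_comp, ← mul_apply_eq_comp
      (π k⁻¹ : H →L[ℂ] H), ← Submonoid.coe_mul, ← map_mul, inv_mul_cancel, map_one, Submonoid.coe_one,
      one_apply_eq_self, lieD_diagonal_highest hq hv, map_smul]
    congr 1
    push_cast
    exact Finset.sum_congr rfl fun i _ => by ring
  obtain ⟨c, hc⟩ := Submodule.mem_span_singleton.1 hmem
  refine ⟨c, ?_, hc.symm⟩
  have h1 := ContinuousLinearMap.norm_map_of_mem_unitary (π k).2 v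
  rw [← hc, norm_smul, hv.norm_eq, mul_one] at h1
  exact h1

end Rep

/-! ### The Casimir operator and bounds for the derived representation. -/

section Rep

variable {H : Type*} [NormedAddCommGroup H] [InnerProductSpace ℂ H] [CompleteSpace H]
  [FiniteDimensional ℂ H] {π : SU3 →* unitary (H →L[ℂ] H)} {p q : ℕ}

/-- The quadratic Casimir operator. -/
def casimir (π : SU3 →* unitary (H →L[ℂ] H)) : H →L[ℂ] H :=
  ∑ i, ∑ j, lieD π (Matrix.single i j 1) * lieD π (Matrix.single j i 1)

/-- The Leibniz rule for the commutator with E_kl gives four sums, which cancel in pairs. -/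
theorem casimir_commute (hc : ∀ v : H, Continuous fun g => (π g : H →L[ℂ] H) v) (k l : Fin 3) :
    lieD π (Matrix.single k l 1) * casimir π = casimir π * lieD π (Matrix.single k l 1) := by
  rw [← sub_eq_zero]
  have key : ∀ i j : Fin 3,
      lieD π (Matrix.single k l 1) * (lieD π (Matrix.single i j 1) * lieD π (Matrix.single j i 1)) -
        lieD π (Matrix.single i j 1) * lieD π (Matrix.single j i 1) * lieD π (Matrix.single k l 1) =
      (if l = i then lieD π (Matrix.single k j 1) * lieD π (Matrix.single j i 1) else 0) -
        (if j = k then lieD π (Matrix.single i l 1) * lieD π (Matrix.single j i 1) else 0) +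
      ((if l = j then lieD π (Matrix.single i j 1) * lieD π (Matrix.single k i 1) else 0) -
        (if i = k then lieD π (Matrix.single i j 1) * lieD π (Matrix.single j l 1) else 0)) := by
    intro i j
    have h1 := congrArg (fun B => B * lieD π (Matrix.single j i 1))
      (lieD_single_commutator hc k l i j)
    have h2 := congrArg (fun B => lieD π (Matrix.single i j 1) * B)
      (lieD_single_commutator hc k l j i)
    simp only [sub_mul, mul_sub, ite_mul, mul_ite, zero_mul, mul_zero] at h1 h2
    rw [← h1, ← h2]
    simp only [mul_assoc]
    abel
  simp only [casimir, Finset.mul_sum, Finset.sum_mul, ← Finset.sum_sub_distrib, key]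
  simp only [Finset.sum_add_distrib, Finset.sum_sub_distrib]
  have e1 : ∑ i : Fin 3, ∑ j : Fin 3, (if l = i then
      lieD π (Matrix.single k j 1) * lieD π (Matrix.single j i 1) else 0) =
      ∑ j, lieD π (Matrix.single k j 1) * lieD π (Matrix.single j l 1) := by
    rw [Finset.sum_comm]
    simp
  have e2 : ∑ i : Fin 3, ∑ j : Fin 3, (if j = k then
      lieD π (Matrix.single i l 1) * lieD π (Matrix.single j i 1) else 0) =
      ∑ i, lieD π (Matrix.single i l 1) * lieD π (Matrix.single k i 1) := by simp
  have e3 : ∑ i : Fin 3, ∑ j : Fin 3, (if l = j then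
      lieD π (Matrix.single i j 1) * lieD π (Matrix.single k i 1) else 0) =
      ∑ i, lieD π (Matrix.single i l 1) * lieD π (Matrix.single k i 1) := by simp
  have e4 : ∑ i : Fin 3, ∑ j : Fin 3, (if i = k then
      lieD π (Matrix.single i j 1) * lieD π (Matrix.single j l 1) else 0) =
      ∑ j, lieD π (Matrix.single k j 1) * lieD π (Matrix.single j l 1) := by
    rw [Finset.sum_comm]
    simp
  rw [e1, e2, e3, e4]
  abel

theorem inner_casimir (hc : ∀ v : H, Continuous fun g => (π g : H →L[ℂ] H) v) (x : H) :
    inner ℂ x (casimir π x) = ((∑ i, ∑ j, ‖lieD π (Matrix.single j i 1) x‖ ^ 2 : ℝ) : ℂ) := by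
  simp only [casimir, FunLike.coe_sum, Finset.sum_apply, inner_sum, mul_apply_eq_comp]
  push_cast
  refine Finset.sum_congr rfl fun i _ => Finset.sum_congr rfl fun j _ => ?_
  rw [← adjoint_lieD_single hc, inner_self_eq_norm_sq_to_K]
  rfl

theorem casimir_eq_smul (hq : IsQuarkSystem π p q) : ∃ c : ℂ, casimir π = c • 1 := by
  refine eq_smul_one_of_eigenspace_invariant hq.irreducible _ fun c g x hx => ?_
  refine rep_mem_of_lieD_mem hq.continuous (fun Z x hx => ?_) g hx
  have hx' : casimir π x = c • x := Module.End.mem_eigenspace_iff.1 hx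
  rw [Matrix.matrix_eq_sum_single Z]
  simp only [map_sum, FunLike.coe_sum, Finset.sum_apply]
  refine Submodule.sum_mem _ fun i _ => Submodule.sum_mem _ fun j _ => ?_
  have : Matrix.single i j (Z i j) = Z i j • Matrix.single i j (1 : ℂ) := by simp
  rw [this, map_smul]
  refine Submodule.smul_mem _ _ (Module.End.mem_eigenspace_iff.2 ?_)
  have h := congrArg (fun B : H →L[ℂ] H => B x) (casimir_commute hq.continuous i j)
  simp only [mul_apply_eq_comp, hx', map_smul] at h
  exact h.symm

section Highest

variable {v : H} (hq : IsQuarkSystem π p q) (hv : IsHighestUnit π p q v)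

include hq hv

theorem lieD_single_self (i : Fin 3) :
    lieD π (Matrix.single i i 1) v = (wt p q i : ℂ) • v := by
  rw [← Matrix.diagonal_single, lieD_diagonal_highest hq hv]
  congr 1
  simp [Pi.single_apply]

theorem norm_sq_offdiag_le {i j : Fin 3} (hij : i ≠ j) :
    ‖lieD π (Matrix.single i j 1) v‖ ^ 2 ≤ p + q := by
  rcases lt_or_gt_of_ne hij with h | h
  · rw [lieD_raise hq hv h]
    simp
    positivity
  · rw [norm_sq_lower hq hv h]
    exact wt_sub_le p q h

theorem norm_sq_single_le (i j : Fin 3) :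
    ‖lieD π (Matrix.single i j 1) v‖ ^ 2 ≤ ((p : ℝ) + q) ^ 2 := by
  by_cases hij : i = j
  · subst hij
    rw [lieD_single_self hq hv, norm_smul, hv.norm_eq, mul_one, Complex.norm_real, Real.norm_eq_abs]
    exact pow_le_pow_left₀ (abs_nonneg _) (abs_wt_le p q i) 2
  · refine (norm_sq_offdiag_le hq hv hij).trans ?_
    -- This uses that p + q is a natural number.
    have : p + q ≤ (p + q) ^ 2 := Nat.le_self_pow two_ne_zero _
    exact_mod_cast this

/-- Each ‖E_ij x‖² is one of the nonnegative terms of ⟨x, Cx⟩ for the Casimir operator C. That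
operator is a scalar, so its value can be computed at the highest weight vector, where the nine
terms are at most (p + q)² each. -/
theorem norm_lieD_single_le (i j : Fin 3) :
    ‖lieD π (Matrix.single i j 1)‖ ≤ 3 * ((p : ℝ) + q) := by
  obtain ⟨c, hc⟩ := casimir_eq_smul hq
  have hcv : c = ((∑ i, ∑ j, ‖lieD π (Matrix.single j i 1) v‖ ^ 2 : ℝ) : ℂ) := by
    have h := inner_casimir hq.continuous v
    rw [hc, smul_apply, one_apply_eq_self, inner_smul_right, inner_self_eq_norm_sq_to_K,
      hv.norm_eq] at h
    rw [← h]; simp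
  set r : ℝ := ∑ i, ∑ j, ‖lieD π (Matrix.single j i 1) v‖ ^ 2 with hr
  have hr9 : r ≤ 9 * ((p : ℝ) + q) ^ 2 := by
    calc r ≤ ∑ i : Fin 3, ∑ j : Fin 3, ((p : ℝ) + q) ^ 2 :=
          Finset.sum_le_sum fun i _ => Finset.sum_le_sum fun j _ => norm_sq_single_le hq hv j i
      _ = _ := by simp; ring
  refine ContinuousLinearMap.opNorm_le_bound _ (by positivity) fun x => ?_
  have h := inner_casimir hq.continuous x
  rw [hc, smul_apply, one_apply_eq_self, inner_smul_right, inner_self_eq_norm_sq_to_K, hcv] at h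
  have h' : r * ‖x‖ ^ 2 = ∑ i, ∑ j, ‖lieD π (Matrix.single j i 1) x‖ ^ 2 := by
    refine Complex.ofReal_injective ?_
    rw [← h, Complex.ofReal_mul, Complex.ofReal_pow]
    rfl
  have h1 : ‖lieD π (Matrix.single i j 1) x‖ ^ 2 ≤ r * ‖x‖ ^ 2 := by
    rw [h']
    refine le_trans ?_ (Finset.single_le_sum (f := fun j' => ∑ i', ‖lieD π (Matrix.single i' j' 1) x‖ ^ 2)
      (fun _ _ => Finset.sum_nonneg fun _ _ => by positivity) (Finset.mem_univ j))
    exact Finset.single_le_sum (f := fun i' => ‖lieD π (Matrix.single i' j 1) x‖ ^ 2)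
      (fun _ _ => by positivity) (Finset.mem_univ i)
  refine abs_le_of_sq_le_sq' ?_ (by positivity) |>.2
  calc ‖lieD π (Matrix.single i j 1) x‖ ^ 2 ≤ r * ‖x‖ ^ 2 := h1
    _ ≤ 9 * ((p : ℝ) + q) ^ 2 * ‖x‖ ^ 2 := by gcongr
    _ = _ := by ring

theorem norm_lieD_single_sub_le (i j : Fin 3) :
    ‖lieD π (Matrix.single i j 1) v - (if i = j then (wt p q i : ℂ) else 0) • v‖ ≤
      Real.sqrt (p + q) := by
  split_ifs with h
  · subst h
    rw [lieD_single_self hq hv, sub_self, norm_zero]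
    exact Real.sqrt_nonneg _
  · rw [zero_smul, sub_zero]
    exact Real.le_sqrt_of_sq_le (norm_sq_offdiag_le hq hv h)

end Highest

/-! ### Traces, coherent states and the Berezin correspondence -/

theorem opTrace_mul_rankOne (A : H →L[ℂ] H) (x y : H) :
    opTrace (A * InnerProductSpace.rankOne ℂ x y) = inner ℂ y (A x) := by
  rw [opTrace]
  have : A * InnerProductSpace.rankOne ℂ x y = InnerProductSpace.rankOne ℂ (A x) y :=
    InnerProductSpace.comp_rankOne x y A
  rw [this, InnerProductSpace.trace_rankOne]

theorem opRep_rankOne (g : SU3) (x y : H) :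
    opRep π g (InnerProductSpace.rankOne ℂ x y) =
      InnerProductSpace.rankOne ℂ ((π g : H →L[ℂ] H) x) ((π g : H →L[ℂ] H) y) := by
  ext z
  change (π g : H →L[ℂ] H) (inner ℂ y ((π g⁻¹ : H →L[ℂ] H) z) • x) = _
  have h1 := ContinuousLinearMap.inner_map_map_of_mem_unitary (π g).2 y ((π g⁻¹ : H →L[ℂ] H) z)
  have h2 : (π g : H →L[ℂ] H) ((π g⁻¹ : H →L[ℂ] H) z) = z := by
    rw [← mul_apply_eq_comp, ← Submonoid.coe_mul, ← map_mul]; simp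
  rw [h2] at h1
  rw [map_smul, ← h1]
  rfl

theorem continuous_coherent (hc : ∀ v : H, Continuous fun g => (π g : H →L[ℂ] H) v)
    (A B : H →L[ℂ] H) (v : H) :
    Continuous fun g => inner ℂ (A ((π g : H →L[ℂ] H) v)) (B ((π g : H →L[ℂ] H) v)) :=
  (A.continuous.comp (hc v)).inner (B.continuous.comp (hc v))

/-- The resolution of the identity by the coherent states. -/
theorem integral_coherent (hq : IsQuarkSystem π p q) {v : H} (hv : ‖v‖ = 1) (A : H →L[ℂ] H) :
    ∫ g, inner ℂ ((π g : H →L[ℂ] H) v) (A ((π g : H →L[ℂ] H) v)) ∂haarSU3 =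
      opTrace A / (Module.finrank ℂ H : ℂ) := by
  let R : SU3 → (H →L[ℂ] H) := fun g =>
    InnerProductSpace.rankOne ℂ ((π g : H →L[ℂ] H) v) ((π g : H →L[ℂ] H) v)
  have hRc : Continuous R := by
    refine continuous_clm_apply.2 fun x => ?_
    exact ((hq.continuous v).inner continuous_const).smul (hq.continuous v)
  have : SecondCountableTopology (H →L[ℂ] H) := by
    have := FiniteDimensional.proper ℂ (H →L[ℂ] H)
    infer_instance
  have hRi : Integrable R haarSU3 := integrable_haar_of_continuous hRc
  let S : H →L[ℂ] H := ∫ g, R g ∂haarSU3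
  have hS : ∀ h, opRep π h S = S := fun h => by
    have h1 := ContinuousLinearMap.integral_comp_comm (opRep π h).toContinuousLinearMap hRi
    have h2 : ∀ g, opRep π h (R g) = R (h * g) := fun g => by
      rw [opRep_rankOne]; simp [R]
    simp only [LinearMap.coe_toContinuousLinearMap', h2] at h1
    rw [← h1]
    exact integral_mul_left_eq_self (μ := haarSU3) R h
  have hT : ∀ B : H →L[ℂ] H, opTrace (B * S) =
      ∫ g, inner ℂ ((π g : H →L[ℂ] H) v) (B ((π g : H →L[ℂ] H) v)) ∂haarSU3 := fun B => by
    let t : (H →L[ℂ] H) →ₗ[ℂ] ℂ :=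
      { toFun := fun C => opTrace (B * C)
        map_add' := fun C D => by simp [opTrace, mul_add]
        map_smul' := fun c C => by simp [opTrace] }
    have h1 := ContinuousLinearMap.integral_comp_comm t.toContinuousLinearMap hRi
    have h2 : ∀ g, t (R g) = inner ℂ ((π g : H →L[ℂ] H) v) (B ((π g : H →L[ℂ] H) v)) :=
      fun g => opTrace_mul_rankOne B _ _
    simp only [LinearMap.coe_toContinuousLinearMap', h2] at h1
    exact h1.symm
  -- By invariance of the Haar measure the averaged projection commutes with the group, so it is a
  -- scalar. Its value 1/dim H is then read off from the case B = 1.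
  obtain ⟨c, hc⟩ := eq_smul_one_of_commute hq.irreducible S fun g => by
    have h1 := hS g
    change (π g : H →L[ℂ] H) * S * (π g⁻¹ : H →L[ℂ] H) = S at h1
    nth_rewrite 1 [← h1]
    rw [mul_assoc, ← Submonoid.coe_mul, ← map_mul]
    simp
  have h1 := hT 1
  have h2 : ∀ g, inner ℂ ((π g : H →L[ℂ] H) v) ((π g : H →L[ℂ] H) v) = (1 : ℂ) := fun g => by
    rw [ContinuousLinearMap.inner_map_map_of_mem_unitary (π g).2, inner_self_eq_norm_sq_to_K, hv]
    simp
  have htr : ∀ B : H →L[ℂ] H, opTrace (B * S) = c * opTrace B := fun B => by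
    rw [hc, mul_smul_comm, mul_one]; simp [opTrace]
  rw [htr] at h1
  simp only [one_apply_eq_self, h2, integral_const, probReal_univ, one_smul] at h1
  have h3 : opTrace (1 : H →L[ℂ] H) = (Module.finrank ℂ H : ℂ) := by
    rw [opTrace]
    exact LinearMap.trace_one ℂ H
  rw [h3] at h1
  have h4 : (Module.finrank ℂ H : ℂ) ≠ 0 := fun h0 => by simp [h0] at h1
  rw [← hT, htr, eq_div_iff h4, mul_right_comm, h1, one_mul]

theorem highestProj_eq {v : H} (hq : IsQuarkSystem π p q) (hv : IsHighestUnit π p q v) :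
    highestProj π p q = InnerProductSpace.rankOne ℂ v v := by
  ext x
  simp only [highestProj]
  have := Submodule.starProjection_unit_singleton ℂ hv.norm_eq x
  rw [InnerProductSpace.rankOne_apply, ← this]
  congr 2
  exact weightSpace_eq_span hq hv

/-- The group element chosen in `berezin` differs from g by an element of the stabilizer of ξ. This
fixes the weight and so multiplies v by a phase, which cancels in the expectation value. -/
theorem berezin_orbitPt {v : H} (hq : IsQuarkSystem π p q) (hv : IsHighestUnit π p q v) {ξ : Mat3}
    {c : ℂ} (hc : domWeight p q = c • ξ) (A : H →L[ℂ] H) (g : SU3) :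
    berezin ξ π p q A (orbitPt ξ g) = inner ℂ ((π g : H →L[ℂ] H) v) (A ((π g : H →L[ℂ] H) v)) := by
  have hspec := (orbitPt ξ g).2.choose_spec
  set h := (orbitPt ξ g).2.choose with hh
  change opTrace (A * opRep π h (highestProj π p q)) = _
  rw [highestProj_eq hq hv, opRep_rankOne, opTrace_mul_rankOne]
  have hk : ((g⁻¹ * h : SU3) : Mat3) * domWeight p q * (((g⁻¹ * h)⁻¹ : SU3) : Mat3) =
      domWeight p q := by
    have h1 : (h : Mat3) * ξ * ((h⁻¹ : SU3) : Mat3) = (g : Mat3) * ξ * ((g⁻¹ : SU3) : Mat3) := hspec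
    rw [hc, mul_inv_rev, inv_inv, Matrix.mul_smul, Matrix.smul_mul]
    congr 1
    calc ((g⁻¹ * h : SU3) : Mat3) * ξ * ((h⁻¹ * g : SU3) : Mat3)
        = ((g⁻¹ : SU3) : Mat3) * ((h : Mat3) * ξ * ((h⁻¹ : SU3) : Mat3)) * (g : Mat3) := by
          simp only [Submonoid.coe_mul, mul_assoc]
      _ = (((g⁻¹ : SU3) : Mat3) * (g : Mat3)) * ξ * (((g⁻¹ : SU3) : Mat3) * (g : Mat3)) := by
          rw [h1]; simp only [mul_assoc]
      _ = ξ := by rw [coe_inv_mul, one_mul, mul_one]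
  obtain ⟨z, hz, hzv⟩ := rep_stabilizer_highest hq hv hk
  have h2 : (π h : H →L[ℂ] H) v = z • (π g : H →L[ℂ] H) v := by
    rw [← map_smul, ← hzv, ← mul_apply_eq_comp, ← Submonoid.coe_mul, ← map_mul, mul_inv_cancel_left]
  rw [h2, map_smul, inner_smul_left, inner_smul_right, ← mul_assoc,
    ← Complex.normSq_eq_conj_mul_self, Complex.normSq_eq_norm_sq, hz]
  simp

end Rep

/-! ### Linear functions and the Poisson bracket on the orbit -/

theorem basisE_conjTranspose (j : Fin 8) : (basisE j)ᴴ = -basisE j := by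
  have h : (gellMann j)ᴴ = gellMann j := by
    ext a b
    fin_cases j <;> fin_cases a <;> fin_cases b <;> simp [gellMann]
  rw [basisE, Matrix.conjTranspose_smul, h, ← neg_smul, ← neg_div]
  simp

theorem coordE_eq (j : Fin 8) (X : Mat3) : coordE j X = -(basisE j * X).trace := by
  rw [coordE, basisE_conjTranspose, neg_mul, Matrix.trace_neg]

theorem coordE_add (j : Fin 8) (X Y : Mat3) : coordE j (X + Y) = coordE j X + coordE j Y := by
  rw [coordE, mul_add, Matrix.trace_add]; rfl

theorem coordE_smul (j : Fin 8) (c : ℂ) (X : Mat3) : coordE j (c • X) = c * coordE j X := by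
  rw [coordE, Matrix.mul_smul, Matrix.trace_smul]; rfl

/-- The coordinates as linear maps. -/
def coordLin (j : Fin 8) : Mat3 →ₗ[ℂ] ℂ where
  toFun := coordE j
  map_add' := coordE_add j
  map_smul' := coordE_smul j

/-- Completeness of the Gell-Mann matrices, extended complex linearly; the identity matrix spans the
complement, whence the trace correction. -/
theorem sum_coordE_smul (Z : Mat3) :
    ∑ l, coordE l Z • basisE l = Z - (Z.trace / 3) • (1 : Mat3) := by
  have h2 : ((Real.sqrt 2 : ℝ) : ℂ) ^ 2 = 2 := by
    rw [← Complex.ofReal_pow, Real.sq_sqrt (by norm_num)]; norm_num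
  have h2' : ((Real.sqrt 2 : ℝ) : ℂ)⁻¹ ^ 2 = 1 / 2 := by rw [inv_pow, h2]; norm_num
  have h3 : ((Real.sqrt 3 : ℝ) : ℂ) ^ 2 = 3 := by
    rw [← Complex.ofReal_pow, Real.sq_sqrt (by norm_num)]; norm_num
  have h3' : ((Real.sqrt 3 : ℝ) : ℂ)⁻¹ ^ 2 = 1 / 3 := by rw [inv_pow, h3]; norm_num
  have hI := Complex.I_sq
  have key : ∀ l, coordE l Z • basisE l = ((1 / 2 : ℂ) * (gellMann l * Z).trace) • gellMann l := by
    intro l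
    rw [coordE_eq, basisE, Matrix.smul_mul, Matrix.trace_smul, smul_smul, smul_eq_mul, div_eq_mul_inv]
    congr 1
    linear_combination (-(gellMann l * Z).trace * ((Real.sqrt 2 : ℝ) : ℂ)⁻¹ ^ 2) * hI +
      (gellMann l * Z).trace * h2'
  simp only [key, Fin.sum_univ_eight]
  ext a b
  simp only [gellMann, Matrix.trace_fin_three, Matrix.mul_apply, Fin.sum_univ_three, Matrix.add_apply,
    Matrix.sub_apply, Matrix.smul_apply]
  -- Only t² = 1/3 is needed from here on.
  generalize ((Real.sqrt 3 : ℝ) : ℂ)⁻¹ = t at *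
  clear key h2 h2' h3
  fin_cases a <;> fin_cases b <;> simp <;> grind

theorem sum_coordE_mul (M N : Mat3) :
    ∑ l, coordE l M * coordE l N = -(M * N).trace + M.trace * N.trace / 3 := by
  have h := congrArg (fun K => -(K * N).trace) (sum_coordE_smul M)
  simp only [Finset.sum_mul, Matrix.trace_sum, Matrix.smul_mul, Matrix.trace_smul, sub_mul,
    Matrix.trace_sub, one_mul, smul_eq_mul, ← Finset.sum_neg_distrib] at h
  simp only [coordE_eq _ N, mul_neg]
  rw [h]; ring

/-- Invariance of the trace form moves the commutator from the basis elements to x. -/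
theorem structConst_sum (x : Mat3) (k j : Fin 8) :
    ∑ l, structConst l k j * coordE l x = coordE j (x * basisE k - basisE k * x) := by
  simp only [structConst]
  have h1 : (basisE k * basisE j - basisE j * basisE k).trace = 0 := by
    rw [Matrix.trace_sub, Matrix.trace_mul_comm (basisE k) (basisE j), sub_self]
  rw [sum_coordE_mul, coordE_eq, h1, zero_mul, zero_div, add_zero, sub_mul, mul_sub,
    Matrix.trace_sub, Matrix.trace_sub, mul_assoc (basisE k),
    Matrix.trace_mul_comm (basisE k) (basisE j * x), mul_assoc, mul_assoc]

theorem structConst_antisymm (l k j : Fin 8) : structConst l k j = -structConst l j k := by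
  rw [structConst, structConst, coordE_eq, coordE_eq, ← Matrix.trace_neg, ← mul_neg, neg_sub, neg_neg]

theorem poissonBracket_antisymm (F G : PolySU3) : poissonBracket F G = -poissonBracket G F := by
  rw [poissonBracket, poissonBracket, Finset.sum_comm, ← Finset.sum_neg_distrib]
  refine Finset.sum_congr rfl fun k _ => ?_
  rw [← Finset.sum_neg_distrib]
  refine Finset.sum_congr rfl fun j _ => ?_
  rw [← Finset.sum_neg_distrib]
  refine Finset.sum_congr rfl fun l _ => ?_
  rw [structConst_antisymm, map_neg]
  ring

theorem poissonBracket_add_right (F G G' : PolySU3) :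
    poissonBracket F (G + G') = poissonBracket F G + poissonBracket F G' := by
  simp only [poissonBracket, map_add, mul_add, Finset.sum_add_distrib]

theorem poissonBracket_mul_right (F G G' : PolySU3) :
    poissonBracket F (G * G') = G * poissonBracket F G' + poissonBracket F G * G' := by
  simp only [poissonBracket, MvPolynomial.pderiv_mul, Finset.mul_sum, Finset.sum_mul,
    ← Finset.sum_add_distrib]
  refine Finset.sum_congr rfl fun _ _ => Finset.sum_congr rfl fun _ _ =>
    Finset.sum_congr rfl fun _ _ => ?_
  ring

theorem poissonBracket_C_right (F : PolySU3) (c : ℂ) : poissonBracket F (MvPolynomial.C c) = 0 := by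
  simp [poissonBracket]

/-- The linear polynomial `∑ y_j x_j` for a matrix with the coordinates `y_j`. -/
def linPoly : Mat3 →ₗ[ℂ] PolySU3 where
  toFun Y := ∑ j, MvPolynomial.C (coordE j Y) * MvPolynomial.X j
  map_add' Y Z := by simp only [coordE_add, map_add, add_mul, Finset.sum_add_distrib]
  map_smul' c Y := by
    simp only [coordE_smul, map_mul, mul_assoc, RingHom.id_apply, MvPolynomial.smul_eq_C_mul,
      Finset.mul_sum]

/-- Restriction to the orbit as an algebra homomorphism. -/
def restrictAlg (ξ : Mat3) : PolySU3 →ₐ[ℂ] (adOrbit ξ → ℂ) :=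
  MvPolynomial.aeval fun j (x : adOrbit ξ) => coordE j (x : Mat3)

theorem restrict_eq (ξ : Mat3) (F : PolySU3) : restrict ξ F = restrictAlg ξ F := by
  funext x
  change MvPolynomial.eval (fun j => coordE j (x : Mat3)) F = restrictAlg ξ F x
  induction F using MvPolynomial.induction_on with
  | C a => simp [restrictAlg]
  | add F G hF hG => rw [map_add, map_add, hF, hG]; rfl
  | mul_X F j hF => rw [map_mul, map_mul, hF]; simp [restrictAlg]

theorem restrict_apply (ξ : Mat3) (F : PolySU3) (x : adOrbit ξ) :
    restrict ξ F x = MvPolynomial.eval (fun j => coordE j (x : Mat3)) F := rfl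

theorem restrict_mul (ξ : Mat3) (F G : PolySU3) :
    restrict ξ (F * G) = restrict ξ F * restrict ξ G := by
  rw [restrict_eq, restrict_eq, restrict_eq, map_mul]

theorem restrict_linPoly {ξ : Mat3} (Y : Mat3) (x : adOrbit ξ) :
    restrict ξ (linPoly Y) x = -((x : Mat3) * Y).trace + (x : Mat3).trace * Y.trace / 3 := by
  rw [restrict_apply, ← sum_coordE_mul]
  simp [linPoly, mul_comm]

/-- The derivative of the polynomial `F` at `x` in the direction `[x, Z]`. -/
def dirD (F : PolySU3) (x : Mat3) : Mat3 →ₗ[ℂ] ℂ where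
  toFun Z := ∑ j, coordE j (x * Z - Z * x) *
    MvPolynomial.eval (fun j => coordE j x) (MvPolynomial.pderiv j F)
  map_add' Z Z' := by
    rw [← Finset.sum_add_distrib]
    refine Finset.sum_congr rfl fun j _ => ?_
    rw [← add_mul, ← coordE_add, mul_add, add_mul, add_sub_add_comm]
  map_smul' c Z := by
    rw [RingHom.id_apply, smul_eq_mul, Finset.mul_sum]
    refine Finset.sum_congr rfl fun j _ => ?_
    rw [← mul_assoc, ← coordE_smul, Matrix.mul_smul, Matrix.smul_mul, smul_sub]

theorem dirD_apply (F : PolySU3) (x Z : Mat3) : dirD F x Z = ∑ j, coordE j (x * Z - Z * x) *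
    MvPolynomial.eval (fun j => coordE j x) (MvPolynomial.pderiv j F) := rfl

theorem dirD_one (F : PolySU3) (x : Mat3) : dirD F x 1 = 0 := by
  have h : ∀ j, coordE j (0 : Mat3) = 0 := fun j => by simp [coordE]
  rw [dirD_apply]
  refine Finset.sum_eq_zero fun j _ => ?_
  rw [mul_one, one_mul, sub_self, h, zero_mul]

theorem restrict_poissonBracket {ξ : Mat3} (F G : PolySU3) (x : adOrbit ξ) :
    restrict ξ (poissonBracket F G) x =
      ∑ k, MvPolynomial.eval (fun j => coordE j (x : Mat3)) (MvPolynomial.pderiv k G) *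
        dirD F x (basisE k) := by
  rw [restrict_apply, poissonBracket, Finset.sum_comm, map_sum]
  refine Finset.sum_congr rfl fun k _ => ?_
  rw [map_sum, dirD_apply, Finset.mul_sum]
  refine Finset.sum_congr rfl fun j _ => ?_
  rw [map_sum, ← structConst_sum, Finset.sum_mul, Finset.mul_sum]
  refine Finset.sum_congr rfl fun l _ => ?_
  simp
  ring

theorem restrict_poissonBracket_X {ξ : Mat3} (F : PolySU3) (k : Fin 8) (x : adOrbit ξ) :
    restrict ξ (poissonBracket F (MvPolynomial.X k)) x = dirD F x (basisE k) := by
  rw [restrict_poissonBracket, Finset.sum_eq_single k]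
  · simp
  · intro j _ hj
    rw [MvPolynomial.pderiv_X_of_ne (Ne.symm hj), map_zero, zero_mul]
  · simp

theorem dirD_eq_sum (F : PolySU3) (x Z : Mat3) :
    dirD F x Z = ∑ k, coordE k Z * dirD F x (basisE k) := by
  have h := congrArg (dirD F x) (sum_coordE_smul Z)
  rw [map_sub, map_smul, dirD_one, smul_zero, sub_zero, map_sum] at h
  rw [← h]
  simp

/-- The Hamiltonian vector fields of linear functions are the generators of the adjoint action; this
links the Poisson bracket to equivariance. -/
theorem restrict_poissonBracket_linPoly_right {ξ : Mat3} (F : PolySU3) (Z : Mat3) (x : adOrbit ξ) :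
    restrict ξ (poissonBracket F (linPoly Z)) x = dirD F x Z := by
  rw [restrict_poissonBracket, dirD_eq_sum]
  refine Finset.sum_congr rfl fun k _ => ?_
  congr 1
  simp only [linPoly, LinearMap.coe_mk, AddHom.coe_mk, map_sum, MvPolynomial.pderiv_C_mul, map_mul,
    MvPolynomial.eval_C]
  rw [Finset.sum_eq_single k]
  · simp
  · intro j _ hj
    rw [MvPolynomial.pderiv_X_of_ne hj]; simp
  · simp

theorem restrict_poissonBracket_linPoly_left {ξ : Mat3} (F : PolySU3) (Z : Mat3) (x : adOrbit ξ) :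
    restrict ξ (poissonBracket (linPoly Z) F) x = -dirD F x Z := by
  rw [poissonBracket_antisymm, map_neg, Pi.neg_apply, restrict_poissonBracket_linPoly_right]

/-- The chain rule for polynomials. -/
theorem hasDerivAt_eval {c : ℝ → Fin 8 → ℂ} {c' : Fin 8 → ℂ} {t : ℝ}
    (hc : ∀ j, HasDerivAt (fun u => c u j) (c' j) t) (F : PolySU3) :
    HasDerivAt (fun u => MvPolynomial.eval (c u) F)
      (∑ j, c' j * MvPolynomial.eval (c t) (MvPolynomial.pderiv j F)) t := by
  induction F using MvPolynomial.induction_on with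
  | C a => simpa using hasDerivAt_const t a
  | add F G hF hG =>
    simp only [map_add, mul_add, Finset.sum_add_distrib]
    exact hF.fun_add hG
  | mul_X F j hF =>
    have h := hF.fun_mul (hc j)
    simp only [map_mul, MvPolynomial.eval_X]
    convert! h using 1
    simp only [MvPolynomial.pderiv_mul, map_add, map_mul, MvPolynomial.eval_X, mul_add,
      Finset.sum_add_distrib, Finset.sum_mul]
    congr 1
    · exact Finset.sum_congr rfl fun i _ => by ring
    · rw [Finset.sum_eq_single j]
      · simp [mul_comm]
      · intro i _ hi
        rw [MvPolynomial.pderiv_X_of_ne (Ne.symm hi)]; simp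
      · simp

theorem smul_orbit_coe {ξ : Mat3} (g : SU3) (x : adOrbit ξ) :
    ((g • x : adOrbit ξ) : Mat3) = (g : Mat3) * (x : Mat3) * ((g⁻¹ : SU3) : Mat3) := rfl

theorem funRep_apply {ξ : Mat3} (g : SU3) (f : adOrbit ξ → ℂ) (x : adOrbit ξ) :
    funRep ξ g f x = f (g⁻¹ • x) := rfl

/-- The group acts on functions through the inverse, so the point moves with the velocity [x, Y] and
not [Y, x]. -/
theorem hasDerivAt_funRep {ξ : Mat3} (F : PolySU3) (Y : su3) (x : adOrbit ξ) :
    HasDerivAt (fun t : ℝ => funRep ξ (expSU3 (t • Y)) (restrict ξ F) x) (dirD F x Y) 0 := by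
  have hj : ∀ j, HasDerivAt (fun t : ℝ => coordE j ((expSU3 (t • -Y) : Mat3) * (x : Mat3) *
      (((expSU3 (t • -Y))⁻¹ : SU3) : Mat3))) (coordE j ((x : Mat3) * Y - Y * (x : Mat3))) 0 := by
    intro j
    have := hasDerivAt_linear_conj ((coordLin j).restrictScalars ℝ) (-Y) (x : Mat3)
    convert! this using 1
    have : ((-Y : su3) : Mat3) = -(Y : Mat3) := rfl
    rw [this, neg_mul, mul_neg, sub_neg_eq_add, neg_add_eq_sub]
    rfl
  have h := hasDerivAt_eval hj F
  have h0 : (0 : ℝ) • -Y = 0 := Subtype.ext (by simp)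
  simp only [h0, expSU3_zero, inv_one, OneMemClass.coe_one, one_mul, mul_one] at h
  have h1 : ∀ t : ℝ, (expSU3 (t • Y))⁻¹ = expSU3 (t • -Y) := fun t => by
    rw [expSU3_inv]
    congr 1
    exact Subtype.ext (by simp)
  have h2 : (fun t : ℝ => funRep ξ (expSU3 (t • Y)) (restrict ξ F) x) = fun t : ℝ =>
      MvPolynomial.eval (fun j => coordE j ((expSU3 (t • -Y) : Mat3) * (x : Mat3) *
        (((expSU3 (t • -Y))⁻¹ : SU3) : Mat3))) F := by
    funext t
    rw [funRep_apply, h1, restrict_apply, smul_orbit_coe]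
  rw [h2, dirD_apply]
  exact h

/-- For Z in `su3` the derivative is taken along a curve inside the orbit. -/
theorem dirD_congr {ξ : Mat3} {F F' : PolySU3} (h : restrict ξ F = restrict ξ F') (x : adOrbit ξ)
    (Z : Mat3) : dirD F x Z = dirD F' x Z := by
  induction Z using su3_induction with
  | hsu Y =>
    have h1 := hasDerivAt_funRep F Y x
    rw [h] at h1
    exact h1.unique (hasDerivAt_funRep F' Y x)
  | h1 => rw [dirD_one, dirD_one]
  | hadd Z W h h' => rw [map_add, map_add, h, h']
  | hsmul c Z h => rw [map_smul, map_smul, h]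

/-- The restriction of the Poisson bracket to the orbit depends only on the restrictions. -/
theorem restrict_poissonBracket_congr {ξ : Mat3} {F F' G G' : PolySU3}
    (hF : restrict ξ F = restrict ξ F') (hG : restrict ξ G = restrict ξ G') :
    restrict ξ (poissonBracket F G) = restrict ξ (poissonBracket F' G') := by
  have key : ∀ {F F' : PolySU3} (G : PolySU3), restrict ξ F = restrict ξ F' →
      restrict ξ (poissonBracket F G) = restrict ξ (poissonBracket F' G) := by
    intro F F' G h
    funext x
    rw [restrict_poissonBracket, restrict_poissonBracket]
    exact Finset.sum_congr rfl fun k _ => by rw [dirD_congr h]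
  rw [key G hF, poissonBracket_antisymm, map_neg, key F' hG, ← map_neg, ← poissonBracket_antisymm]

theorem exists_smul_eq {ξ : Mat3} (x y : adOrbit ξ) : ∃ g : SU3, g • x = y := by
  obtain ⟨_, g, rfl⟩ := x
  obtain ⟨_, h, rfl⟩ := y
  refine ⟨h * g⁻¹, Subtype.ext ?_⟩
  rw [smul_orbit_coe]
  simp only [mul_inv_rev, inv_inv, Submonoid.coe_mul]
  calc (h : Mat3) * ((g⁻¹ : SU3) : Mat3) * ((g : Mat3) * ξ * ((g⁻¹ : SU3) : Mat3)) *
        ((g : Mat3) * ((h⁻¹ : SU3) : Mat3))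
      = (h : Mat3) * (((g⁻¹ : SU3) : Mat3) * (g : Mat3)) * ξ *
        (((g⁻¹ : SU3) : Mat3) * (g : Mat3)) * ((h⁻¹ : SU3) : Mat3) := by simp only [mul_assoc]
    _ = _ := by rw [coe_inv_mul, mul_one, mul_one]

/-- The Casimir functions on the orbit are constant. -/
theorem restrict_const_of_poissonBracket_eq_zero {ξ : Mat3} {F : PolySU3}
    (h : ∀ k x, restrict ξ (poissonBracket F (MvPolynomial.X k)) x = 0) (x y : adOrbit ξ) :
    restrict ξ F x = restrict ξ F y := by
  have h0 : ∀ (x : adOrbit ξ) Z, dirD F x Z = 0 := fun x Z => by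
    rw [dirD_eq_sum]
    exact Finset.sum_eq_zero fun k _ => by rw [← restrict_poissonBracket_X, h, mul_zero]
  have hinv : ∀ (g : SU3) (x : adOrbit ξ), restrict ξ F (g⁻¹ • x) = restrict ξ F x := by
    intro g x
    -- The derivative of F vanishes along the curve joining x to its translate, and every g is
    -- reached by such a curve.
    obtain ⟨Y, rfl⟩ := expSU3_surjective g
    let f : ℝ → ℂ := fun t => funRep ξ (expSU3 (t • Y)) (restrict ξ F) x
    have hf : ∀ t, HasDerivAt f 0 t := fun t => by
      have h1 := hasDerivAt_funRep F Y ((expSU3 (t • Y))⁻¹ • x)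
      rw [h0] at h1
      rw [← add_neg_cancel t] at h1
      have h2 := HasDerivAt.comp_add_const t (-t) h1
      refine h2.congr_of_eventuallyEq (Eventually.of_forall fun u => ?_)
      simp only [f, funRep_apply]
      rw [← mul_smul, ← mul_inv_rev, ← expSU3_add, add_comm u, add_neg_cancel_left]
    have h1 := is_const_of_deriv_eq_zero (fun t => (hf t).differentiableAt)
      (fun t => (hf t).deriv) 1 0
    have h00 : (0 : ℝ) • Y = 0 := Subtype.ext (by simp)
    simp only [f, one_smul, h00, expSU3_zero, funRep_apply, inv_one, one_smul] at h1
    exact h1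
  obtain ⟨g, rfl⟩ := exists_smul_eq x y
  rw [← hinv g (g • x), inv_smul_smul]

/-! ### Noncommutative polynomials in the matrix units -/

/-- Noncommutative polynomials in the matrix units. -/
abbrev NCPoly : Type := FreeAlgebra ℂ (Fin 3 × Fin 3)

/-- A linear map on matrices is determined by the matrix units. -/
theorem linearMap_eq_sum {E : Type*} [AddCommGroup E] [Module ℂ E] (t : Mat3 →ₗ[ℂ] E) (Z : Mat3) :
    t Z = ∑ p : Fin 3 × Fin 3, Z p.1 p.2 • t (Matrix.single p.1 p.2 1) := by
  conv_lhs => rw [Matrix.matrix_eq_sum_single Z]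
  rw [map_sum, Fintype.sum_prod_type]
  refine Finset.sum_congr rfl fun i _ => ?_
  rw [map_sum]
  refine Finset.sum_congr rfl fun j _ => ?_
  rw [← map_smul, Matrix.smul_single, smul_eq_mul, mul_one]

/-- The linear noncommutative polynomial of a matrix. -/
def ncLin : Mat3 →ₗ[ℂ] NCPoly where
  toFun Z := ∑ p : Fin 3 × Fin 3, Z p.1 p.2 • FreeAlgebra.ι ℂ p
  map_add' Y Z := by simp only [Matrix.add_apply, add_smul, Finset.sum_add_distrib]
  map_smul' c Z := by
    simp only [Matrix.smul_apply, smul_eq_mul, mul_smul, Finset.smul_sum, RingHom.id_apply]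

theorem ncLin_apply (Z : Mat3) : ncLin Z = ∑ p : Fin 3 × Fin 3, Z p.1 p.2 • FreeAlgebra.ι ℂ p := rfl

theorem ncLin_single (p : Fin 3 × Fin 3) : ncLin (Matrix.single p.1 p.2 1) = FreeAlgebra.ι ℂ p := by
  rw [ncLin_apply, Finset.sum_eq_single p]
  · simp
  · intro q _ hq
    rw [Matrix.single_apply_of_ne, zero_smul]
    rintro ⟨h1, h2⟩
    exact hq (Prod.ext h1.symm h2.symm)
  · simp

/-- Induction for noncommutative polynomials, with the linear ones as generators. -/
theorem ncPoly_induction {C : NCPoly → Prop} (hs : ∀ c, C (algebraMap ℂ NCPoly c))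
    (hl : ∀ Z, C (ncLin Z)) (hm : ∀ u w, C u → C w → C (u * w)) (ha : ∀ u w, C u → C w → C (u + w))
    (u : NCPoly) : C u :=
  FreeAlgebra.induction ℂ (Fin 3 × Fin 3) (motive := C) hs (fun p => ncLin_single p ▸ hl _) hm ha u

/-- The algebra homomorphism that extends a linear map on matrices. -/
def ncLift {B : Type*} [Ring B] [Algebra ℂ B] (t : Mat3 →ₗ[ℂ] B) : NCPoly →ₐ[ℂ] B :=
  FreeAlgebra.lift ℂ fun p => t (Matrix.single p.1 p.2 1)

theorem ncLift_lin {B : Type*} [Ring B] [Algebra ℂ B] (t : Mat3 →ₗ[ℂ] B) (Z : Mat3) :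
    ncLift t (ncLin Z) = t Z := by
  rw [linearMap_eq_sum t, ncLin_apply, map_sum]
  refine Finset.sum_congr rfl fun p _ => ?_
  rw [map_smul, ncLift, FreeAlgebra.lift_ι_apply]

/-- Conjugation by a group element, as a linear map. -/
def conjLin (g : SU3) : Mat3 →ₗ[ℂ] Mat3 where
  toFun Z := (g : Mat3) * Z * ((g⁻¹ : SU3) : Mat3)
  map_add' Y Z := by rw [mul_add, add_mul]
  map_smul' c Z := by simp

theorem conjLin_apply (g : SU3) (Z : Mat3) :
    conjLin g Z = (g : Mat3) * Z * ((g⁻¹ : SU3) : Mat3) := rfl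

/-- The adjoint action on noncommutative polynomials. -/
def ncAd (g : SU3) : NCPoly →ₐ[ℂ] NCPoly := ncLift (ncLin ∘ₗ conjLin g)

theorem ncAd_lin (g : SU3) (Z : Mat3) : ncAd g (ncLin Z) = ncLin (conjLin g Z) := ncLift_lin _ _

/-- The commutative polynomial of a noncommutative one. -/
def ncAbel : NCPoly →ₐ[ℂ] PolySU3 := ncLift linPoly

theorem ncAbel_lin (Z : Mat3) : ncAbel (ncLin Z) = linPoly Z := ncLift_lin _ _

/-- The classical symbol of a noncommutative polynomial. -/
def symb (ξ : Mat3) : NCPoly →ₐ[ℂ] (adOrbit ξ → ℂ) := (restrictAlg ξ).comp ncAbel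

theorem symb_eq (ξ : Mat3) (u : NCPoly) : symb ξ u = restrict ξ (ncAbel u) := by
  rw [restrict_eq]; rfl

theorem symb_lin {ξ : Mat3} (Z : Mat3) (x : adOrbit ξ) :
    symb ξ (ncLin Z) x = -((x : Mat3) * Z).trace + (x : Mat3).trace * Z.trace / 3 := by
  rw [symb_eq, ncAbel_lin, restrict_linPoly]

theorem symb_mem (ξ : Mat3) (u : NCPoly) : symb ξ u ∈ polyOrbit ξ := ⟨ncAbel u, (symb_eq ξ u).symm⟩

theorem trace_conj (g : SU3) (Z : Mat3) : (conjLin g Z).trace = Z.trace := by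
  rw [conjLin_apply, Matrix.trace_mul_comm, ← mul_assoc, coe_inv_mul, one_mul]

theorem funRep_mul {ξ : Mat3} (g : SU3) (f f' : adOrbit ξ → ℂ) :
    funRep ξ g (f * f') = funRep ξ g f * funRep ξ g f' := rfl

theorem symb_ad {ξ : Mat3} (g : SU3) (u : NCPoly) : symb ξ (ncAd g u) = funRep ξ g (symb ξ u) := by
  induction u using ncPoly_induction with
  | hs c => rw [AlgHom.commutes, AlgHom.commutes]; rfl
  | hl Z =>
    funext x
    rw [ncAd_lin, funRep_apply, symb_lin, symb_lin, smul_orbit_coe, inv_inv, trace_conj]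
    have h1 := trace_conj g⁻¹ (x : Mat3)
    rw [conjLin_apply, inv_inv] at h1
    rw [h1, conjLin_apply, ← mul_assoc, ← mul_assoc, Matrix.trace_mul_comm, ← mul_assoc, ← mul_assoc]
  | hm u w hu hw => rw [map_mul, map_mul, hu, hw, map_mul, funRep_mul]
  | ha u w hu hw => rw [map_add, map_add, hu, hw, map_add, map_add]

theorem restrict_X_eq_symb {ξ : Mat3} (hξ : ξ.trace = 0) (j : Fin 8) :
    restrict ξ (MvPolynomial.X j) = symb ξ (ncLin (basisE j)) := by
  funext x
  have hx : (x : Mat3).trace = 0 := by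
    obtain ⟨_, g, rfl⟩ := x
    exact (trace_conj g ξ).trans hξ
  rw [symb_lin, hx, zero_mul, zero_div, add_zero, Matrix.trace_mul_comm, ← coordE_eq, restrict_apply,
    MvPolynomial.eval_X]

/-- The coordinate x_j is the symbol of the generator E_j, and the symbol map is an algebra
homomorphism. -/
theorem exists_symb_eq {ξ : Mat3} (hξ : ξ.trace = 0) (F : PolySU3) :
    ∃ u, symb ξ u = restrict ξ F := by
  induction F using MvPolynomial.induction_on with
  | C a => exact ⟨algebraMap ℂ NCPoly a, by rw [AlgHom.commutes, restrict_eq,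
      ← MvPolynomial.algebraMap_eq, AlgHom.commutes]⟩
  | add F G hF hG =>
    obtain ⟨u, hu⟩ := hF
    obtain ⟨w, hw⟩ := hG
    exact ⟨u + w, by rw [map_add, map_add, hu, hw]⟩
  | mul_X F j hF =>
    obtain ⟨u, hu⟩ := hF
    exact ⟨u * ncLin (basisE j), by rw [map_mul, hu, restrict_mul, restrict_X_eq_symb hξ]⟩

/-- The commutator of noncommutative polynomials is the quantization of their Poisson bracket: in
every representation of the generators with `[t Z, t Z'] = c t [Z, Z']`. -/
theorem exists_commutator.{v} (ξ : Mat3) (u w : NCPoly) : ∃ z : NCPoly,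
    symb ξ z = -restrict ξ (poissonBracket (ncAbel u) (ncAbel w)) ∧
    ∀ {B : Type v} [Ring B] [Algebra ℂ B] (t : Mat3 →ₗ[ℂ] B) (c : ℂ),
      (∀ Z Z', t Z * t Z' - t Z' * t Z = c • t (Z * Z' - Z' * Z)) →
      ncLift t u * ncLift t w - ncLift t w * ncLift t u = c • ncLift t z := by
  -- First the left factor is a generator; afterwards the Leibniz rule is applied in the left
  -- factor. Since z is built from u and w alone, the same z serves all representations and all
  -- constants c.
  have key : ∀ Z w, ∃ z : NCPoly,
      symb ξ z = -restrict ξ (poissonBracket (ncAbel (ncLin Z)) (ncAbel w)) ∧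
      ∀ {B : Type v} [Ring B] [Algebra ℂ B] (t : Mat3 →ₗ[ℂ] B) (c : ℂ),
      (∀ Z Z', t Z * t Z' - t Z' * t Z = c • t (Z * Z' - Z' * Z)) →
      ncLift t (ncLin Z) * ncLift t w - ncLift t w * ncLift t (ncLin Z) = c • ncLift t z := by
    intro Z w
    induction w using ncPoly_induction with
    | hs a =>
      refine ⟨0, ?_, fun t c h => ?_⟩
      · rw [AlgHom.commutes, MvPolynomial.algebraMap_eq, poissonBracket_C_right, map_zero, map_zero,
          neg_zero]
      · rw [AlgHom.commutes, ← Algebra.commutes, sub_self, map_zero, smul_zero]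
    | hl Z' =>
      refine ⟨ncLin (Z * Z' - Z' * Z), ?_, fun t c h => by simp only [ncLift_lin, h]⟩
      funext x
      rw [Pi.neg_apply, ncAbel_lin, ncAbel_lin, restrict_poissonBracket_linPoly_right, symb_lin,
        dirD_apply]
      have h1 : ∀ j, MvPolynomial.eval (fun j => coordE j (x : Mat3))
          (MvPolynomial.pderiv j (linPoly Z)) = coordE j Z := by
        intro j
        simp only [linPoly, LinearMap.coe_mk, AddHom.coe_mk, map_sum, MvPolynomial.pderiv_C_mul,
          map_mul, MvPolynomial.eval_C]
        rw [Finset.sum_eq_single j]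
        · simp
        · intro i _ hi
          rw [MvPolynomial.pderiv_X_of_ne hi]; simp
        · simp
      have h2 : ∀ Y Y' : Mat3, (Y * Y' - Y' * Y).trace = 0 := fun Y Y' => by
        rw [Matrix.trace_sub, Matrix.trace_mul_comm, sub_self]
      simp only [h1]
      rw [sum_coordE_mul, h2, h2, mul_zero, zero_mul, zero_div, add_zero, add_zero, neg_neg, sub_mul,
        mul_sub, Matrix.trace_sub, Matrix.trace_sub, ← mul_assoc, ← mul_assoc, neg_sub,
        Matrix.trace_mul_comm ((x : Mat3) * Z) Z', ← mul_assoc]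
    | hm w w' hw hw' =>
      obtain ⟨z, h1, h2⟩ := hw
      obtain ⟨z', h1', h2'⟩ := hw'
      refine ⟨w * z' + z * w', ?_, fun t c h => ?_⟩
      · rw [map_mul ncAbel, poissonBracket_mul_right, map_add, map_add, map_mul, map_mul, h1, h1',
          restrict_mul, restrict_mul, symb_eq, symb_eq]
        ring
      · have e := h2 t c h
        have e' := h2' t c h
        rw [map_add, map_mul, map_mul, map_mul, smul_add, ← mul_smul_comm, ← smul_mul_assoc, ← e, ← e']
        noncomm_ring
    | ha w w' hw hw' =>
      obtain ⟨z, h1, h2⟩ := hw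
      obtain ⟨z', h1', h2'⟩ := hw'
      refine ⟨z + z', ?_, fun t c h => ?_⟩
      · rw [map_add ncAbel, poissonBracket_add_right, map_add, map_add, h1, h1']
        ring
      · rw [map_add, map_add, smul_add, ← h2 t c h, ← h2' t c h]
        noncomm_ring
  induction u using ncPoly_induction with
  | hs a =>
    refine ⟨0, ?_, fun t c h => ?_⟩
    · rw [AlgHom.commutes, MvPolynomial.algebraMap_eq, poissonBracket_antisymm,
        poissonBracket_C_right, neg_zero, map_zero, map_zero, neg_zero]
    · rw [AlgHom.commutes, ← Algebra.commutes, sub_self, map_zero, smul_zero]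
  | hl Z => exact key Z w
  | hm u u' hu hu' =>
    obtain ⟨z, h1, h2⟩ := hu
    obtain ⟨z', h1', h2'⟩ := hu'
    refine ⟨u * z' + z * u', ?_, fun t c h => ?_⟩
    · rw [poissonBracket_antisymm, map_neg] at h1 h1' ⊢
      rw [map_mul ncAbel, poissonBracket_mul_right, map_add, map_add, map_mul, map_mul, h1, h1',
        restrict_mul, restrict_mul, symb_eq, symb_eq]
      ring
    · have e := h2 t c h
      have e' := h2' t c h
      rw [map_add, map_mul, map_mul, map_mul, smul_add, ← mul_smul_comm, ← smul_mul_assoc, ← e, ← e']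
      noncomm_ring
  | ha u u' hu hu' =>
    obtain ⟨z, h1, h2⟩ := hu
    obtain ⟨z', h1', h2'⟩ := hu'
    refine ⟨z + z', ?_, fun t c h => ?_⟩
    · rw [poissonBracket_antisymm, map_neg] at h1 h1' ⊢
      rw [map_add ncAbel, poissonBracket_add_right, map_add, map_add, h1, h1']
      ring
    · rw [map_add, map_add, smul_add, ← h2 t c h, ← h2' t c h]
      noncomm_ring

/-! ### Quantization in a single representation. -/

section Quantization

variable {H : Type*} [NormedAddCommGroup H] [InnerProductSpace ℂ H] [CompleteSpace H]
  [FiniteDimensional ℂ H] {π : SU3 →* unitary (H →L[ℂ] H)}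

/-- The quantization of noncommutative polynomials, with the semiclassical parameter `c`. -/
def quant (π : SU3 →* unitary (H →L[ℂ] H)) (c : ℂ) : NCPoly →ₐ[ℂ] (H →L[ℂ] H) := ncLift (c • lieD π)

theorem quant_lin (π : SU3 →* unitary (H →L[ℂ] H)) (c : ℂ) (Z : Mat3) :
    quant π c (ncLin Z) = c • lieD π Z := ncLift_lin _ _

theorem opRep_apply (π : SU3 →* unitary (H →L[ℂ] H)) (g : SU3) (A : H →L[ℂ] H) :
    opRep π g A = (π g : H →L[ℂ] H) * A * ((π g⁻¹ : unitary (H →L[ℂ] H)) : H →L[ℂ] H) := rfl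

theorem coe_rep_inv_mul (π : SU3 →* unitary (H →L[ℂ] H)) (g : SU3) :
    ((π g⁻¹ : unitary (H →L[ℂ] H)) : H →L[ℂ] H) * (π g : H →L[ℂ] H) = 1 := by
  rw [← Submonoid.coe_mul, ← map_mul, inv_mul_cancel, map_one, OneMemClass.coe_one]

theorem opRep_one_apply (π : SU3 →* unitary (H →L[ℂ] H)) (g : SU3) :
    opRep π g (1 : H →L[ℂ] H) = 1 := by
  have := coe_rep_inv_mul π g⁻¹
  rw [inv_inv] at this
  rw [opRep_apply, mul_one, this]

theorem opRep_mul (π : SU3 →* unitary (H →L[ℂ] H)) (g : SU3) (A B : H →L[ℂ] H) :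
    opRep π g (A * B) = opRep π g A * opRep π g B := by
  simp only [opRep_apply]
  calc _ = (π g : H →L[ℂ] H) * A * 1 * B * ((π g⁻¹ : unitary (H →L[ℂ] H)) : H →L[ℂ] H) := by
        rw [mul_one]; simp only [mul_assoc]
    _ = _ := by rw [← coe_rep_inv_mul π g]; simp only [mul_assoc]

theorem quant_ad (hc : ∀ v, Continuous fun g => (π g : H →L[ℂ] H) v) (c : ℂ) (g : SU3) (u : NCPoly) :
    quant π c (ncAd g u) = opRep π g (quant π c u) := by
  induction u using ncPoly_induction with
  | hs a =>
    rw [AlgHom.commutes, AlgHom.commutes, Algebra.algebraMap_eq_smul_one, map_smul, opRep_one_apply]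
  | hl Z => rw [ncAd_lin, quant_lin, quant_lin, map_smul, conjLin_apply, lieD_conj hc, opRep_apply]
  | hm u w hu hw => rw [map_mul, map_mul, hu, hw, map_mul, opRep_mul]
  | ha u w hu hw => rw [map_add, map_add, hu, hw, map_add, map_add]

/-- One of the two factors c is absorbed in the rescaled generator. The other is the semiclassical
parameter, and `exists_commutator` applies. -/
theorem quant_commutator (hc : ∀ v, Continuous fun g => (π g : H →L[ℂ] H) v) (c : ℂ) (Z Z' : Mat3) :
    (c • lieD π) Z * (c • lieD π) Z' - (c • lieD π) Z' * (c • lieD π) Z =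
      c • (c • lieD π) (Z * Z' - Z' * Z) := by
  simp only [LinearMap.smul_apply, lieD_commutator hc, smul_mul_smul_comm, ← smul_sub, smul_smul]

end Quantization

/-! ### Unitary models of the finite dimensional invariant spaces of noncommutative polynomials -/

/-- A finite family of noncommutative polynomials that transforms by unitary matrices. -/
structure UnitaryFrame (κ : Type) [Fintype κ] [DecidableEq κ] where
  /-- The matrix of a group element. -/
  mat : SU3 → Matrix κ κ ℂ
  /-- The members of the family. -/
  vec : κ → NCPoly
  mat_one : mat 1 = 1
  mat_mul : ∀ g h, mat (g * h) = mat g * mat h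
  mat_star : ∀ g, (mat g)ᴴ = mat g⁻¹
  continuous_mat : ∀ i j, Continuous fun g => mat g i j
  ad_vec : ∀ g j, ncAd g (vec j) = ∑ i, mat g i j • vec i

namespace UnitaryFrame

/-- The constants. -/
def const : UnitaryFrame Unit where
  mat _ := 1
  vec _ := 1
  mat_one := rfl
  mat_mul _ _ := (one_mul 1).symm
  mat_star _ := Matrix.conjTranspose_one
  continuous_mat _ _ := continuous_const
  ad_vec g j := by simp

/-- The generators. -/
def gen : UnitaryFrame (Fin 3 × Fin 3) where
  mat g := Matrix.of fun p q => (g : Mat3) p.1 q.1 * ((g⁻¹ : SU3) : Mat3) q.2 p.2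
  vec p := FreeAlgebra.ι ℂ p
  mat_one := by
    ext p q
    simp only [Matrix.of_apply, inv_one, OneMemClass.coe_one, Matrix.one_apply, Prod.ext_iff]
    by_cases h1 : p.1 = q.1 <;> by_cases h2 : p.2 = q.2 <;> simp [h1, h2, eq_comm]
  mat_mul g h := by
    ext p q
    simp only [Matrix.of_apply, Matrix.mul_apply, mul_inv_rev, Submonoid.coe_mul,
      Fintype.sum_prod_type, Finset.sum_mul_sum]
    refine Finset.sum_congr rfl fun i _ => Finset.sum_congr rfl fun j _ => ?_
    ring
  mat_star g := by
    ext p q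
    simp only [Matrix.conjTranspose_apply, Matrix.of_apply, star_mul', coe_inv_eq, inv_inv, star_star]
  continuous_mat p q := by
    simp only [Matrix.of_apply]
    exact (continuous_entry _ _).mul ((continuous_entry _ _).comp continuous_inv)
  ad_vec g q := by
    rw [← ncLin_single, ncAd_lin, ncLin_apply]
    refine Finset.sum_congr rfl fun p _ => ?_
    congr 1
    simp [conjLin_apply, Matrix.mul_apply, Matrix.single_apply, Matrix.of_apply, ite_and]

variable {κ κ' : Type} [Fintype κ] [DecidableEq κ] [Fintype κ'] [DecidableEq κ']

/-- The products of the members of two families. -/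
def prod (F : UnitaryFrame κ) (F' : UnitaryFrame κ') : UnitaryFrame (κ × κ') where
  mat g := Matrix.kronecker (F.mat g) (F'.mat g)
  vec p := F.vec p.1 * F'.vec p.2
  mat_one := by rw [F.mat_one, F'.mat_one]; exact Matrix.one_kronecker_one
  mat_mul g h := by rw [F.mat_mul, F'.mat_mul]; exact Matrix.mul_kronecker_mul _ _ _ _
  mat_star g := by
    rw [← F.mat_star, ← F'.mat_star]; exact Matrix.conjTranspose_kronecker _ _
  continuous_mat p q := by
    exact (F.continuous_mat p.1 q.1).mul (F'.continuous_mat p.2 q.2)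
  ad_vec g q := by
    rw [map_mul, F.ad_vec, F'.ad_vec, Finset.sum_mul_sum, Fintype.sum_prod_type]
    refine Finset.sum_congr rfl fun i _ => Finset.sum_congr rfl fun j _ => ?_
    rw [smul_mul_smul_comm]; rfl

/-- The union of two families. -/
def sum (F : UnitaryFrame κ) (F' : UnitaryFrame κ') : UnitaryFrame (κ ⊕ κ') where
  mat g := Matrix.fromBlocks (F.mat g) 0 0 (F'.mat g)
  vec := Sum.elim F.vec F'.vec
  mat_one := by rw [F.mat_one, F'.mat_one, Matrix.fromBlocks_one]
  mat_mul g h := by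
    rw [Matrix.fromBlocks_multiply, F.mat_mul, F'.mat_mul]; simp
  mat_star g := by
    rw [Matrix.fromBlocks_conjTranspose, F.mat_star, F'.mat_star]; simp
  continuous_mat p q := by
    rcases p with p | p <;> rcases q with q | q
    · exact F.continuous_mat p q
    · exact continuous_const
    · exact continuous_const
    · exact F'.continuous_mat p q
  ad_vec g q := by
    rcases q with q | q
    · simp [F.ad_vec]
    · simp [F'.ad_vec]

variable (F : UnitaryFrame κ)

/-- The unitary representation given by the matrices. -/
def rep : SU3 →* unitary (EuclideanSpace ℂ κ →L[ℂ] EuclideanSpace ℂ κ) where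
  toFun g := ⟨Matrix.toEuclideanCLM (𝕜 := ℂ) (F.mat g), by
    rw [Unitary.mem_iff, ← map_star, ← map_mul, ← map_mul, Matrix.star_eq_conjTranspose, F.mat_star,
      ← F.mat_mul, ← F.mat_mul, inv_mul_cancel, mul_inv_cancel, F.mat_one, map_one]
    exact ⟨rfl, rfl⟩⟩
  map_one' := Subtype.ext (by simp [F.mat_one])
  map_mul' g h := Subtype.ext (by simp [F.mat_mul])

theorem rep_apply (g : SU3) (x : EuclideanSpace ℂ κ) (i : κ) :
    (F.rep g : EuclideanSpace ℂ κ →L[ℂ] EuclideanSpace ℂ κ) x i = ∑ j, F.mat g i j * x j := rfl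

theorem continuous_rep_apply (x : EuclideanSpace ℂ κ) :
    Continuous fun g => (F.rep g : EuclideanSpace ℂ κ →L[ℂ] EuclideanSpace ℂ κ) x := by
  refine (PiLp.continuous_toLp 2 _).comp (continuous_pi fun i => ?_)
  exact continuous_finsetSum _ fun j _ => (F.continuous_mat i j).mul continuous_const

/-- The linear combinations of the family. -/
def comb : EuclideanSpace ℂ κ →ₗ[ℂ] NCPoly where
  toFun x := ∑ i, x i • F.vec i
  map_add' x y := by simp only [PiLp.add_apply, add_smul, Finset.sum_add_distrib]
  map_smul' c x := by
    simp only [PiLp.smul_apply, smul_eq_mul, mul_smul, Finset.smul_sum, RingHom.id_apply]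

theorem comb_apply (x : EuclideanSpace ℂ κ) : F.comb x = ∑ i, x i • F.vec i := rfl

theorem comb_rep (g : SU3) (x : EuclideanSpace ℂ κ) :
    F.comb ((F.rep g : EuclideanSpace ℂ κ →L[ℂ] EuclideanSpace ℂ κ) x) = ncAd g (F.comb x) := by
  rw [comb_apply, comb_apply, map_sum]
  simp only [map_smul, F.ad_vec, rep_apply, Finset.sum_smul, Finset.smul_sum, smul_smul]
  rw [Finset.sum_comm]
  simp only [mul_comm]

theorem vec_mem_span_iff (u : NCPoly) :
    u ∈ Submodule.span ℂ (Set.range F.vec) ↔ ∃ x, F.comb x = u := by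
  rw [Submodule.mem_span_range_iff_exists_fun]
  exact ⟨fun ⟨c, hc⟩ => ⟨WithLp.toLp 2 c, hc⟩, fun ⟨x, hx⟩ => ⟨fun i => x i, hx⟩⟩

end UnitaryFrame

/-- Every noncommutative polynomial is a combination of a unitary frame. -/
theorem exists_unitaryFrame (u : NCPoly) : ∃ (κ : Type) (_ : Fintype κ) (_ : DecidableEq κ)
    (F : UnitaryFrame κ) (x : EuclideanSpace ℂ κ), F.comb x = u := by
  suffices h : ∃ (κ : Type) (_ : Fintype κ) (_ : DecidableEq κ)
      (F : UnitaryFrame κ), u ∈ Submodule.span ℂ (Set.range F.vec) by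
    obtain ⟨κ, i1, i2, F, h⟩ := h
    exact ⟨κ, i1, i2, F, (F.vec_mem_span_iff u).1 h⟩
  induction u using ncPoly_induction with
  | hs c =>
    refine ⟨Unit, inferInstance, inferInstance, UnitaryFrame.const, ?_⟩
    rw [Algebra.algebraMap_eq_smul_one]
    exact Submodule.smul_mem _ _ (Submodule.subset_span ⟨(), rfl⟩)
  | hl Z =>
    refine ⟨_, inferInstance, inferInstance, UnitaryFrame.gen, ?_⟩
    rw [ncLin_apply]
    exact Submodule.sum_mem _ fun p _ => Submodule.smul_mem _ _ (Submodule.subset_span ⟨p, rfl⟩)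
  | hm u w hu hw =>
    obtain ⟨κ, i1, i2, F, hF⟩ := hu
    obtain ⟨κ', i1', i2', F', hF'⟩ := hw
    refine ⟨_, inferInstance, inferInstance, F.prod F', ?_⟩
    have h := Submodule.mul_mem_mul hF hF'
    rw [Submodule.span_mul_span] at h
    refine Submodule.span_mono ?_ h
    rintro _ ⟨_, ⟨i, rfl⟩, _, ⟨j, rfl⟩, rfl⟩
    exact ⟨(i, j), rfl⟩
  | ha u w hu hw =>
    obtain ⟨κ, i1, i2, F, hF⟩ := hu
    obtain ⟨κ', i1', i2', F', hF'⟩ := hw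
    refine ⟨_, inferInstance, inferInstance, F.sum F', Submodule.add_mem _ ?_ ?_⟩
    · refine Submodule.span_mono ?_ hF
      rintro _ ⟨i, rfl⟩
      exact ⟨Sum.inl i, rfl⟩
    · refine Submodule.span_mono ?_ hF'
      rintro _ ⟨i, rfl⟩
      exact ⟨Sum.inr i, rfl⟩

/-- Highest weight vectors among the noncommutative polynomials. -/
def NCHighest (a : ℕ × ℕ) (w : NCPoly) : Prop :=
  ∃ (κ : Type) (_ : Fintype κ) (_ : DecidableEq κ) (F : UnitaryFrame κ) (y : EuclideanSpace ℂ κ),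
    IsHighest (hilbRep F.rep) a y ∧ F.comb y = w

/-- `NCPoly` is given no topology; the continuity needed for derivatives is that of linear maps on
the finite dimensional frame. -/
theorem NCHighest.map {a : ℕ × ℕ} {w : NCPoly} (hw : NCHighest a w) {V : Type*} [AddCommGroup V]
    [Module ℂ V] [TopologicalSpace V] [IsTopologicalAddGroup V] [ContinuousSMul ℂ V]
    {ρ : Representation ℂ SU3 V} {L : NCPoly →ₗ[ℂ] V} (hL : ∀ g u, L (ncAd g u) = ρ g (L u)) :
    IsHighest ρ a (L w) := by
  obtain ⟨κ, i1, i2, F, y, hy, rfl⟩ := hw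
  refine IsHighest.map (L := L ∘ₗ F.comb) (fun g x => ?_)
    (LinearMap.continuous_of_finiteDimensional _) hy
  change L (F.comb ((F.rep g : EuclideanSpace ℂ κ →L[ℂ] EuclideanSpace ℂ κ) x)) = _
  rw [F.comb_rep, hL]
  rfl

/-- The noncommutative polynomials are spanned by the translates of highest weight vectors. -/
theorem span_ncAd_highest :
    Submodule.span ℂ {x | ∃ g a w, NCHighest a w ∧ x = ncAd g w} = ⊤ := by
  rw [eq_top_iff]
  intro u _
  obtain ⟨κ, i1, i2, F, x, rfl⟩ := exists_unitaryFrame u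
  have h : x ∈ Submodule.span ℂ _ := (span_translates_highest F.continuous_rep_apply).symm ▸
    Submodule.mem_top (x := x)
  have h2 := Submodule.mem_map_of_mem (f := F.comb) h
  rw [Submodule.map_span] at h2
  refine Submodule.span_mono ?_ h2
  rintro _ ⟨_, ⟨g, a, v, hv, rfl⟩, rfl⟩
  exact ⟨g, a, F.comb v, ⟨κ, i1, i2, F, v, hv, rfl⟩, F.comb_rep g v⟩

/-- Highest weight vectors in `Poly(𝒪_ξ)` are symbols of highest weight vectors. -/
theorem exists_ncHighest_symb {ξ : Mat3} (hξ : ξ.trace = 0) {f : adOrbit ξ → ℂ}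
    (hf : f ∈ polyOrbit ξ) {a : ℕ × ℕ} (ha : IsHighest (funRep ξ) a f) :
    ∃ w, NCHighest a w ∧ symb ξ w = f := by
  obtain ⟨P, rfl⟩ := hf
  obtain ⟨u, hu⟩ := exists_symb_eq hξ P
  obtain ⟨κ, i1, i2, F, x, rfl⟩ := exists_unitaryFrame u
  rw [← hu] at ha
  obtain ⟨y, hy, hy'⟩ := exists_highest_lift F.continuous_rep_apply
    ((symb ξ).toLinearMap ∘ₗ F.comb) (ρ := funRep ξ) (fun g x => by
      simp only [LinearMap.comp_apply, F.comb_rep, AlgHom.toLinearMap_apply, symb_ad]) (x := x) ha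
  exact ⟨F.comb y, ⟨κ, i1, i2, F, y, hy, rfl⟩, hy'.trans hu⟩

theorem smul_orbitPt {ξ : Mat3} (g h : SU3) : g • orbitPt ξ h = orbitPt ξ (g * h) := by
  refine Subtype.ext ?_
  rw [smul_orbit_coe]
  simp only [orbitPt, mul_inv_rev, Submonoid.coe_mul, mul_assoc]

/-- The images of a noncommutative polynomial under equivariant maps to `Poly(𝒪_ξ)` lie in a finite
dimensional space. -/
theorem exists_finiteDimensional_range {ξ : Mat3} (u : NCPoly) :
    ∃ L : Submodule ℂ (adOrbit ξ → ℂ), FiniteDimensional ℂ L ∧ L ≤ polyOrbit ξ ∧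
      ∀ Φ : NCPoly →ₗ[ℂ] (adOrbit ξ → ℂ), (∀ u, Φ u ∈ polyOrbit ξ) →
        (∀ g u, Φ (ncAd g u) = funRep ξ g (Φ u)) → Φ u ∈ L := by
  obtain ⟨κ, i1, i2, F, x, rfl⟩ := exists_unitaryFrame u
  let J : (adOrbit ξ → ℂ) →ₗ[ℂ] (SU3 → ℂ) := LinearMap.funLeft ℂ ℂ (orbitPt ξ)
  have hJ : Function.Injective J := LinearMap.funLeft_injective_of_surjective ℂ ℂ _ (by
    rintro ⟨_, g, rfl⟩
    exact ⟨g, rfl⟩)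
  -- By equivariance, the pullback of Φ(u) to the group is a combination of these matrix
  -- coefficients, which do not depend on Φ; only the values of Φ at the base point enter as
  -- coefficients.
  let K : Submodule ℂ (SU3 → ℂ) := Submodule.span ℂ (Set.range fun i g =>
    (F.rep g⁻¹ : EuclideanSpace ℂ κ →L[ℂ] EuclideanSpace ℂ κ) x i)
  have hK : FiniteDimensional ℂ K := FiniteDimensional.span_of_finite ℂ (Set.finite_range _)
  have hKJ : FiniteDimensional ℂ (K.comap J) :=
    Module.Finite.of_injective (J.restrict (p := K.comap J) (q := K) fun _ h => h)
      (fun a b h => Subtype.ext (hJ (congrArg Subtype.val h)))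
  refine ⟨polyOrbit ξ ⊓ K.comap J, Submodule.finiteDimensional_inf_right _ _, inf_le_left,
    fun Φ hΦ hΦ' => ⟨hΦ _, ?_⟩⟩
  change J (Φ (F.comb x)) ∈ K
  have h : J (Φ (F.comb x)) = ∑ i, Φ (F.vec i) (orbitPt ξ 1) • fun g =>
      (F.rep g⁻¹ : EuclideanSpace ℂ κ →L[ℂ] EuclideanSpace ℂ κ) x i := by
    funext g
    have h1 : Φ (F.comb x) (orbitPt ξ g) = Φ (ncAd g⁻¹ (F.comb x)) (orbitPt ξ 1) := by
      rw [hΦ', funRep_apply, inv_inv]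
      rw [smul_orbitPt, mul_one]
    change Φ (F.comb x) (orbitPt ξ g) = _
    rw [h1, ← F.comb_rep, F.comb_apply, map_sum, Finset.sum_apply, Finset.sum_apply]
    refine Finset.sum_congr rfl fun i _ => ?_
    rw [map_smul, Pi.smul_apply, Pi.smul_apply, smul_eq_mul, smul_eq_mul, mul_comm]
  rw [h]
  exact Submodule.sum_mem _ fun i _ => Submodule.smul_mem _ _ (Submodule.subset_span ⟨i, rfl⟩)

/-! ### The semiclassical limit of the quantization -/

theorem trace_of_mem_rationalArc {ξ : Mat3} (hξ : ξ ∈ rationalArc) : ξ.trace = 0 := by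
  obtain ⟨⟨x, y, _, _, _, rfl⟩, _⟩ := hξ
  rw [xiPoint, Matrix.trace_smul, Matrix.trace_diagonal]
  have h : 2 * (x : ℂ) + y + (-x + y) + (-x - 2 * y) = 0 := by ring
  simp [Fin.sum_univ_three, h]

/-- An infimum of positive numbers might vanish, so the scales are bounded below. For Rξ = ω_(p,q)
the first and last diagonal entries differ by i(p + q), and p + q is a positive integer. -/
theorem integralRadius_pos {ξ : Mat3} (hξ : ξ ∈ rationalArc) : 0 < integralRadius ξ := by
  obtain ⟨⟨x, y, hx, hy, hxy, rfl⟩, hne⟩ := hξ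
  -- K is the difference of the imaginary parts of the first and last diagonal entries of ξ, so RK =
  -- p + q ≥ 1.
  set K : ℝ := (3 * x + 3 * y) / Real.sqrt 6 with hK
  have hxy0 : 0 < x + y := by
    by_contra h
    have h1 : x = 0 := by linarith
    have h2 : y = 0 := by linarith
    rw [h1, h2] at hxy
    norm_num at hxy
  have h6 : (0 : ℝ) < Real.sqrt 6 := Real.sqrt_pos.2 (by norm_num)
  have hK0 : 0 < K := div_pos (by linarith) h6
  have hle : K⁻¹ ≤ integralRadius (xiPoint x y) := by
    refine le_csInf hne ?_
    rintro R ⟨hR, p, q, h⟩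
    have h0 := congrArg (fun M : Mat3 => (M 0 0).im - (M 2 2).im) h
    simp only [xiPoint, domWeight, Matrix.smul_apply, Matrix.diagonal_apply_eq, smul_eq_mul] at h0
    have e1 : ∀ t : ℝ, ((R : ℂ) * (Complex.I / (Real.sqrt 6 : ℂ) * (t : ℂ))).im =
        R * t / Real.sqrt 6 := fun t => by
      have : (R : ℂ) * (Complex.I / (Real.sqrt 6 : ℂ) * (t : ℂ)) =
          ((R * t / Real.sqrt 6 : ℝ) : ℂ) * Complex.I := by push_cast; ring
      rw [this, Complex.im_ofReal_mul, Complex.I_im, mul_one]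
    have e2 : ∀ t : ℝ, (Complex.I / 3 * (t : ℂ)).im = t / 3 := fun t => by
      have : Complex.I / 3 * (t : ℂ) = ((t / 3 : ℝ) : ℂ) * Complex.I := by push_cast; ring
      rw [this, Complex.im_ofReal_mul, Complex.I_im, mul_one]
    have a1 := e1 (2 * x + y)
    have a2 := e1 (-x - 2 * y)
    have a3 := e2 (2 * p + q)
    have a4 := e2 (-p - 2 * q)
    push_cast at a1 a2 a3 a4
    simp only [Matrix.cons_val_zero, Matrix.cons_val_two, Matrix.tail_cons, Matrix.head_cons] at h0
    rw [a1, a2, a3, a4] at h0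
    have h1 : R * K = p + q := by
      have : R * K = R * (2 * x + y) / Real.sqrt 6 - R * (-x - 2 * y) / Real.sqrt 6 := by
        rw [hK]; ring
      rw [this, h0]; ring
    have h2 : (1 : ℝ) ≤ p + q := by
      have : (0 : ℝ) < p + q := h1 ▸ mul_pos hR hK0
      exact_mod_cast this
    rw [inv_le_iff_one_le_mul₀ hK0]
    linarith
  exact (inv_pos.2 hK0).trans_le hle

theorem continuous_orbitPt_of_mem {ξ : Mat3} {f : adOrbit ξ → ℂ} (hf : f ∈ polyOrbit ξ) :
    Continuous fun g => f (orbitPt ξ g) := by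
  obtain ⟨F, rfl⟩ := hf
  refine (MvPolynomial.continuous_eval F).comp (continuous_pi fun j => ?_)
  have h1 : Continuous fun g : SU3 => (g : Mat3) * ξ * ((g⁻¹ : SU3) : Mat3) :=
    (continuous_subtype_val.mul continuous_const).mul (continuous_subtype_val.comp continuous_inv)
  exact (continuous_const.mul h1).matrix_trace

theorem exists_bound_of_mem {ξ : Mat3} {f : adOrbit ξ → ℂ} (hf : f ∈ polyOrbit ξ) :
    ∃ C, 0 ≤ C ∧ ∀ x, ‖f x‖ ≤ C := by
  obtain ⟨C, hC⟩ := isCompact_univ.exists_bound_of_continuousOn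
    (continuous_orbitPt_of_mem hf).continuousOn
  refine ⟨C, (norm_nonneg _).trans (hC 1 trivial), ?_⟩
  rintro ⟨_, g, rfl⟩
  exact hC g trivial

theorem tendsto_inv_sqrt : Tendsto (fun s : ℕ+ => (Real.sqrt (s : ℕ))⁻¹) atTop (𝓝 0) := by
  have h : Tendsto (fun s : ℕ+ => ((s : ℕ) : ℝ)) atTop atTop :=
    tendsto_natCast_atTop_atTop.comp tendsto_PNat_val_atTop_atTop
  exact (Real.tendsto_sqrt_atTop.comp h).inv_tendsto_atTop

/-- Integrals over the group converge under uniform convergence. -/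
theorem tendsto_integral_of_uniform {f : ℕ+ → SU3 → ℂ} {f₀ : SU3 → ℂ} (hf : ∀ s, Continuous (f s))
    (hf₀ : Continuous f₀) {C : ℝ} (h : ∀ s g, ‖f s g - f₀ g‖ ≤ C * (Real.sqrt (s : ℕ))⁻¹) :
    Tendsto (fun s => ∫ g, f s g ∂haarSU3) atTop (𝓝 (∫ g, f₀ g ∂haarSU3)) := by
  rw [tendsto_iff_norm_sub_tendsto_zero]
  refine squeeze_zero (fun _ => norm_nonneg _) (fun s => ?_)
    (by simpa using tendsto_inv_sqrt.const_mul C)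
  rw [← integral_sub (integrable_haar_of_continuous (hf s)) (integrable_haar_of_continuous hf₀)]
  refine (norm_integral_le_of_norm_le_const (Eventually.of_forall (h s))).trans ?_
  simp

section Ray

variable {ξ : Mat3} {p₁ q₁ : ℕ} {H : ℕ+ → Type*} [∀ s, NormedAddCommGroup (H s)]
  [∀ s, InnerProductSpace ℂ (H s)] [∀ s, CompleteSpace (H s)] [∀ s, FiniteDimensional ℂ (H s)]
  {π : ∀ s, SU3 →* unitary (H s →L[ℂ] H s)}

/-- The quantization of noncommutative polynomials in the system `s` of a ray. -/
def rayQuant (ξ : Mat3) (π : ∀ s, SU3 →* unitary (H s →L[ℂ] H s)) (s : ℕ+) :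
    NCPoly →ₐ[ℂ] (H s →L[ℂ] H s) :=
  quant (π s) (-Complex.I / (((s : ℝ) * integralRadius ξ : ℝ) : ℂ))

variable (hξ : ξ ∈ rationalArc) (hω : domWeight p₁ q₁ = (integralRadius ξ : ℂ) • ξ)
  (hπ : ∀ s : ℕ+, IsQuarkSystem (π s) (s * p₁) (s * q₁))

include hω in
theorem domWeight_ray (s : ℕ+) : domWeight (s * p₁) (s * q₁) =
    (((s : ℝ) * integralRadius ξ : ℝ) : ℂ) • ξ := by
  have h : domWeight (s * p₁) (s * q₁) = ((s : ℕ) : ℂ) • domWeight p₁ q₁ := by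
    rw [domWeight, domWeight, smul_comm ((s : ℕ) : ℂ)]
    congr 1
    ext i j
    fin_cases i <;> fin_cases j <;> simp <;> ring
  rw [h, hω, smul_smul]
  push_cast
  rfl

include hξ hω hπ

/-- The diagonal part of Z acts on v exactly by the classical value at ξ. The off-diagonal entries
contribute at most √(s(p₁ + q₁)) each, which the factor 1/(s r(ξ)) turns into O(s^(-1/2)). -/
theorem norm_rayQuant_lin_sub_le (s : ℕ+) {v : H s} (hv : IsHighestUnit (π s) (s * p₁) (s * q₁) v)
    (Z : Mat3) : ‖rayQuant ξ π s (ncLin Z) v - symb ξ (ncLin Z) (orbitPt ξ 1) • v‖ ≤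
      (∑ p : Fin 3 × Fin 3, ‖Z p.1 p.2‖) * (Real.sqrt (p₁ + q₁) / integralRadius ξ) *
        (Real.sqrt (s : ℕ))⁻¹ := by
  have hr := integralRadius_pos hξ
  have hs : (0 : ℝ) < (s : ℕ) := Nat.cast_pos.2 s.pos
  set R : ℝ := (s : ℝ) * integralRadius ξ with hR
  have hR0 : 0 < R := mul_pos hs hr
  have hRC : (R : ℂ) ≠ 0 := Complex.ofReal_ne_zero.2 hR0.ne'
  have hξ' : ξ = ((R : ℂ)⁻¹ * Complex.I) • Matrix.diagonal fun i => (wt (s * p₁) (s * q₁) i : ℂ) := by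
    rw [mul_smul, ← domWeight_eq, domWeight_ray hω, ← hR, smul_smul, inv_mul_cancel₀ hRC, one_smul]
  have hsymb : symb ξ (ncLin Z) (orbitPt ξ 1) = ∑ p : Fin 3 × Fin 3, Z p.1 p.2 *
      ((-Complex.I / R) * (if p.1 = p.2 then (wt (s * p₁) (s * q₁) p.1 : ℂ) else 0)) := by
    have h1 : ((orbitPt ξ 1 : adOrbit ξ) : Mat3) = ξ := by simp [orbitPt]
    rw [symb_lin, h1, trace_of_mem_rationalArc hξ, zero_mul, zero_div, add_zero]
    conv_lhs => rw [hξ']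
    rw [Matrix.smul_mul, Matrix.trace_smul, Matrix.trace, Fintype.sum_prod_type, smul_eq_mul,
      Finset.mul_sum, ← Finset.sum_neg_distrib]
    refine Finset.sum_congr rfl fun i _ => ?_
    rw [Finset.sum_eq_single i]
    · simp only [Matrix.diag_apply, Matrix.diagonal_mul, if_true]; ring
    · intro j _ hj
      rw [if_neg (Ne.symm hj)]; ring
    · simp
  have hq : rayQuant ξ π s (ncLin Z) v = ∑ p : Fin 3 × Fin 3, Z p.1 p.2 • ((-Complex.I / R) •
      lieD (π s) (Matrix.single p.1 p.2 1) v) := by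
    rw [rayQuant, quant_lin, linearMap_eq_sum (lieD (π s)) Z, Finset.smul_sum, FunLike.coe_sum,
      Finset.sum_apply]
    refine Finset.sum_congr rfl fun p _ => ?_
    rw [smul_comm]; rfl
  rw [hsymb, hq, Finset.sum_smul, ← Finset.sum_sub_distrib, Finset.sum_mul, Finset.sum_mul]
  refine (norm_sum_le _ _).trans (Finset.sum_le_sum fun p _ => ?_)
  rw [mul_smul, ← smul_sub, norm_smul, mul_assoc]
  refine mul_le_mul_of_nonneg_left ?_ (norm_nonneg _)
  rw [mul_smul, ← smul_sub, norm_smul, norm_div, norm_neg, Complex.norm_I, Complex.norm_real,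
    Real.norm_of_nonneg hR0.le]
  have h1 := norm_lieD_single_sub_le (hπ s) hv p.1 p.2
  refine (mul_le_mul_of_nonneg_left h1 (by positivity)).trans (le_of_eq ?_)
  push_cast
  rw [← mul_add, Real.sqrt_mul hs.le, hR]
  have h2 := Real.mul_self_sqrt hs.le
  have h3 : Real.sqrt (s : ℕ) ≠ 0 := (Real.sqrt_pos.2 hs).ne'
  field_simp
  linear_combination Real.sqrt (p₁ + q₁) * h2

theorem norm_rayQuant_lin_le (s : ℕ+) (Z : Mat3) : ‖rayQuant ξ π s (ncLin Z)‖ ≤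
    (∑ p : Fin 3 × Fin 3, ‖Z p.1 p.2‖) * (3 * (p₁ + q₁) / integralRadius ξ) := by
  obtain ⟨v, hv⟩ := (hπ s).exists_highestUnit
  have hr := integralRadius_pos hξ
  have hs : (0 : ℝ) < (s : ℕ) := Nat.cast_pos.2 s.pos
  have hR0 : (0 : ℝ) < (s : ℝ) * integralRadius ξ := mul_pos hs hr
  rw [rayQuant, quant_lin, linearMap_eq_sum (lieD (π s)) Z, Finset.smul_sum, Finset.sum_mul]
  refine (norm_sum_le _ _).trans (Finset.sum_le_sum fun p _ => ?_)
  rw [smul_comm, norm_smul]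
  refine mul_le_mul_of_nonneg_left ?_ (norm_nonneg _)
  rw [norm_smul, norm_div, norm_neg, Complex.norm_I, Complex.norm_real, Real.norm_of_nonneg hR0.le]
  refine (mul_le_mul_of_nonneg_left (norm_lieD_single_le (hπ s) hv p.1 p.2)
    (by positivity)).trans (le_of_eq ?_)
  push_cast
  field_simp

theorem exists_norm_rayQuant_le (u : NCPoly) : ∃ C, 0 ≤ C ∧ ∀ s, ‖rayQuant ξ π s u‖ ≤ C := by
  induction u using ncPoly_induction with
  | hs c =>
    refine ⟨‖c‖, norm_nonneg _, fun s => ?_⟩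
    rw [AlgHom.commutes, Algebra.algebraMap_eq_smul_one, norm_smul]
    exact mul_le_of_le_one_right (norm_nonneg _) ContinuousLinearMap.norm_id_le
  | hl Z =>
    have hr := integralRadius_pos hξ
    exact ⟨_, by positivity, fun s => norm_rayQuant_lin_le hξ hω hπ s Z⟩
  | hm u w hu hw =>
    obtain ⟨C, hC, h⟩ := hu
    obtain ⟨C', hC', h'⟩ := hw
    refine ⟨C * C', mul_nonneg hC hC', fun s => ?_⟩
    rw [map_mul]
    exact (norm_mul_le _ _).trans (mul_le_mul (h s) (h' s) (norm_nonneg _) hC)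
  | ha u w hu hw =>
    obtain ⟨C, hC, h⟩ := hu
    obtain ⟨C', hC', h'⟩ := hw
    refine ⟨C + C', add_nonneg hC hC', fun s => ?_⟩
    rw [map_add]
    exact (norm_add_le _ _).trans (add_le_add (h s) (h' s))

/-- The coherent states are approximate eigenvectors of the quantization. -/
theorem exists_norm_rayQuant_coherent_le (u : NCPoly) : ∃ C, 0 ≤ C ∧ ∀ s (v : H s),
    IsHighestUnit (π s) (s * p₁) (s * q₁) v → ∀ g : SU3,
      ‖rayQuant ξ π s u ((π s g : H s →L[ℂ] H s) v) -
        symb ξ u (orbitPt ξ g) • (π s g : H s →L[ℂ] H s) v‖ ≤ C * (Real.sqrt (s : ℕ))⁻¹ := by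
  induction u using ncPoly_induction with
  | hs c =>
    refine ⟨0, le_rfl, fun s v hv g => le_of_eq ?_⟩
    rw [AlgHom.commutes, AlgHom.commutes, Algebra.algebraMap_eq_smul_one]
    simp
  | hl Z =>
    have hr := integralRadius_pos hξ
    -- Conjugation by g reduces the claim to the highest weight vector and the matrix g⁻¹Zg. Entries
    -- of unitary matrices are at most 1, so this constant bounds the sum of the entries of g⁻¹Zg
    -- for all g.
    let C₀ : ℝ := ∑ p : Fin 3 × Fin 3, ∑ i : Fin 3, ∑ j : Fin 3, ‖Z i j‖
    have hC₀ : 0 ≤ C₀ := by positivity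
    refine ⟨C₀ * (Real.sqrt (p₁ + q₁) / integralRadius ξ), by positivity, fun s v hv g => ?_⟩
    have h1 : rayQuant ξ π s (ncLin Z) ((π s g : H s →L[ℂ] H s) v) =
        (π s g : H s →L[ℂ] H s) (rayQuant ξ π s (ncAd g⁻¹ (ncLin Z)) v) := by
      have h := quant_ad (hπ s).continuous (-Complex.I / (((s : ℝ) * integralRadius ξ : ℝ) : ℂ)) g
        (ncAd g⁻¹ (ncLin Z))
      rw [ncAd_lin, ncAd_lin, conjLin_apply, conjLin_apply, inv_inv] at h
      have h2 : (g : Mat3) * (((g⁻¹ : SU3) : Mat3) * Z * (g : Mat3)) * ((g⁻¹ : SU3) : Mat3) = Z := by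
        calc _ = ((g : Mat3) * ((g⁻¹ : SU3) : Mat3)) * Z * ((g : Mat3) * ((g⁻¹ : SU3) : Mat3)) := by
              simp only [mul_assoc]
          _ = Z := by rw [coe_mul_inv, one_mul, mul_one]
      rw [h2] at h
      rw [rayQuant, h, ncAd_lin, conjLin_apply, inv_inv, opRep_apply, mul_apply_eq_comp,
        mul_apply_eq_comp, ← mul_apply_eq_comp ((π s g⁻¹ : unitary _) : H s →L[ℂ] H s),
        coe_rep_inv_mul, one_apply_eq_self]
    have h2 : symb ξ (ncLin Z) (orbitPt ξ g) = symb ξ (ncAd g⁻¹ (ncLin Z)) (orbitPt ξ 1) := by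
      rw [symb_ad, funRep_apply, inv_inv, smul_orbitPt, mul_one]
    rw [h1, h2, ← map_smul, ← map_sub, ContinuousLinearMap.norm_map_of_mem_unitary (π s g).2, ncAd_lin]
    refine (norm_rayQuant_lin_sub_le hξ hω hπ s hv _).trans ?_
    refine mul_le_mul_of_nonneg_right (mul_le_mul_of_nonneg_right ?_ (by positivity)) (by positivity)
    refine Finset.sum_le_sum fun p _ => ?_
    rw [conjLin_apply, Matrix.mul_apply]
    simp only [Matrix.mul_apply, Finset.sum_mul]
    rw [Finset.sum_comm]
    refine (norm_sum_le _ _).trans (Finset.sum_le_sum fun i _ => ?_)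
    refine (norm_sum_le _ _).trans (Finset.sum_le_sum fun j _ => ?_)
    rw [norm_mul, norm_mul]
    have e1 := entry_norm_bound_of_unitary (g⁻¹).2.1 p.1 i
    have e2 := entry_norm_bound_of_unitary ((g⁻¹)⁻¹).2.1 j p.2
    calc _ ≤ 1 * ‖Z i j‖ * 1 := by gcongr
      _ = _ := by ring
  | hm u w hu hw =>
    obtain ⟨C, hC, h⟩ := hu
    obtain ⟨C', hC', h'⟩ := hw
    obtain ⟨B, hB, hBu⟩ := exists_norm_rayQuant_le hξ hω hπ u
    obtain ⟨B', hB', hBw⟩ := exists_bound_of_mem (symb_mem ξ w)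
    refine ⟨B * C' + B' * C, by positivity, fun s v hv g => ?_⟩
    set y := (π s g : H s →L[ℂ] H s) v with hy
    -- The error of w is hit by the operator of u, hence the bound of its norm uniform in s; the
    -- error of u only meets the bounded classical symbol of w.
    have e : rayQuant ξ π s (u * w) y - symb ξ (u * w) (orbitPt ξ g) • y =
        rayQuant ξ π s u (rayQuant ξ π s w y - symb ξ w (orbitPt ξ g) • y) +
          symb ξ w (orbitPt ξ g) • (rayQuant ξ π s u y - symb ξ u (orbitPt ξ g) • y) := by
      rw [map_mul, map_mul, mul_apply_eq_comp, map_sub, map_smul, smul_sub, smul_smul, Pi.mul_apply,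
        mul_comm (symb ξ u (orbitPt ξ g))]
      abel
    rw [e, add_mul, mul_assoc, mul_assoc]
    refine (norm_add_le _ _).trans (add_le_add ?_ ?_)
    · exact (ContinuousLinearMap.le_opNorm _ _).trans
        (mul_le_mul (hBu s) (h' s v hv g) (norm_nonneg _) hB)
    · rw [norm_smul]
      exact mul_le_mul (hBw _) (h s v hv g) (norm_nonneg _) hB'
  | ha u w hu hw =>
    obtain ⟨C, hC, h⟩ := hu
    obtain ⟨C', hC', h'⟩ := hw
    refine ⟨C + C', add_nonneg hC hC', fun s v hv g => ?_⟩
    rw [map_add, map_add, add_apply, Pi.add_apply, add_smul, add_sub_add_comm, add_mul]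
    exact (norm_add_le _ _).trans (add_le_add (h s v hv g) (h' s v hv g))

/-- Expectations of the quantization in coherent states approximate the classical symbol. -/
theorem exists_norm_expectation_le (u : NCPoly) : ∃ C, ∀ s (v : H s),
    IsHighestUnit (π s) (s * p₁) (s * q₁) v → ∀ g : SU3,
      ‖inner ℂ ((π s g : H s →L[ℂ] H s) v) (rayQuant ξ π s u ((π s g : H s →L[ℂ] H s) v)) -
        symb ξ u (orbitPt ξ g)‖ ≤ C * (Real.sqrt (s : ℕ))⁻¹ := by
  obtain ⟨C, hC, h⟩ := exists_norm_rayQuant_coherent_le hξ hω hπ u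
  refine ⟨C, fun s v hv g => ?_⟩
  have hn := (ContinuousLinearMap.norm_map_of_mem_unitary (π s g).2 v).trans hv.norm_eq
  set y := (π s g : H s →L[ℂ] H s) v with hy
  have e : inner ℂ y (rayQuant ξ π s u y) - symb ξ u (orbitPt ξ g) =
      inner ℂ y (rayQuant ξ π s u y - symb ξ u (orbitPt ξ g) • y) := by
    rw [inner_sub_right, inner_smul_right, inner_self_eq_norm_sq_to_K, hn]
    simp
  rw [e]
  refine (norm_inner_le_norm _ _).trans ?_
  rw [hn, one_mul]
  exact h s v hv g

theorem tendsto_opTrace_rayQuant (u : NCPoly) :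
    Tendsto (fun s => opTrace (rayQuant ξ π s u) / (Module.finrank ℂ (H s) : ℂ)) atTop
      (𝓝 (orbitIntegral ξ (symb ξ u))) := by
  obtain ⟨C, h⟩ := exists_norm_expectation_le hξ hω hπ u
  choose v hv using fun s => (hπ s).exists_highestUnit
  simp only [← fun s => integral_coherent (hπ s) (hv s).norm_eq (rayQuant ξ π s u)]
  exact tendsto_integral_of_uniform (fun s => continuous_coherent (hπ s).continuous 1 _ _)
    (continuous_orbitPt_of_mem (symb_mem ξ u)) fun s g => h s (v s) (hv s) g

/-- The normalised trace is the average over g of ⟨Q_s(u)y, Q_s(w)y⟩ for the coherent state y at g,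
and both vectors are close to multiples of the unit vector y. This makes quantization asymptotically
isometric. -/
theorem tendsto_opInner_rayQuant (u w : NCPoly) :
    Tendsto (fun s => opInner (rayQuant ξ π s u) (rayQuant ξ π s w) / (Module.finrank ℂ (H s) : ℂ))
      atTop (𝓝 (orbitInner ξ (symb ξ u) (symb ξ w))) := by
  obtain ⟨C, hC, h⟩ := exists_norm_rayQuant_coherent_le hξ hω hπ u
  obtain ⟨C', hC', h'⟩ := exists_norm_rayQuant_coherent_le hξ hω hπ w
  obtain ⟨B', hB', hBw⟩ := exists_norm_rayQuant_le hξ hω hπ w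
  obtain ⟨B, hB, hBu⟩ := exists_bound_of_mem (symb_mem ξ u)
  choose v hv using fun s => (hπ s).exists_highestUnit
  simp only [opInner, ← fun s => integral_coherent (hπ s) (hv s).norm_eq
    (star (rayQuant ξ π s u) * rayQuant ξ π s w)]
  simp only [mul_apply_eq_comp, ContinuousLinearMap.star_eq_adjoint,
    ContinuousLinearMap.adjoint_inner_right]
  refine tendsto_integral_of_uniform (C := C * B' + B * C')
    (fun s => continuous_coherent (hπ s).continuous _ _ _)
    ((Complex.continuous_conj.comp (continuous_orbitPt_of_mem (symb_mem ξ u))).mul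
      (continuous_orbitPt_of_mem (symb_mem ξ w))) fun s g => ?_
  have hn := (ContinuousLinearMap.norm_map_of_mem_unitary (π s g).2 (v s)).trans (hv s).norm_eq
  have hu := h s (v s) (hv s) g
  have hw := h' s (v s) (hv s) g
  set y := (π s g : H s →L[ℂ] H s) (v s) with hy
  set a := symb ξ u (orbitPt ξ g) with ha
  set b := symb ξ w (orbitPt ξ g) with hb
  have e : inner ℂ (rayQuant ξ π s u y) (rayQuant ξ π s w y) - conj a * b =
      inner ℂ (rayQuant ξ π s u y - a • y) (rayQuant ξ π s w y) +
        inner ℂ (a • y) (rayQuant ξ π s w y - b • y) := by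
    rw [inner_sub_left, inner_sub_right, inner_smul_left, inner_smul_left, inner_smul_right,
      inner_self_eq_norm_sq_to_K, hn]
    simp
  change ‖_ - conj a * b‖ ≤ _
  rw [e, add_mul]
  refine (norm_add_le _ _).trans (add_le_add ?_ ?_)
  · refine (norm_inner_le_norm _ _).trans ?_
    have : ‖rayQuant ξ π s w y‖ ≤ B' := by
      refine (ContinuousLinearMap.le_opNorm _ _).trans ?_
      rw [hn, mul_one]
      exact hBw s
    calc _ ≤ (C * (Real.sqrt (s : ℕ))⁻¹) * B' := mul_le_mul hu this (norm_nonneg _) (by positivity)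
      _ = _ := by ring
  · refine (norm_inner_le_norm _ _).trans ?_
    rw [norm_smul, hn, mul_one, mul_assoc]
    exact mul_le_mul (hBu _) hw (norm_nonneg _) hB

theorem tendsto_orbitInner_berezin {f : adOrbit ξ → ℂ} (hf : f ∈ polyOrbit ξ) (u : NCPoly) :
    Tendsto (fun s : ℕ+ => orbitInner ξ f (berezin ξ (π s) (s * p₁) (s * q₁) (rayQuant ξ π s u)))
      atTop (𝓝 (orbitInner ξ f (symb ξ u))) := by
  obtain ⟨C, h⟩ := exists_norm_expectation_le hξ hω hπ u
  obtain ⟨B, hB, hBf⟩ := exists_bound_of_mem hf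
  choose v hv using fun s => (hπ s).exists_highestUnit
  simp only [orbitInner, orbitIntegral,
    fun s => berezin_orbitPt (hπ s) (hv s) (domWeight_ray hω s) (rayQuant ξ π s u)]
  have hfc : Continuous fun g => conj (f (orbitPt ξ g)) :=
    Complex.continuous_conj.comp (continuous_orbitPt_of_mem hf)
  refine tendsto_integral_of_uniform (C := B * C)
    (fun s => hfc.mul (continuous_coherent (hπ s).continuous 1 _ _))
    (hfc.mul (continuous_orbitPt_of_mem (symb_mem ξ u))) fun s g => ?_
  rw [← mul_sub, norm_mul, RCLike.norm_conj, mul_assoc]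
  exact mul_le_mul (hBf _) (h s (v s) (hv s) g) (norm_nonneg _) hB

end Ray

/-! ### Convergence of matrices and of coefficients -/

section LinearAlgebra

variable {S : Type*} {l : Filter S}

theorem tendsto_matrix {κ κ' : Type*} {M : S → Matrix κ κ' ℂ} {M₀ : Matrix κ κ' ℂ}
    (h : ∀ i j, Tendsto (fun s => M s i j) l (𝓝 (M₀ i j))) : Tendsto M l (𝓝 M₀) :=
  tendsto_pi_nhds.2 fun i => tendsto_pi_nhds.2 fun j => h i j

theorem eventually_isUnit_and_tendsto_inv {κ : Type*} [Fintype κ] [DecidableEq κ]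
    {M : S → Matrix κ κ ℂ} (h : Tendsto M l (𝓝 1)) :
    (∀ᶠ s in l, IsUnit (M s).det) ∧ Tendsto (fun s => (M s)⁻¹) l (𝓝 1) := by
  have hdet : Tendsto (fun s => (M s).det) l (𝓝 1) := by
    have := (Continuous.matrix_det continuous_id).tendsto (1 : Matrix κ κ ℂ)
    simpa [Function.comp_def] using this.comp h
  refine ⟨(hdet.eventually_ne one_ne_zero).mono fun s hs => isUnit_iff_ne_zero.2 hs, ?_⟩
  have hadj : Tendsto (fun s => (M s).adjugate) l (𝓝 1) := by
    have := (Continuous.matrix_adjugate continuous_id).tendsto (1 : Matrix κ κ ℂ)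
    simpa [Function.comp_def] using this.comp h
  have := (hdet.inv₀ one_ne_zero).smul hadj
  simp only [inv_one, one_smul] at this
  refine this.congr fun s => ?_
  rw [Matrix.inv_def, Ring.inverse_eq_inv']

/-- If the linear systems `M s` converge to an injective one, then convergence of the right hand
sides implies convergence of the solutions. -/
theorem tendsto_of_tendsto_linear {κ ι : Type*} [Fintype κ] {M : S → ι → κ → ℂ} {M₀ : ι → κ → ℂ}
    (hM : ∀ i j, Tendsto (fun s => M s i j) l (𝓝 (M₀ i j)))
    (hinj : ∀ c : κ → ℂ, (∀ i, ∑ j, c j * M₀ i j = 0) → c = 0)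
    {c : S → κ → ℂ} {c₀ : κ → ℂ}
    (h : ∀ i, Tendsto (fun s => ∑ j, c s j * M s i j) l (𝓝 (∑ j, c₀ j * M₀ i j))) (j : κ) :
    Tendsto (fun s => c s j) l (𝓝 (c₀ j)) := by
  classical
  -- A functional vanishing on all rows of the limit system would be a nonzero solution of the
  -- homogeneous system.
  have hspan : Submodule.span ℂ (Set.range M₀) = ⊤ := by
    by_contra hne
    obtain ⟨φ, hφ, hφ'⟩ := Submodule.exists_le_ker_of_lt_top _ (lt_top_iff_ne_top.2 hne)
    have h0 : (fun j => φ (Pi.single j 1)) = 0 := by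
      refine hinj _ fun i => ?_
      have h1 : φ (M₀ i) = 0 := hφ' (Submodule.subset_span ⟨i, rfl⟩)
      rw [pi_eq_sum_univ' (M₀ i), map_sum] at h1
      rw [← h1]
      refine Finset.sum_congr rfl fun j _ => ?_
      rw [map_smul, smul_eq_mul, mul_comm]
    refine hφ (LinearMap.pi_ext' fun j => LinearMap.ext_ring ?_)
    exact congrFun h0 j
  have hP : ∀ j : κ, ∃ P : ι →₀ ℂ, (P.sum fun i a => a • M₀ i) = Pi.single j 1 := fun j =>
    Finsupp.mem_span_range_iff_exists_finsupp.1 (hspan ▸ Submodule.mem_top)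
  choose P hP using hP
  -- Finitely many equations suffice: the combinations of rows that yield the unit vectors in the
  -- limit yield an almost identical square system for large s, which can be inverted.
  let Q : S → Matrix κ κ ℂ := fun s => Matrix.of fun j k => (P j).sum fun i a => a * M s i k
  have hQ : Tendsto Q l (𝓝 1) := by
    refine tendsto_matrix fun j k => ?_
    have h1 : (1 : Matrix κ κ ℂ) j k = (P j).sum fun i a => a * M₀ i k := by
      have := congrFun (hP j) k
      rw [Finsupp.sum, Finset.sum_apply] at this
      rw [Finsupp.sum, Matrix.one_eq_pi_single, ← this]
      rfl
    rw [h1]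
    exact tendsto_finsetSum _ fun i _ => (hM i k).const_mul _
  obtain ⟨hu, hinv⟩ := eventually_isUnit_and_tendsto_inv hQ
  have hQc : ∀ j, Tendsto (fun s => (Q s *ᵥ c s) j) l (𝓝 (c₀ j)) := by
    intro j
    have h1 : ∀ (N : ι → κ → ℂ) (d : κ → ℂ),
        ∑ k, ((P j).sum fun i a => a * N i k) * d k = (P j).sum fun i a => a * ∑ k, d k * N i k := by
      intro N d
      simp only [Finsupp.sum, Finset.sum_mul, Finset.mul_sum]
      rw [Finset.sum_comm]
      exact Finset.sum_congr rfl fun i _ => Finset.sum_congr rfl fun k _ => by ring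
    have h2 : c₀ j = (P j).sum fun i a => a * ∑ k, c₀ k * M₀ i k := by
      rw [← h1]
      have h3 : ∀ k, ((P j).sum fun i a => a * M₀ i k) = (Pi.single j 1 : κ → ℂ) k := by
        intro k
        rw [← hP j, Finsupp.sum, Finsupp.sum, Finset.sum_apply]
        rfl
      simp [h3, Pi.single_apply]
    rw [h2]
    have h4 : (fun s => (Q s *ᵥ c s) j) = fun s => (P j).sum fun i a => a * ∑ k, c s k * M s i k := by
      funext s
      rw [← h1]
      rfl
    rw [h4]
    exact tendsto_finsetSum _ fun i _ => (h i).const_mul _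
  have h5 : Tendsto (fun s => ((Q s)⁻¹ *ᵥ (Q s *ᵥ c s)) j) l (𝓝 (((1 : Matrix κ κ ℂ) *ᵥ c₀) j)) := by
    refine tendsto_finsetSum _ fun k _ => ?_
    exact ((tendsto_pi_nhds.1 (tendsto_pi_nhds.1 hinv j) k)).mul (hQc k)
  rw [Matrix.one_mulVec] at h5
  refine h5.congr' (hu.mono fun s hs => ?_)
  rw [Matrix.mulVec_mulVec, Matrix.nonsing_inv_mul _ hs, Matrix.one_mulVec]

theorem norm_entry_sq_le {n m : ℕ} (D : Matrix (Fin n) (Fin m) ℂ) (σ : Fin n) (γ : Fin m) :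
    ‖D σ γ‖ ^ 2 ≤ ‖(Dᴴ * D) γ γ‖ := by
  have h : (Dᴴ * D) γ γ = ((∑ τ, ‖D τ γ‖ ^ 2 : ℝ) : ℂ) := by
    rw [Matrix.mul_apply]
    push_cast
    refine Finset.sum_congr rfl fun τ _ => ?_
    rw [Matrix.conjTranspose_apply, Complex.star_def, Complex.conj_mul']
  rw [h, Complex.norm_real, Real.norm_of_nonneg (by positivity)]
  exact Finset.single_le_sum (f := fun τ => ‖D τ γ‖ ^ 2) (fun _ _ => by positivity)
    (Finset.mem_univ σ)

theorem le_of_isUnit_gram {n m : ℕ} {D : Matrix (Fin n) (Fin m) ℂ} (h : IsUnit (Dᴴ * D).det) :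
    m ≤ n := by
  have h1 : Function.Injective D.mulVecLin := by
    intro x y hxy
    have h2 : D *ᵥ x = D *ᵥ y := hxy
    have h3 : (Dᴴ * D) *ᵥ x = (Dᴴ * D) *ᵥ y := by
      rw [← Matrix.mulVec_mulVec, ← Matrix.mulVec_mulVec, h2]
    exact Matrix.mulVec_injective_of_isUnit ((Matrix.isUnit_iff_isUnit_det _).2 h) h3
  simpa using LinearMap.finrank_le_finrank_of_injective h1

/-- If `D† D → 1` and `R D → 0` then `R → 0`, also for matrices of varying size. -/
theorem tendsto_zero_of_mul_tendsto_zero {m : ℕ} {n : S → ℕ} (hn : ∀ s, n s ≤ m)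
    {D : ∀ s, Matrix (Fin (n s)) (Fin m) ℂ} {R : ∀ s, Matrix (Fin m) (Fin (n s)) ℂ}
    (hD : Tendsto (fun s => (D s)ᴴ * D s) l (𝓝 1))
    (hR : ∀ γ δ, Tendsto (fun s => (R s * D s) γ δ) l (𝓝 0)) :
    Tendsto (fun s => ∑ γ, ∑ σ, ‖R s γ σ‖) l (𝓝 0) := by
  obtain ⟨hu, hinv⟩ := eventually_isUnit_and_tendsto_inv hD
  have hG : ∀ δ ε, Tendsto (fun s => ((D s)ᴴ * D s)⁻¹ δ ε) l (𝓝 ((1 : Matrix _ _ ℂ) δ ε)) :=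
    fun δ ε => tendsto_pi_nhds.1 (tendsto_pi_nhds.1 hinv δ) ε
  have hG' : ∀ ε, Tendsto (fun s => ((D s)ᴴ * D s) ε ε) l (𝓝 1) := fun ε => by
    have := tendsto_pi_nhds.1 (tendsto_pi_nhds.1 hD ε) ε
    rwa [Matrix.one_apply_eq] at this
  have hb : Tendsto (fun s => ∑ _γ : Fin m, ∑ δ : Fin m, ∑ ε : Fin m,
      (‖(R s * D s) _γ δ‖ * ‖((D s)ᴴ * D s)⁻¹ δ ε‖ * Real.sqrt ‖((D s)ᴴ * D s) ε ε‖) * m) l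
      (𝓝 0) := by
    have : (0 : ℝ) = ∑ _γ : Fin m, ∑ δ : Fin m, ∑ ε : Fin m,
        (‖(0 : ℂ)‖ * ‖(1 : Matrix (Fin m) (Fin m) ℂ) δ ε‖ * Real.sqrt ‖(1 : ℂ)‖) * m := by simp
    rw [this]
    refine tendsto_finsetSum _ fun γ _ => tendsto_finsetSum _ fun δ _ =>
      tendsto_finsetSum _ fun ε _ => ?_
    exact (((hR γ δ).norm.mul (hG δ ε).norm).mul
      ((Real.continuous_sqrt.tendsto _).comp (hG' ε).norm)).mul_const _
  refine squeeze_zero' (Eventually.of_forall fun s => by positivity) (hu.mono fun s hs => ?_) hb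
  refine Finset.sum_le_sum fun γ _ => ?_
  -- An invertible Gram matrix makes D injective. With the assumed bound on its number of rows D is
  -- square, and the left inverse (D†D)⁻¹D† is also a right inverse, so R = (RD)(D†D)⁻¹D†.
  have hcard : n s = m := le_antisymm (hn s) (le_of_isUnit_gram hs)
  have h1 : D s * (((D s)ᴴ * D s)⁻¹ * (D s)ᴴ) = 1 := by
    refine (Matrix.mul_eq_one_comm_of_card_eq _ _ _ (by simpa using hcard.symm)).1 ?_
    rw [Matrix.mul_assoc, Matrix.nonsing_inv_mul _ hs]
  have h2 : R s = R s * D s * (((D s)ᴴ * D s)⁻¹ * (D s)ᴴ) := by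
    rw [Matrix.mul_assoc, h1, Matrix.mul_one]
  have h3 : ∀ σ, ‖R s γ σ‖ ≤ ∑ δ : Fin m, ∑ ε : Fin m,
      ‖(R s * D s) γ δ‖ * ‖((D s)ᴴ * D s)⁻¹ δ ε‖ * Real.sqrt ‖((D s)ᴴ * D s) ε ε‖ := by
    intro σ
    conv_lhs => rw [h2, Matrix.mul_apply]
    refine (norm_sum_le _ _).trans (Finset.sum_le_sum fun δ _ => ?_)
    rw [Matrix.mul_apply (M := ((D s)ᴴ * D s)⁻¹), Finset.mul_sum]
    refine (norm_sum_le _ _).trans (Finset.sum_le_sum fun ε _ => ?_)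
    rw [norm_mul, norm_mul, Matrix.conjTranspose_apply, norm_star, ← mul_assoc]
    exact mul_le_mul_of_nonneg_left (Real.le_sqrt_of_sq_le (norm_entry_sq_le _ _ _)) (by positivity)
  refine (Finset.sum_le_card_nsmul _ _ _ fun σ _ => h3 σ).trans (le_of_eq ?_)
  have hcard' : ((n s : ℕ) : ℝ) = m := congrArg _ hcard
  rw [Finset.card_univ, Fintype.card_fin, nsmul_eq_mul, hcard', mul_comm, Finset.sum_mul]
  exact Finset.sum_congr rfl fun δ _ => by rw [Finset.sum_mul]

end LinearAlgebra

/-! ### Finite dimensional spaces of polynomial functions on the orbit. -/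

section FunctionSpaces

variable {ξ : Mat3} {S : Type*} {l : Filter S} {L : Submodule ℂ (adOrbit ξ → ℂ)}

/-- Linear functionals on a finite dimensional space of functions are continuous for pointwise
convergence. -/
theorem tendsto_linear_of_pointwise [FiniteDimensional ℂ L] {f : S → adOrbit ξ → ℂ}
    {f₀ : adOrbit ξ → ℂ} (hf : ∀ s, f s ∈ L) (hf₀ : f₀ ∈ L)
    (h : ∀ x, Tendsto (fun s => f s x) l (𝓝 (f₀ x))) (φ : L →ₗ[ℂ] ℂ) :
    Tendsto (fun s => φ ⟨f s, hf s⟩) l (𝓝 (φ ⟨f₀, hf₀⟩)) := by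
  have hφ : Continuous φ := φ.continuous_of_finiteDimensional
  refine (hφ.tendsto _).comp ?_
  rw [tendsto_subtype_rng]
  exact tendsto_pi_nhds.2 h

/-- In a finite dimensional space of polynomial functions, pointwise convergence is uniform. -/
theorem tendstoUniformly_of_pointwise [FiniteDimensional ℂ L] (hL : L ≤ polyOrbit ξ)
    {f : S → adOrbit ξ → ℂ} {f₀ : adOrbit ξ → ℂ} (hf : ∀ s, f s ∈ L) (hf₀ : f₀ ∈ L)
    (h : ∀ x, Tendsto (fun s => f s x) l (𝓝 (f₀ x))) : TendstoUniformly f f₀ l := by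
  let b := Module.finBasis ℂ L
  choose B hB hBb using fun i => exists_bound_of_mem (hL (b i).2)
  have hsum : ∀ F : L, ∀ x, (F : adOrbit ξ → ℂ) x = ∑ i, b.repr F i * (b i : adOrbit ξ → ℂ) x := by
    intro F x
    conv_lhs => rw [← b.sum_repr F]
    rw [Submodule.coe_sum, Finset.sum_apply]
    rfl
  have hc : ∀ i, Tendsto (fun s => b.repr ⟨f s, hf s⟩ i) l (𝓝 (b.repr ⟨f₀, hf₀⟩ i)) := fun i =>
    tendsto_linear_of_pointwise hf hf₀ h (b.coord i)
  have hb : Tendsto (fun s => ∑ i, ‖b.repr ⟨f s, hf s⟩ i - b.repr ⟨f₀, hf₀⟩ i‖ * B i) l (𝓝 0) := by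
    have : (0 : ℝ) = ∑ i, 0 * B i := by simp
    rw [this]
    exact tendsto_finsetSum _ fun i _ =>
      (tendsto_iff_norm_sub_tendsto_zero.1 (hc i)).mul_const _
  rw [Metric.tendstoUniformly_iff]
  intro ε hε
  filter_upwards [hb.eventually (gt_mem_nhds hε)] with s hs x
  refine lt_of_le_of_lt ?_ hs
  rw [dist_comm, dist_eq_norm]
  have e := hsum ⟨f s, hf s⟩ x
  have e₀ := hsum ⟨f₀, hf₀⟩ x
  simp only at e e₀
  rw [e, e₀, ← Finset.sum_sub_distrib]
  refine (norm_sum_le _ _).trans (Finset.sum_le_sum fun i _ => ?_)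
  rw [← sub_mul, norm_mul]
  exact mul_le_mul_of_nonneg_left (hBb i x) (norm_nonneg _)

theorem orbitInner_sum_smul {ι : Type*} [Fintype ι] {f : adOrbit ξ → ℂ}
    (hf : Continuous fun g => f (orbitPt ξ g)) (c : ι → ℂ) {h : ι → adOrbit ξ → ℂ}
    (hh : ∀ i, Continuous fun g => h i (orbitPt ξ g)) :
    orbitInner ξ f (∑ i, c i • h i) = ∑ i, c i * orbitInner ξ f (h i) := by
  have hc : Continuous fun g => conj (f (orbitPt ξ g)) := Complex.continuous_conj.comp hf
  simp only [orbitInner, orbitIntegral, ← integral_const_mul]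
  rw [← integral_finsetSum (f := fun i g => c i * (conj (f (orbitPt ξ g)) * h i (orbitPt ξ g))) _
    fun i _ => integrable_haar_of_continuous (continuous_const.mul (hc.mul (hh i)))]
  refine integral_congr_ae (Eventually.of_forall fun g => ?_)
  simp only [Finset.sum_apply, Pi.smul_apply, smul_eq_mul, Finset.mul_sum]
  exact Finset.sum_congr rfl fun i _ => by ring

theorem orbitIntegral_sum_smul {ι : Type*} [Fintype ι] (c : ι → ℂ) {h : ι → adOrbit ξ → ℂ}
    (hh : ∀ i, Continuous fun g => h i (orbitPt ξ g)) :
    orbitIntegral ξ (∑ i, c i • h i) = ∑ i, c i * orbitIntegral ξ (h i) := by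
  simp only [orbitIntegral, ← integral_const_mul]
  rw [← integral_finsetSum (f := fun i g => c i * h i (orbitPt ξ g)) _ fun i _ => integrable_haar_of_continuous (continuous_const.mul (hh i))]
  refine integral_congr_ae (Eventually.of_forall fun g => ?_)
  simp only [Finset.sum_apply, Pi.smul_apply, smul_eq_mul]

end FunctionSpaces

/-! ### Symbols of quantized polynomials and characteristic matrices -/

section Operators

variable {H : Type*} [NormedAddCommGroup H] [InnerProductSpace ℂ H] [CompleteSpace H]
  [FiniteDimensional ℂ H]

theorem opInner_conj_symm (A B : H →L[ℂ] H) : conj (opInner A B) = opInner B A := by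
  have h : ∀ C : H →L[ℂ] H, conj (opTrace C) = opTrace (star C) := by
    intro C
    rw [opTrace, opTrace, LinearMap.trace_eq_sum_inner _ (stdOrthonormalBasis ℂ H),
      LinearMap.trace_eq_sum_inner _ (stdOrthonormalBasis ℂ H), map_sum]
    refine Finset.sum_congr rfl fun i _ => ?_
    rw [inner_conj_symm, ContinuousLinearMap.coe_coe, ContinuousLinearMap.coe_coe,
      ContinuousLinearMap.star_eq_adjoint, ContinuousLinearMap.adjoint_inner_right]
  rw [opInner, opInner, h, star_mul, star_star]

theorem opInner_sum_smul {ι : Type*} [Fintype ι] (A : H →L[ℂ] H) (c : ι → ℂ) (B : ι → H →L[ℂ] H) :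
    opInner A (∑ i, c i • B i) = ∑ i, c i * opInner A (B i) := by
  simp only [opInner, opTrace, Finset.mul_sum, mul_smul_comm, ContinuousLinearMap.toLinearMap_sum,
    map_sum, ContinuousLinearMap.toLinearMap_smul, map_smul, smul_eq_mul]

end Operators

theorem IsHighestBasis.eq_sum {V : Type*} [AddCommGroup V] [Module ℂ V] [TopologicalSpace V]
    {ρ : Representation ℂ SU3 V} {S : Submodule ℂ V} {ip : V → V → ℂ} {a : ℕ × ℕ} {n : ℕ}
    {x : Fin n → V} (hx : IsHighestBasis ρ S ip a x)
    (hip : ∀ (c : Fin n → ℂ) i, ip (x i) (∑ j, c j • x j) = ∑ j, c j * ip (x i) (x j))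
    {v : V} (hv : v ∈ S) (hv' : IsHighest ρ a v) : v = ∑ i, ip (x i) v • x i := by
  obtain ⟨c, rfl⟩ := (Submodule.mem_span_range_iff_exists_fun ℂ).1 (hx.spans v hv hv')
  refine Finset.sum_congr rfl fun i _ => ?_
  rw [hip, Finset.sum_eq_single i]
  · rw [hx.orthonormal, if_pos rfl, mul_one]
  · intro j _ hj
    rw [hx.orthonormal, if_neg (Ne.symm hj), mul_zero]
  · simp

theorem IsHighestBasis.eq_sum_orbit {ξ : Mat3} {a : ℕ × ℕ} {n : ℕ} {x : Fin n → adOrbit ξ → ℂ}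
    (hx : IsHighestBasis (funRep ξ) (polyOrbit ξ) (orbitInner ξ) a x) {f : adOrbit ξ → ℂ}
    (hf : f ∈ polyOrbit ξ) (hf' : IsHighest (funRep ξ) a f) :
    f = ∑ i, orbitInner ξ (x i) f • x i :=
  hx.eq_sum (fun c i => orbitInner_sum_smul (continuous_orbitPt_of_mem (hx.mem i)) c
    fun j => continuous_orbitPt_of_mem (hx.mem j)) hf hf'

section Ray

variable {ξ : Mat3} {p₁ q₁ : ℕ} {H : ℕ+ → Type*} [∀ s, NormedAddCommGroup (H s)]
  [∀ s, InnerProductSpace ℂ (H s)] [∀ s, CompleteSpace (H s)] [∀ s, FiniteDimensional ℂ (H s)]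
  {π : ∀ s, SU3 →* unitary (H s →L[ℂ] H s)}
  {W : ∀ s, (H s →L[ℂ] H s) →ₗ[ℂ] (adOrbit ξ → ℂ)}
  {m : ℕ × ℕ → ℕ} {X : ∀ a, Fin (m a) → adOrbit ξ → ℂ}
  {n : ℕ+ → ℕ × ℕ → ℕ} {e : ∀ s a, Fin (n s a) → (H s →L[ℂ] H s)}

/-- The symbol of the quantization of a noncommutative polynomial. -/
def raySymb (π : ∀ s, SU3 →* unitary (H s →L[ℂ] H s))
    (W : ∀ s, (H s →L[ℂ] H s) →ₗ[ℂ] (adOrbit ξ → ℂ)) (s : ℕ+) : NCPoly →ₗ[ℂ] (adOrbit ξ → ℂ) :=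
  W s ∘ₗ (rayQuant ξ π s).toLinearMap

theorem raySymb_apply (s : ℕ+) (u : NCPoly) : raySymb π W s u = W s (rayQuant ξ π s u) := rfl

/-- The symbols of the quantization converge pointwise to the classical symbol. -/
def HasSymbolLimit (π : ∀ s, SU3 →* unitary (H s →L[ℂ] H s))
    (W : ∀ s, (H s →L[ℂ] H s) →ₗ[ℂ] (adOrbit ξ → ℂ)) (u : NCPoly) : Prop :=
  ∀ x, Tendsto (fun s => raySymb π W s u x) atTop (𝓝 (symb ξ u x))

/-- The coefficients of the quantization of `u` with respect to `√(dim H) e_σ`. -/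
def rayCoef (ξ : Mat3) (π : ∀ s, SU3 →* unitary (H s →L[ℂ] H s))
    (e : ∀ s a, Fin (n s a) → (H s →L[ℂ] H s)) (s : ℕ+) (a : ℕ × ℕ) (u : NCPoly)
    (σ : Fin (n s a)) : ℂ :=
  opInner (e s a σ) (rayQuant ξ π s u) / (Real.sqrt (Module.finrank ℂ (H s)) : ℂ)

variable (hξ : ξ ∈ rationalArc) (hω : domWeight p₁ q₁ = (integralRadius ξ : ℂ) • ξ)
  (hπ : ∀ s : ℕ+, IsQuarkSystem (π s) (s * p₁) (s * q₁))
  (hW : ∀ s, IsSymbolCorrespondence ξ (π s) (W s))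
  (hX : ∀ a, IsHighestBasis (funRep ξ) (polyOrbit ξ) (orbitInner ξ) a (X a))
  (he : ∀ s a, IsHighestBasis (opRep (π s)) ⊤ opInner a (e s a))

include hω hπ in
theorem continuous_berezin (s : ℕ+) (A : H s →L[ℂ] H s) :
    Continuous fun g => berezin ξ (π s) (s * p₁) (s * q₁) A (orbitPt ξ g) := by
  obtain ⟨v, hv⟩ := (hπ s).exists_highestUnit
  simp only [berezin_orbitPt (hπ s) hv (domWeight_ray hω s)]
  exact continuous_coherent (hπ s).continuous 1 A v

section

include hπ

theorem rayQuant_ad (s : ℕ+) (g : SU3) (u : NCPoly) :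
    rayQuant ξ π s (ncAd g u) = opRep (π s) g (rayQuant ξ π s u) := quant_ad (hπ s).continuous _ g u

theorem isHighest_rayQuant (s : ℕ+) {a : ℕ × ℕ} {u : NCPoly} (hu : NCHighest a u) :
    IsHighest (opRep (π s)) a (rayQuant ξ π s u) :=
  hu.map (L := (rayQuant ξ π s).toLinearMap) (rayQuant_ad hπ s)

theorem finrank_pos_of_ray (s : ℕ+) : 0 < Module.finrank ℂ (H s) := by
  obtain ⟨v, hv⟩ := (hπ s).exists_highestUnit
  exact Module.finrank_pos_iff_exists_ne_zero.2 ⟨v, hv.ne_zero⟩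

include he

theorem rayQuant_eq_sum (s : ℕ+) {a : ℕ × ℕ} {u : NCPoly} (hu : NCHighest a u) :
    rayQuant ξ π s u = ∑ σ, rayCoef ξ π e s a u σ •
      ((Real.sqrt (Module.finrank ℂ (H s)) : ℂ) • e s a σ) := by
  have h := (he s a).eq_sum (fun c i => opInner_sum_smul _ c _) (Submodule.mem_top)
    (isHighest_rayQuant (ξ := ξ) hπ s hu)
  have h0 : (Real.sqrt (Module.finrank ℂ (H s)) : ℂ) ≠ 0 := Complex.ofReal_ne_zero.2
    (Real.sqrt_pos.2 (Nat.cast_pos.2 (finrank_pos_of_ray hπ s))).ne'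
  conv_lhs => rw [h]
  refine Finset.sum_congr rfl fun σ _ => ?_
  rw [smul_smul, rayCoef, div_mul_cancel₀ _ h0]

theorem sum_conj_rayCoef_mul (s : ℕ+) {a : ℕ × ℕ} (u : NCPoly) {w : NCPoly} (hw : NCHighest a w) :
    ∑ σ, conj (rayCoef ξ π e s a u σ) * rayCoef ξ π e s a w σ =
      opInner (rayQuant ξ π s u) (rayQuant ξ π s w) / (Module.finrank ℂ (H s) : ℂ) := by
  have hd : (0 : ℝ) ≤ (Module.finrank ℂ (H s) : ℝ) := Nat.cast_nonneg _
  have h1 : (Real.sqrt (Module.finrank ℂ (H s)) : ℂ) * (Real.sqrt (Module.finrank ℂ (H s)) : ℂ) =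
      (Module.finrank ℂ (H s) : ℂ) := by
    rw [← Complex.ofReal_mul, Real.mul_self_sqrt hd, Complex.ofReal_natCast]
  have h0 : (Real.sqrt (Module.finrank ℂ (H s)) : ℂ) ≠ 0 := Complex.ofReal_ne_zero.2
    (Real.sqrt_pos.2 (Nat.cast_pos.2 (finrank_pos_of_ray hπ s))).ne'
  conv_rhs => rw [rayQuant_eq_sum hπ he s hw]
  simp only [smul_smul]
  rw [opInner_sum_smul, Finset.sum_div]
  refine Finset.sum_congr rfl fun σ _ => ?_
  rw [← opInner_conj_symm (e s a σ), ← h1, rayCoef, map_div₀, Complex.conj_ofReal]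
  field_simp

/-- The characteristic matrix determines the symbols of the quantization. -/
theorem sum_charMatrix_mul_rayCoef
    (hX : ∀ a, IsHighestBasis (funRep ξ) (polyOrbit ξ) (orbitInner ξ) a (X a)) (s : ℕ+)
    {a : ℕ × ℕ} {u : NCPoly} (hu : NCHighest a u)
    (V : (H s →L[ℂ] H s) →ₗ[ℂ] (adOrbit ξ → ℂ))
    (hV : ∀ A, Continuous fun g => V A (orbitPt ξ g)) (γ : Fin (m a)) :
    ∑ σ, charMatrix V (X a) (e s a) γ σ * rayCoef ξ π e s a u σ =
      orbitInner ξ (X a γ) (V (rayQuant ξ π s u)) := by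
  rw [rayQuant_eq_sum hπ he s hu, map_sum]
  simp only [map_smul V (rayCoef ξ π e s a u _)]
  rw [orbitInner_sum_smul (continuous_orbitPt_of_mem ((hX a).mem γ)) _ fun σ => hV _]
  exact Finset.sum_congr rfl fun σ _ => mul_comm _ _

end

section

include hπ hW

theorem raySymb_mem (s : ℕ+) (u : NCPoly) : raySymb π W s u ∈ polyOrbit ξ := (hW s).mem_poly _

theorem raySymb_ad (s : ℕ+) (g : SU3) (u : NCPoly) :
    raySymb π W s (ncAd g u) = funRep ξ g (raySymb π W s u) := by
  rw [raySymb_apply, rayQuant_ad hπ, (hW s).equivariant, raySymb_apply]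

theorem exists_finiteDimensional_raySymb (u : NCPoly) :
    ∃ L : Submodule ℂ (adOrbit ξ → ℂ), FiniteDimensional ℂ L ∧ L ≤ polyOrbit ξ ∧ symb ξ u ∈ L ∧
      ∀ s, raySymb π W s u ∈ L := by
  obtain ⟨L, h1, h2, h3⟩ := exists_finiteDimensional_range (ξ := ξ) u
  exact ⟨L, h1, h2, h3 (symb ξ).toLinearMap (symb_mem ξ) symb_ad,
    fun s => h3 _ (raySymb_mem hπ hW s) (raySymb_ad hπ hW s)⟩

theorem isHighest_raySymb (s : ℕ+) {a : ℕ × ℕ} {u : NCPoly} (hu : NCHighest a u) :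
    IsHighest (funRep ξ) a (raySymb π W s u) :=
  hu.map (raySymb_ad hπ hW s)

theorem HasSymbolLimit.ncAd {u : NCPoly} (h : HasSymbolLimit π W u) (g : SU3) :
    HasSymbolLimit π W (ncAd g u) := by
  intro x
  simp only [raySymb_ad hπ hW, symb_ad, funRep_apply]
  exact h _

/-- It suffices to know the limits of the symbols of highest weight vectors. -/
theorem hasSymbolLimit_of_highest (h : ∀ a u, NCHighest a u → HasSymbolLimit π W u) (u : NCPoly) :
    HasSymbolLimit π W u := by
  have hu : u ∈ Submodule.span ℂ {x | ∃ g a w, NCHighest a w ∧ x = Quark.ncAd g w} :=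
    span_ncAd_highest ▸ Submodule.mem_top
  induction hu using Submodule.span_induction with
  | mem x hx =>
    obtain ⟨g, a, w, hw, rfl⟩ := hx
    exact (h a w hw).ncAd hπ hW g
  | zero => intro x; simp
  | add u w _ _ hu hw =>
    intro x
    simp only [map_add, Pi.add_apply]
    exact (hu x).add (hw x)
  | smul c u _ hu =>
    intro x
    simp only [map_smul, Pi.smul_apply, smul_eq_mul]
    exact (hu x).const_mul c

/-- All the symbols lie in one finite dimensional space, on which the inner product with f is
continuous for pointwise convergence. -/
theorem HasSymbolLimit.tendsto_orbitInner {u : NCPoly} (h : HasSymbolLimit π W u) {f : adOrbit ξ → ℂ}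
    (hf : f ∈ polyOrbit ξ) :
    Tendsto (fun s => orbitInner ξ f (raySymb π W s u)) atTop (𝓝 (orbitInner ξ f (symb ξ u))) := by
  obtain ⟨L, h1, h2, h3, h4⟩ := exists_finiteDimensional_raySymb hπ hW u
  have key : ∀ (c : Fin 2 → ℂ) (k : Fin 2 → L), orbitInner ξ f ((∑ i, c i • k i : L) : adOrbit ξ → ℂ) =
      ∑ i, c i * orbitInner ξ f (k i) := by
    intro c k
    rw [← orbitInner_sum_smul (continuous_orbitPt_of_mem hf) c
      fun i => continuous_orbitPt_of_mem (h2 (k i).2)]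
    simp
  let φ : L →ₗ[ℂ] ℂ :=
    { toFun := fun k => orbitInner ξ f k
      map_add' := fun k k' => by simpa using key ![1, 1] ![k, k']
      map_smul' := fun c k => by simpa using key ![c, 0] ![k, 0] }
  exact tendsto_linear_of_pointwise h4 h3 h φ

end

include hX hπ hW he in
-- The correspondence is injective and preserves highest weight vectors of weight a.
theorem card_highest_le (s : ℕ+) (a : ℕ × ℕ) : n s a ≤ m a := by
  have hli : LinearIndependent ℂ (e s a) := by
    rw [Fintype.linearIndependent_iff]
    intro c hc i
    have h := opInner_sum_smul (e s a i) c (e s a)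
    rw [hc, Finset.sum_eq_single i] at h
    · rw [(he s a).orthonormal, if_pos rfl, mul_one] at h
      rw [← h]
      simp [opInner, opTrace]
    · intro j _ hj
      rw [(he s a).orthonormal, if_neg (Ne.symm hj), mul_zero]
    · simp
  have hli' := hli.map' (W s) (LinearMap.ker_eq_bot.2 (hW s).injective)
  have hmem : ∀ σ, W s (e s a σ) ∈ Submodule.span ℂ (Set.range (X a)) := fun σ =>
    (hX a).spans _ ((hW s).mem_poly _) (((he s a).highest σ).map (L := W s) (hW s).equivariant
      (LinearMap.continuous_of_finiteDimensional _))
  have hle : Submodule.span ℂ (Set.range (W s ∘ e s a)) ≤ Submodule.span ℂ (Set.range (X a)) := by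
    rw [Submodule.span_le]
    rintro _ ⟨σ, rfl⟩
    exact hmem σ
  have h1 := finrank_span_eq_card hli'
  have h2 : Module.finrank ℂ (Submodule.span ℂ (Set.range (X a))) ≤ m a := by
    simpa [Set.finrank] using finrank_range_le_card (R := ℂ) (X a)
  have : FiniteDimensional ℂ (Submodule.span ℂ (Set.range (X a))) :=
    FiniteDimensional.span_of_finite ℂ (Set.finite_range _)
  have h3 := Submodule.finrank_mono hle
  rw [h1, Fintype.card_fin] at h3
  exact h3.trans h2

include hξ hX in
/-- Highest weight polynomials with the symbols `X a γ`. -/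
theorem exists_lift_basis (a : ℕ × ℕ) :
    ∃ w : Fin (m a) → NCPoly, ∀ γ, NCHighest a (w γ) ∧ symb ξ (w γ) = X a γ := by
  choose w hw using fun γ => exists_ncHighest_symb (trace_of_mem_rationalArc hξ) ((hX a).mem γ)
    ((hX a).highest γ)
  exact ⟨w, hw⟩

/-- The matrix of the coefficients of the quantizations of a family of polynomials. -/
def rayCoefMatrix (ξ : Mat3) (π : ∀ s, SU3 →* unitary (H s →L[ℂ] H s))
    (e : ∀ s a, Fin (n s a) → (H s →L[ℂ] H s)) (s : ℕ+) (a : ℕ × ℕ) {k : ℕ} (w : Fin k → NCPoly) :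
    Matrix (Fin (n s a)) (Fin k) ℂ :=
  Matrix.of fun σ γ => rayCoef ξ π e s a (w γ) σ

include hξ hω hπ hX he

/-- The Gram entries are normalised traces of products of quantizations, and they tend to the inner
products of the orthonormal functions X. -/
theorem tendsto_gram {a : ℕ × ℕ} {w : Fin (m a) → NCPoly}
    (hw : ∀ γ, NCHighest a (w γ) ∧ symb ξ (w γ) = X a γ) :
    Tendsto (fun s => (rayCoefMatrix ξ π e s a w)ᴴ * rayCoefMatrix ξ π e s a w) atTop (𝓝 1) := by
  refine tendsto_matrix fun γ δ => ?_
  have h := tendsto_opInner_rayQuant hξ hω hπ (w γ) (w δ)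
  rw [(hw γ).2, (hw δ).2, (hX a).orthonormal] at h
  rw [Matrix.one_apply]
  refine h.congr fun s => ?_
  rw [← sum_conj_rayCoef_mul hπ he s (w γ) (hw δ).1]
  rfl

include hW

/-- For a highest weight polynomial u the inner products of X_γ with the W-symbol and with the
Berezin symbol of its quantization differ by (C - B) applied to the coefficients of u. These stay
bounded, so both have the same limit. Since the W-symbol is again a highest weight function of
weight a, its inner products with the X_γ determine it. -/
theorem hasSymbolLimit_of_charMatrix
    (h : ∀ a : ℕ × ℕ, Tendsto (fun s : ℕ+ => ∑ γ, ∑ σ, ‖(charMatrix (W s) (X a) (e s a) -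
      charMatrix (berezin ξ (π s) (s * p₁) (s * q₁)) (X a) (e s a)) γ σ‖) atTop (𝓝 0)) (u : NCPoly) :
    HasSymbolLimit π W u := by
  refine hasSymbolLimit_of_highest hπ hW (fun a u hu => ?_) u
  have hn := tendsto_opInner_rayQuant hξ hω hπ u u
  -- The squares of the coefficients sum to the normalised Hilbert–Schmidt norm, which converges.
  obtain ⟨M, hM0, hM⟩ : ∃ M, 0 ≤ M ∧ ∀ᶠ s in atTop, ∀ σ, ‖rayCoef ξ π e s a u σ‖ ≤ M := by
    refine ⟨Real.sqrt (‖orbitInner ξ (symb ξ u) (symb ξ u)‖ + 1), Real.sqrt_nonneg _, ?_⟩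
    filter_upwards [hn.norm.eventually (gt_mem_nhds (lt_add_one _))] with s hs σ
    refine Real.le_sqrt_of_sq_le (le_trans ?_ hs.le)
    have h1 := norm_entry_sq_le (rayCoefMatrix ξ π e s a ![u]) σ 0
    rw [← sum_conj_rayCoef_mul hπ he s u hu]
    exact h1
  have hγ : ∀ γ, Tendsto (fun s => orbitInner ξ (X a γ) (raySymb π W s u)) atTop
      (𝓝 (orbitInner ξ (X a γ) (symb ξ u))) := by
    intro γ
    have h1 := tendsto_orbitInner_berezin hξ hω hπ ((hX a).mem γ) u
    have h2 : Tendsto (fun s : ℕ+ => orbitInner ξ (X a γ) (raySymb π W s u) -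
        orbitInner ξ (X a γ) (berezin ξ (π s) (s * p₁) (s * q₁) (rayQuant ξ π s u))) atTop (𝓝 0) := by
      have h3 := (h a).mul_const M
      rw [zero_mul] at h3
      refine squeeze_zero_norm' (hM.mono fun s hs => ?_) h3
      rw [raySymb_apply,
        ← sum_charMatrix_mul_rayCoef hπ he hX s hu (W s)
          (fun A => continuous_orbitPt_of_mem ((hW s).mem_poly A)) γ,
        ← sum_charMatrix_mul_rayCoef hπ he hX s hu _ (continuous_berezin hω hπ s) γ, ← Finset.sum_sub_distrib]
      simp only [← sub_mul]
      have h4 : ∑ σ, ‖(charMatrix (W s) (X a) (e s a) -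
          charMatrix (berezin ξ (π s) (s * p₁) (s * q₁)) (X a) (e s a)) γ σ‖ ≤
          ∑ γ, ∑ σ, ‖(charMatrix (W s) (X a) (e s a) -
          charMatrix (berezin ξ (π s) (s * p₁) (s * q₁)) (X a) (e s a)) γ σ‖ :=
        Finset.single_le_sum (f := fun γ => ∑ σ, ‖(charMatrix (W s) (X a) (e s a) -
          charMatrix (berezin ξ (π s) (s * p₁) (s * q₁)) (X a) (e s a)) γ σ‖)
          (fun _ _ => by positivity) (Finset.mem_univ γ)
      refine (norm_sum_le _ _).trans ?_
      refine le_trans ?_ (mul_le_mul_of_nonneg_right h4 hM0)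
      rw [Finset.sum_mul]
      refine Finset.sum_le_sum fun σ _ => ?_
      rw [norm_mul]
      exact mul_le_mul_of_nonneg_left (hs σ) (norm_nonneg _)
    simpa using h2.add h1
  intro x
  have e1 : ∀ s, raySymb π W s u x = ∑ γ, orbitInner ξ (X a γ) (raySymb π W s u) * X a γ x := by
    intro s
    have := congrFun ((hX a).eq_sum_orbit (raySymb_mem hπ hW s u) (isHighest_raySymb hπ hW s hu)) x
    rw [this, Finset.sum_apply]
    rfl
  have e2 : symb ξ u x = ∑ γ, orbitInner ξ (X a γ) (symb ξ u) * X a γ x := by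
    have := congrFun ((hX a).eq_sum_orbit (symb_mem ξ u)
      (hu.map (L := (symb ξ).toLinearMap) symb_ad)) x
    rw [this, Finset.sum_apply]
    rfl
  simp only [e1]
  rw [e2]
  exact tendsto_finsetSum _ fun γ _ => (hγ γ).mul_const _

/-- For lifts of the X_δ with coefficient matrix D, the entries of (C - B)D are differences of inner
products of X_γ with two symbols having the same limit. Since D†D → 1, the factor D can be removed.
-/
theorem charMatrix_of_hasSymbolLimit (h : ∀ u, HasSymbolLimit π W u) (a : ℕ × ℕ) :
    Tendsto (fun s : ℕ+ => ∑ γ, ∑ σ, ‖(charMatrix (W s) (X a) (e s a) -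
      charMatrix (berezin ξ (π s) (s * p₁) (s * q₁)) (X a) (e s a)) γ σ‖) atTop (𝓝 0) := by
  obtain ⟨w, hw⟩ := exists_lift_basis hξ hX a
  refine tendsto_zero_of_mul_tendsto_zero (fun s => card_highest_le hπ hW hX he s a)
    (tendsto_gram hξ hω hπ hX he hw) fun γ δ => ?_
  have h1 := tendsto_orbitInner_berezin hξ hω hπ ((hX a).mem γ) (w δ)
  have h2 := (h (w δ)).tendsto_orbitInner hπ hW ((hX a).mem γ)
  have h3 := h2.sub h1
  rw [sub_self] at h3
  refine h3.congr fun s => ?_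
  rw [raySymb_apply,
    ← sum_charMatrix_mul_rayCoef hπ he hX s (hw δ).1 (W s)
      (fun A => continuous_orbitPt_of_mem ((hW s).mem_poly A)) γ,
    ← sum_charMatrix_mul_rayCoef hπ he hX s (hw δ).1 _ (continuous_berezin hω hπ s) γ, ← Finset.sum_sub_distrib]
  simp only [← sub_mul]
  rfl

/-- Every polynomial function is in the image of almost all the symbol correspondences. -/
theorem eventually_mem_range {f : adOrbit ξ → ℂ} (hf : f ∈ polyOrbit ξ) :
    ∀ᶠ s in atTop, f ∈ LinearMap.range (W s) := by
  have hbasis : ∀ a γ, ∀ᶠ s in atTop, X a γ ∈ LinearMap.range (W s) := by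
    intro a γ
    obtain ⟨w, hw⟩ := exists_lift_basis hξ hX a
    obtain ⟨hu, -⟩ := eventually_isUnit_and_tendsto_inv (tendsto_gram hξ hω hπ hX he hw)
    refine hu.mono fun s hs => ?_
    -- Once the Gram matrix is invertible, the lifts have m(a) independent quantizations. Their
    -- images under the injective W remain independent in the span of the m(a) functions X, so they
    -- span it.
    have hli : LinearIndependent ℂ fun γ => rayQuant ξ π s (w γ) := by
      rw [Fintype.linearIndependent_iff]
      intro c hc
      have h1 : ((rayCoefMatrix ξ π e s a w)ᴴ * rayCoefMatrix ξ π e s a w) *ᵥ c = 0 := by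
        funext δ
        have h2 := opInner_sum_smul (rayQuant ξ π s (w δ)) c fun γ => rayQuant ξ π s (w γ)
        rw [hc] at h2
        have h3 : ∀ γ, ((rayCoefMatrix ξ π e s a w)ᴴ * rayCoefMatrix ξ π e s a w) δ γ =
            opInner (rayQuant ξ π s (w δ)) (rayQuant ξ π s (w γ)) /
              (Module.finrank ℂ (H s) : ℂ) := fun γ => by
          rw [← sum_conj_rayCoef_mul hπ he s (w δ) (hw γ).1]
          rfl
        rw [Matrix.mulVec, dotProduct]
        simp only [h3, div_mul_eq_mul_div]
        rw [← Finset.sum_div]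
        simp only [mul_comm _ (c _)]
        rw [← h2]
        simp [opInner, opTrace]
      have h4 := Matrix.mulVec_injective_of_isUnit ((Matrix.isUnit_iff_isUnit_det _).2 hs)
        (h1.trans (Matrix.mulVec_zero _).symm)
      exact fun i => congrFun h4 i
    have hli' := hli.map' (W s) (LinearMap.ker_eq_bot.2 (hW s).injective)
    have hle : Submodule.span ℂ (Set.range (W s ∘ fun γ => rayQuant ξ π s (w γ))) ≤
        Submodule.span ℂ (Set.range (X a)) := by
      rw [Submodule.span_le]
      rintro _ ⟨γ, rfl⟩
      exact (hX a).spans _ ((hW s).mem_poly _) (isHighest_raySymb hπ hW s (hw γ).1)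
    have : FiniteDimensional ℂ (Submodule.span ℂ (Set.range (X a))) :=
      FiniteDimensional.span_of_finite ℂ (Set.finite_range _)
    have heq := Submodule.eq_of_le_of_finrank_le hle (by
      rw [finrank_span_eq_card hli', Fintype.card_fin]
      simpa [Set.finrank] using finrank_range_le_card (R := ℂ) (X a))
    have hmem : X a γ ∈ Submodule.span ℂ (Set.range (X a)) := Submodule.subset_span ⟨γ, rfl⟩
    rw [← heq] at hmem
    refine (Submodule.span_le.2 ?_) hmem
    rintro _ ⟨γ, rfl⟩
    exact ⟨_, rfl⟩
  obtain ⟨F, rfl⟩ := hf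
  obtain ⟨u, hu⟩ := exists_symb_eq (trace_of_mem_rationalArc hξ) F
  rw [← hu]
  clear hu F
  have hu : u ∈ Submodule.span ℂ {x | ∃ g a w, NCHighest a w ∧ x = Quark.ncAd g w} :=
    span_ncAd_highest ▸ Submodule.mem_top
  induction hu using Submodule.span_induction with
  | mem x hx =>
    obtain ⟨g, a, w, hw, rfl⟩ := hx
    filter_upwards [eventually_all.2 (hbasis a)] with s hs
    have h1 := (hX a).eq_sum_orbit (symb_mem ξ w) (hw.map (L := (symb ξ).toLinearMap) symb_ad)
    have h2 : symb ξ w ∈ LinearMap.range (W s) := by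
      rw [h1]
      exact Submodule.sum_mem _ fun γ _ => Submodule.smul_mem _ _ (hs γ)
    obtain ⟨A, hA⟩ := h2
    exact ⟨opRep (π s) g A, by rw [(hW s).equivariant, hA, symb_ad]⟩
  | zero => exact Eventually.of_forall fun s => by rw [map_zero]; exact Submodule.zero_mem _
  | add u w _ _ hu hw =>
    filter_upwards [hu, hw] with s h1 h2
    rw [map_add]
    exact Submodule.add_mem _ h1 h2
  | smul c u _ hu =>
    filter_upwards [hu] with s h1
    rw [map_smul]
    exact Submodule.smul_mem _ _ h1

end Ray

/-! ### From the limits of the symbols to the Poisson type -/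

/-- The Poisson bracket with a fixed polynomial as a linear map. -/
def poissonLin (F : PolySU3) : PolySU3 →ₗ[ℂ] PolySU3 where
  toFun := poissonBracket F
  map_add' := poissonBracket_add_right F
  map_smul' c G := by
    rw [MvPolynomial.smul_eq_C_mul, poissonBracket_mul_right, poissonBracket_C_right, zero_mul,
      add_zero, ← MvPolynomial.smul_eq_C_mul]
    rfl

theorem poissonBracket_sum_right {ι : Type*} [Fintype ι] (F : PolySU3) (c : ι → ℂ) (G : ι → PolySU3) :
    poissonBracket F (∑ i, c i • G i) = ∑ i, c i • poissonBracket F (G i) := by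
  change poissonLin F _ = _
  rw [map_sum]
  exact Finset.sum_congr rfl fun i _ => map_smul (poissonLin F) _ _

theorem poissonBracket_sum_left {ι : Type*} [Fintype ι] (F : PolySU3) (c : ι → ℂ) (G : ι → PolySU3) :
    poissonBracket (∑ i, c i • G i) F = ∑ i, c i • poissonBracket (G i) F := by
  rw [poissonBracket_antisymm, poissonBracket_sum_right, ← Finset.sum_neg_distrib]
  refine Finset.sum_congr rfl fun i _ => ?_
  rw [poissonBracket_antisymm F, smul_neg, neg_neg]

/-- Convergence of noncommutative polynomials in a finite dimensional space. -/
def NCTendsto (w : ℕ+ → NCPoly) (w₀ : NCPoly) : Prop :=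
  ∃ (ι : Type) (_ : Fintype ι) (b : ι → NCPoly) (κ : ℕ+ → ι → ℂ) (κ₀ : ι → ℂ),
    (∀ i, Tendsto (fun s => κ s i) atTop (𝓝 (κ₀ i))) ∧ (∀ s, w s = ∑ i, κ s i • b i) ∧
      w₀ = ∑ i, κ₀ i • b i

theorem NCTendsto.add {w w' : ℕ+ → NCPoly} {w₀ w₀' : NCPoly} (h : NCTendsto w w₀)
    (h' : NCTendsto w' w₀') : NCTendsto (fun s => w s + w' s) (w₀ + w₀') := by
  obtain ⟨ι, _, b, κ, κ₀, h1, h2, h3⟩ := h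
  obtain ⟨ι', _, b', κ', κ₀', h1', h2', h3'⟩ := h'
  refine ⟨ι ⊕ ι', inferInstance, Sum.elim b b', fun s => Sum.elim (κ s) (κ' s), Sum.elim κ₀ κ₀',
    ?_, fun s => ?_, ?_⟩
  · rintro (i | i)
    · exact h1 i
    · exact h1' i
  · change w s + w' s = _
    rw [Fintype.sum_sum_type, h2, h2']; rfl
  · rw [Fintype.sum_sum_type, h3, h3']; rfl

theorem NCTendsto.map {w : ℕ+ → NCPoly} {w₀ : NCPoly} (h : NCTendsto w w₀)
    (f : NCPoly →ₗ[ℂ] NCPoly) : NCTendsto (fun s => f (w s)) (f w₀) := by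
  obtain ⟨ι, _, b, κ, κ₀, h1, h2, h3⟩ := h
  exact ⟨ι, inferInstance, fun i => f (b i), κ, κ₀, h1, fun s => by simp [h2], by simp [h3]⟩

theorem NCTendsto.smul {w : ℕ+ → NCPoly} {w₀ : NCPoly} (h : NCTendsto w w₀) (c : ℂ) :
    NCTendsto (fun s => c • w s) (c • w₀) := h.map (c • LinearMap.id)

theorem NCTendsto.mul {w w' : ℕ+ → NCPoly} {w₀ w₀' : NCPoly} (h : NCTendsto w w₀)
    (h' : NCTendsto w' w₀') : NCTendsto (fun s => w s * w' s) (w₀ * w₀') := by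
  obtain ⟨ι, _, b, κ, κ₀, h1, h2, h3⟩ := h
  obtain ⟨ι', _, b', κ', κ₀', h1', h2', h3'⟩ := h'
  refine ⟨ι × ι', inferInstance, fun p => b p.1 * b' p.2, fun s p => κ s p.1 * κ' s p.2,
    fun p => κ₀ p.1 * κ₀' p.2, fun p => (h1 p.1).mul (h1' p.2), fun s => ?_, ?_⟩
  · simp only [h2, h2', Finset.sum_mul_sum, Fintype.sum_prod_type, smul_mul_smul_comm]
  · simp only [h3, h3', Finset.sum_mul_sum, Fintype.sum_prod_type, smul_mul_smul_comm]

/-- Bilinear expansion reduces to the finitely many commutators of the fixed spanning polynomials,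
whose z do not depend on s; only the coefficients vary, and they converge. -/
theorem NCTendsto.commutator.{v} (ξ : Mat3) {w w' : ℕ+ → NCPoly} {w₀ w₀' : NCPoly}
    (h : NCTendsto w w₀) (h' : NCTendsto w' w₀') : ∃ z z₀, NCTendsto z z₀ ∧
      symb ξ z₀ = -restrict ξ (poissonBracket (ncAbel w₀) (ncAbel w₀')) ∧
      ∀ s {B : Type v} [Ring B] [Algebra ℂ B] (t : Mat3 →ₗ[ℂ] B) (c : ℂ),
        (∀ Z Z', t Z * t Z' - t Z' * t Z = c • t (Z * Z' - Z' * Z)) →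
        ncLift t (w s) * ncLift t (w' s) - ncLift t (w' s) * ncLift t (w s) =
          c • ncLift t (z s) := by
  obtain ⟨ι, _, b, κ, κ₀, h1, h2, h3⟩ := h
  obtain ⟨ι', _, b', κ', κ₀', h1', h2', h3'⟩ := h'
  choose z hz hz' using fun i j => exists_commutator.{v} ξ (b i) (b' j)
  refine ⟨fun s => ∑ p : ι × ι', (κ s p.1 * κ' s p.2) • z p.1 p.2,
    ∑ p : ι × ι', (κ₀ p.1 * κ₀' p.2) • z p.1 p.2,
    ⟨ι × ι', inferInstance, fun p => z p.1 p.2, fun s p => κ s p.1 * κ' s p.2,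
    fun p => κ₀ p.1 * κ₀' p.2, fun p => (h1 p.1).mul (h1' p.2), fun s => rfl, rfl⟩, ?_,
    fun _ _ _ _ t c ht => ?_⟩
  · rw [h3, h3', map_sum, map_sum, map_sum]
    simp only [map_smul]
    rw [poissonBracket_sum_left]
    simp only [poissonBracket_sum_right, map_sum, map_smul, hz, Fintype.sum_prod_type,
      Finset.smul_sum, smul_smul, ← Finset.sum_neg_distrib, smul_neg]
  · simp only [h2, h2', map_sum, map_smul, Fintype.sum_prod_type, Finset.smul_sum]
    rw [Finset.sum_mul_sum, Finset.sum_mul_sum, Finset.sum_comm (s := (Finset.univ : Finset ι')),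
      ← Finset.sum_sub_distrib]
    refine Finset.sum_congr rfl fun i _ => ?_
    rw [← Finset.sum_sub_distrib]
    refine Finset.sum_congr rfl fun j _ => ?_
    rw [smul_mul_smul_comm, smul_mul_smul_comm, mul_comm (κ' _ j), ← smul_sub, hz' i j t c ht,
      smul_comm]

theorem TendstoUniformly.congr_eventually {α β : Type*} {S : Type*} {l : Filter S} [UniformSpace β]
    {F F' : S → α → β} {f : α → β} (h : TendstoUniformly F f l) (hF : ∀ᶠ s in l, F s = F' s) :
    TendstoUniformly F' f l := fun u hu =>
  (hF.and (h u hu)).mono fun s hs x => hs.1 ▸ hs.2 x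

section Ray

variable {ξ : Mat3} {p₁ q₁ : ℕ} {H : ℕ+ → Type*} [∀ s, NormedAddCommGroup (H s)]
  [∀ s, InnerProductSpace ℂ (H s)] [∀ s, CompleteSpace (H s)] [∀ s, FiniteDimensional ℂ (H s)]
  {π : ∀ s, SU3 →* unitary (H s →L[ℂ] H s)}
  {W : ∀ s, (H s →L[ℂ] H s) →ₗ[ℂ] (adOrbit ξ → ℂ)}
  {m : ℕ × ℕ → ℕ} {X : ∀ a, Fin (m a) → adOrbit ξ → ℂ}
  (hξ : ξ ∈ rationalArc)
  (hπ : ∀ s : ℕ+, IsQuarkSystem (π s) (s * p₁) (s * q₁))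
  (hW : ∀ s, IsSymbolCorrespondence ξ (π s) (W s))
  (hX : ∀ a, IsHighestBasis (funRep ξ) (polyOrbit ξ) (orbitInner ξ) a (X a))

include hπ hW

theorem NCTendsto.tendstoUniformly_raySymb (hlim : ∀ u, HasSymbolLimit π W u) {w : ℕ+ → NCPoly}
    {w₀ : NCPoly} (h : NCTendsto w w₀) :
    TendstoUniformly (fun s => raySymb π W s (w s)) (symb ξ w₀) atTop := by
  obtain ⟨ι, _, b, κ, κ₀, h1, h2, h3⟩ := h
  choose L hL1 hL2 hL3 hL4 using fun i => exists_finiteDimensional_raySymb hπ hW (b i)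
  have hle : ∀ i, L i ≤ ⨆ i, L i := le_iSup L
  refine tendstoUniformly_of_pointwise (L := ⨆ i, L i) (iSup_le hL2) (fun s => ?_) ?_ fun x => ?_
  · rw [h2, map_sum]
    refine Submodule.sum_mem _ fun i _ => ?_
    rw [map_smul]
    exact Submodule.smul_mem _ _ (hle i (hL4 i s))
  · rw [h3, map_sum]
    refine Submodule.sum_mem _ fun i _ => ?_
    rw [map_smul]
    exact Submodule.smul_mem _ _ (hle i (hL3 i))
  · simp only [h2, h3, map_sum, map_smul, Finset.sum_apply, Pi.smul_apply, smul_eq_mul]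
    exact tendsto_finsetSum _ fun i _ => (h1 i).mul (hlim (b i) x)

include hξ hX

/-- Polynomial functions are symbols of convergent sequences of noncommutative polynomials. -/
theorem exists_ncTendsto_of_mem (hlim : ∀ u, HasSymbolLimit π W u) {f : adOrbit ξ → ℂ}
    (hf : f ∈ polyOrbit ξ) : ∃ w w₀, NCTendsto w w₀ ∧ symb ξ w₀ = f ∧
      ∀ᶠ s in atTop, raySymb π W s (w s) = f := by
  have hadd : ∀ {f f' : adOrbit ξ → ℂ}, (∃ w w₀, NCTendsto w w₀ ∧ symb ξ w₀ = f ∧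
      ∀ᶠ s in atTop, raySymb π W s (w s) = f) → (∃ w w₀, NCTendsto w w₀ ∧ symb ξ w₀ = f' ∧
      ∀ᶠ s in atTop, raySymb π W s (w s) = f') → ∃ w w₀, NCTendsto w w₀ ∧ symb ξ w₀ = f + f' ∧
      ∀ᶠ s in atTop, raySymb π W s (w s) = f + f' := by
    rintro f f' ⟨w, w₀, h1, h2, h3⟩ ⟨w', w₀', h1', h2', h3'⟩
    refine ⟨_, _, h1.add h1', by rw [map_add, h2, h2'], ?_⟩
    filter_upwards [h3, h3'] with s e e'
    rw [map_add, e, e']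
  have hsmul : ∀ (c : ℂ) {f : adOrbit ξ → ℂ}, (∃ w w₀, NCTendsto w w₀ ∧ symb ξ w₀ = f ∧
      ∀ᶠ s in atTop, raySymb π W s (w s) = f) → ∃ w w₀, NCTendsto w w₀ ∧ symb ξ w₀ = c • f ∧
      ∀ᶠ s in atTop, raySymb π W s (w s) = c • f := by
    rintro c f ⟨w, w₀, h1, h2, h3⟩
    exact ⟨_, _, h1.smul c, by rw [map_smul, h2], h3.mono fun s e => by rw [map_smul, e]⟩
  have hbasis : ∀ a γ, ∃ w w₀, NCTendsto w w₀ ∧ symb ξ w₀ = X a γ ∧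
      ∀ᶠ s in atTop, raySymb π W s (w s) = X a γ := by
    intro a γ
    obtain ⟨w, hw⟩ := exists_lift_basis hξ hX a
    -- The symbols of the lifts are combinations of the X with the matrix Q s, which tends to 1. The
    -- inverse matrix corrects the lifts so that their symbols become exactly X.
    let Q : ℕ+ → Matrix (Fin (m a)) (Fin (m a)) ℂ := fun s =>
      Matrix.of fun δ ε => orbitInner ξ (X a δ) (raySymb π W s (w ε))
    have hQ : Tendsto Q atTop (𝓝 1) := by
      refine tendsto_matrix fun δ ε => ?_
      have h := (hlim (w ε)).tendsto_orbitInner hπ hW ((hX a).mem δ)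
      rw [(hw ε).2, (hX a).orthonormal] at h
      rw [Matrix.one_apply]
      exact h
    obtain ⟨hu, hinv⟩ := eventually_isUnit_and_tendsto_inv hQ
    refine ⟨fun s => ∑ δ, (Q s)⁻¹ δ γ • w δ, ∑ δ, (1 : Matrix (Fin (m a)) (Fin (m a)) ℂ) δ γ • w δ,
      ⟨Fin (m a), inferInstance, w, fun s δ => (Q s)⁻¹ δ γ,
        fun δ => (1 : Matrix (Fin (m a)) (Fin (m a)) ℂ) δ γ,
        fun δ => tendsto_pi_nhds.1 (tendsto_pi_nhds.1 hinv δ) γ, fun s => rfl, rfl⟩, ?_, ?_⟩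
    · simp [Matrix.one_apply, (hw _).2]
    · refine hu.mono fun s hs => ?_
      have h1 : ∀ δ, raySymb π W s (w δ) = ∑ ε, Q s ε δ • X a ε := fun δ =>
        (hX a).eq_sum_orbit (raySymb_mem hπ hW s _) (isHighest_raySymb hπ hW s (hw δ).1)
      simp only [map_sum, map_smul, h1, Finset.smul_sum, smul_smul]
      rw [Finset.sum_comm]
      have h2 : ∀ ε, ∑ δ, (Q s)⁻¹ δ γ * Q s ε δ = (1 : Matrix (Fin (m a)) (Fin (m a)) ℂ) ε γ := by
        intro ε
        rw [← Matrix.mul_nonsing_inv _ hs, Matrix.mul_apply]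
        exact Finset.sum_congr rfl fun δ _ => mul_comm _ _
      simp only [← Finset.sum_smul, h2]
      simp [Matrix.one_apply]
  obtain ⟨F, rfl⟩ := hf
  obtain ⟨u, hu⟩ := exists_symb_eq (trace_of_mem_rationalArc hξ) F
  rw [← hu]
  clear hu F
  have hu : u ∈ Submodule.span ℂ {x | ∃ g a w, NCHighest a w ∧ x = Quark.ncAd g w} :=
    span_ncAd_highest ▸ Submodule.mem_top
  have hzero : ∃ w w₀, NCTendsto w w₀ ∧ symb ξ w₀ = 0 ∧
      ∀ᶠ s in atTop, raySymb π W s (w s) = 0 :=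
    ⟨fun _ => 0, 0, ⟨Empty, inferInstance, fun _ => 0, fun _ _ => 0, fun _ => 0,
      fun i => i.elim, fun s => by simp, by simp⟩, map_zero _,
      Eventually.of_forall fun s => map_zero _⟩
  induction hu using Submodule.span_induction with
  | mem x hx =>
    obtain ⟨g, a, w, hw, rfl⟩ := hx
    have h1 := (hX a).eq_sum_orbit (symb_mem ξ w) (hw.map (L := (symb ξ).toLinearMap) symb_ad)
    have h2 : ∀ T : Finset (Fin (m a)), ∃ w' w₀, NCTendsto w' w₀ ∧
        symb ξ w₀ = ∑ γ ∈ T, orbitInner ξ (X a γ) (symb ξ w) • X a γ ∧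
        ∀ᶠ s in atTop, raySymb π W s (w' s) =
          ∑ γ ∈ T, orbitInner ξ (X a γ) (symb ξ w) • X a γ := by
      intro T
      induction T using Finset.induction_on with
      | empty => simpa using hzero
      | insert γ T hγ ih =>
        rw [Finset.sum_insert hγ]
        exact hadd (hsmul _ (hbasis a γ)) ih
    obtain ⟨w', w₀, h3, h4, h5⟩ := h2 Finset.univ
    refine ⟨_, _, h3.map (ncAd g).toLinearMap, ?_, h5.mono fun s e => ?_⟩
    · rw [AlgHom.toLinearMap_apply, symb_ad, symb_ad, h4, ← h1]
    · rw [AlgHom.toLinearMap_apply, raySymb_ad hπ hW, symb_ad, e, ← h1]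
  | zero => rw [map_zero]; exact hzero
  | add u w _ _ hu hw => rw [map_add]; exact hadd hu hw
  | smul c u _ hu => rw [map_smul]; exact hsmul c hu

/-- With f_i eventually equal to the symbols of quantizations of w_s and w'_s, the twisted product
is the symbol of w_s w'_s. The factor s r(ξ) times the semiclassical parameter is -i, and the
commutator polynomial has the limiting symbol -{f₁, f₂}; together they give i{f₁, f₂}. -/
theorem isPoissonType_of_hasSymbolLimit (hlim : ∀ u, HasSymbolLimit π W u) : IsPoissonType ξ W := by
  intro F G
  obtain ⟨w, w₀, h1, h2, h3⟩ := exists_ncTendsto_of_mem hξ hπ hW hX hlim (f := restrict ξ F) ⟨F, rfl⟩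
  obtain ⟨w', w₀', h1', h2', h3'⟩ :=
    exists_ncTendsto_of_mem hξ hπ hW hX hlim (f := restrict ξ G) ⟨G, rfl⟩
  have hinv : ∀ {s : ℕ+} {v : NCPoly} {f : adOrbit ξ → ℂ}, raySymb π W s v = f →
      Function.invFun (W s) f = rayQuant ξ π s v := by
    rintro s v f rfl
    exact Function.leftInverse_invFun (hW s).injective _
  constructor
  · have h := (h1.mul h1').tendstoUniformly_raySymb hπ hW hlim
    rw [map_mul, h2, h2'] at h
    refine TendstoUniformly.congr_eventually h ?_
    filter_upwards [h3, h3'] with s e e'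
    rw [twistedProduct, hinv e, hinv e', raySymb_apply, map_mul]
  · obtain ⟨z, z₀, h4, h5, h6⟩ := h1.commutator ξ h1'
    have h7 := (h4.smul (-Complex.I)).tendstoUniformly_raySymb hπ hW hlim
    have h8 : restrict ξ (poissonBracket (ncAbel w₀) (ncAbel w₀')) =
        restrict ξ (poissonBracket F G) :=
      restrict_poissonBracket_congr ((symb_eq ξ w₀).symm.trans h2) ((symb_eq ξ w₀').symm.trans h2')
    rw [map_smul, h5, h8, smul_neg, neg_smul, neg_neg] at h7
    refine TendstoUniformly.congr_eventually h7 ?_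
    filter_upwards [h3, h3'] with s e e'
    have hr := integralRadius_pos hξ
    have hs : (0 : ℝ) < (s : ℕ) := Nat.cast_pos.2 s.pos
    have hR : (((s : ℝ) * integralRadius ξ : ℝ) : ℂ) ≠ 0 :=
      Complex.ofReal_ne_zero.2 (mul_pos hs hr).ne'
    have h9 := h6 s _ _ (quant_commutator (hπ s).continuous
      (-Complex.I / (((s : ℝ) * integralRadius ξ : ℝ) : ℂ)))
    have h10 : rayQuant ξ π s (w s) * rayQuant ξ π s (w' s) -
        rayQuant ξ π s (w' s) * rayQuant ξ π s (w s) =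
        (-Complex.I / (((s : ℝ) * integralRadius ξ : ℝ) : ℂ)) • rayQuant ξ π s (z s) := h9
    rw [twistedProduct, twistedProduct, hinv e, hinv e', ← map_sub, h10, map_smul, map_smul,
      smul_smul, mul_div_cancel₀ _ hR, raySymb_apply]

end Ray

/-! ### From the Poisson type to the limits of the symbols -/

section Single

variable {ξ : Mat3} {H : Type*} [NormedAddCommGroup H] [InnerProductSpace ℂ H] [CompleteSpace H]
  [FiniteDimensional ℂ H] {π : SU3 →* unitary (H →L[ℂ] H)}
  {W : (H →L[ℂ] H) →ₗ[ℂ] (adOrbit ξ → ℂ)}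

/-- The commutator with a generator is exactly the corresponding Poisson bracket. -/
theorem IsSymbolCorrespondence.apply_commutator (hW : IsSymbolCorrespondence ξ π W)
    (hc : ∀ v : H, Continuous fun g => (π g : H →L[ℂ] H) v) {A : H →L[ℂ] H} {F : PolySU3}
    (hA : W A = restrict ξ F) (Z : Mat3) (x : adOrbit ξ) :
    W (lieD π Z * A - A * lieD π Z) x = dirD F x Z := by
  induction Z using su3_induction with
  | hsu Y =>
    let φ : (H →L[ℂ] H) →L[ℝ] ℂ :=
      ((LinearMap.proj x ∘ₗ W : (H →L[ℂ] H) →ₗ[ℂ] ℂ).toContinuousLinearMap).restrictScalars ℝ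
    have h1 := φ.hasFDerivAt.comp_hasDerivAt (0 : ℝ) (hasDerivAt_rep_conj hc Y A)
    have h2 := hasDerivAt_funRep F Y x
    rw [← hA] at h2
    refine h1.unique (h2.congr_of_eventuallyEq (Eventually.of_forall fun t => ?_))
    change _ = funRep ξ (expSU3 (t • Y)) (W A) x
    rw [← hW.equivariant]
    rfl
  | h1 => rw [lieD_one, zero_mul, mul_zero, sub_zero, map_zero, dirD_one]; rfl
  | hadd Z Z' h h' =>
    rw [map_add, map_add, add_mul, mul_add, add_sub_add_comm, map_add, Pi.add_apply, h, h']
  | hsmul c Z h =>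
    rw [map_smul, map_smul, smul_mul_assoc, mul_smul_comm, ← smul_sub, map_smul, Pi.smul_apply, h]

theorem orbitIntegral_of_const {f : adOrbit ξ → ℂ} (h : ∀ x y, f x = f y) (x : adOrbit ξ) :
    orbitIntegral ξ f = f x := by
  rw [orbitIntegral]
  simp only [fun g => h (orbitPt ξ g) x]
  simp

/-- By equivariance the symbol of 1 is invariant, hence constant on the orbit, and the trace
normalisation gives its value. -/
theorem IsSymbolCorrespondence.apply_one (hW : IsSymbolCorrespondence ξ π W)
    (hd : 0 < Module.finrank ℂ H) : W 1 = 1 := by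
  have h : ∀ x y, W 1 x = W 1 y := by
    intro x y
    obtain ⟨g, rfl⟩ := exists_smul_eq x y
    have h1 := congrFun (hW.equivariant g 1) (g • x)
    rw [opRep_one_apply, funRep_apply, inv_smul_smul] at h1
    exact h1.symm
  funext x
  have h2 := hW.normalized 1
  have h3 : opTrace (1 : H →L[ℂ] H) = Module.finrank ℂ H := LinearMap.trace_one ℂ H
  rw [orbitIntegral_of_const h x, h3, div_self (Nat.cast_ne_zero.2 hd.ne')] at h2
  exact h2

end Single

/-! ### Limits of the symbols of constants, products and generators. -/

section Ray

variable {ξ : Mat3} {p₁ q₁ : ℕ} {H : ℕ+ → Type*} [∀ s, NormedAddCommGroup (H s)]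
  [∀ s, InnerProductSpace ℂ (H s)] [∀ s, CompleteSpace (H s)] [∀ s, FiniteDimensional ℂ (H s)]
  {π : ∀ s, SU3 →* unitary (H s →L[ℂ] H s)}
  {W : ∀ s, (H s →L[ℂ] H s) →ₗ[ℂ] (adOrbit ξ → ℂ)}
  (hξ : ξ ∈ rationalArc) (hω : domWeight p₁ q₁ = (integralRadius ξ : ℂ) • ξ)
  (hπ : ∀ s : ℕ+, IsQuarkSystem (π s) (s * p₁) (s * q₁))
  (hW : ∀ s, IsSymbolCorrespondence ξ (π s) (W s))
  (hrange : ∀ f ∈ polyOrbit ξ, ∀ᶠ s in atTop, f ∈ LinearMap.range (W s))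
  (hP : IsPoissonType ξ W)

include hπ hW

theorem hasSymbolLimit_algebraMap (c : ℂ) : HasSymbolLimit π W (algebraMap ℂ NCPoly c) := by
  intro x
  have h : ∀ s, raySymb π W s (algebraMap ℂ NCPoly c) x = c := fun s => by
    rw [raySymb_apply, AlgHom.commutes, Algebra.algebraMap_eq_smul_one, map_smul,
      (hW s).apply_one (finrank_pos_of_ray hπ s)]
    simp
  simp only [h, AlgHom.commutes]
  exact tendsto_const_nhds

/-- The symbols of the quantization of `u` in coordinates. -/
theorem exists_coordinates (u : NCPoly) : ∃ (k : ℕ) (F : Fin k → PolySU3) (c : ℕ+ → Fin k → ℂ)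
    (c₀ : Fin k → ℂ), LinearIndependent ℂ (fun i => restrict ξ (F i)) ∧
      (∀ s, raySymb π W s u = ∑ i, c s i • restrict ξ (F i)) ∧
      symb ξ u = ∑ i, c₀ i • restrict ξ (F i) ∧
      (HasSymbolLimit π W u ↔ ∀ i, Tendsto (fun s => c s i) atTop (𝓝 (c₀ i))) := by
  obtain ⟨L, h1, h2, h3, h4⟩ := exists_finiteDimensional_raySymb hπ hW u
  let b := Module.finBasis ℂ L
  choose F hF using fun i => h2 (b i).2
  have hsum : ∀ f : L, (f : adOrbit ξ → ℂ) = ∑ i, b.repr f i • restrict ξ (F i) := by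
    intro f
    conv_lhs => rw [← b.sum_repr f]
    rw [Submodule.coe_sum]
    simp only [hF, Submodule.coe_smul]
  have e1 : ∀ s, raySymb π W s u = ∑ i, b.repr ⟨_, h4 s⟩ i • restrict ξ (F i) := fun s => hsum ⟨_, h4 s⟩
  have e2 : symb ξ u = ∑ i, b.repr ⟨_, h3⟩ i • restrict ξ (F i) := hsum ⟨_, h3⟩
  refine ⟨_, F, fun s i => b.repr ⟨_, h4 s⟩ i, fun i => b.repr ⟨_, h3⟩ i, ?_, e1, e2, ?_, ?_⟩
  · have := b.linearIndependent.map' L.subtype L.ker_subtype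
    simp only [hF]
    exact this
  · exact fun h i => tendsto_linear_of_pointwise h4 h3 h (b.coord i)
  · intro h x
    have e1' : ∀ s, raySymb π W s u x = ∑ i, b.repr ⟨_, h4 s⟩ i * restrict ξ (F i) x := fun s => by
      rw [congrFun (e1 s) x, Finset.sum_apply]; rfl
    have e2' : symb ξ u x = ∑ i, b.repr ⟨_, h3⟩ i * restrict ξ (F i) x := by
      rw [congrFun e2 x, Finset.sum_apply]; rfl
    simp only [e1']
    rw [e2']
    exact tendsto_finsetSum _ fun i _ => (h i).mul_const _

omit hπ in
/-- Quantizations are the combinations of the operators whose symbols are the basis functions. -/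
theorem rayQuant_eq_sum_invFun {s : ℕ+} {u : NCPoly} {k : ℕ} {c : Fin k → ℂ}
    {f : Fin k → adOrbit ξ → ℂ} (h : raySymb π W s u = ∑ i, c i • f i)
    (hf : ∀ i, f i ∈ LinearMap.range (W s)) :
    rayQuant ξ π s u = ∑ i, c i • Function.invFun (W s) (f i) := by
  refine (hW s).injective ?_
  rw [← raySymb_apply, h, map_sum]
  refine Finset.sum_congr rfl fun i _ => ?_
  rw [map_smul, Function.invFun_eq (hf i)]

include hrange hP

/-- The Poisson type speaks only of fixed functions. So the varying symbols are expanded in fixed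
bases with convergent coefficients, and the limit of the twisted product is applied to pairs of
basis functions. -/
theorem HasSymbolLimit.mul {u w : NCPoly} (hu : HasSymbolLimit π W u) (hw : HasSymbolLimit π W w) :
    HasSymbolLimit π W (u * w) := by
  obtain ⟨k, F, c, c₀, -, h1, h2, h3⟩ := exists_coordinates hπ hW u
  obtain ⟨k', F', c', c₀', -, h1', h2', h3'⟩ := exists_coordinates hπ hW w
  have hc := h3.1 hu
  have hc' := h3'.1 hw
  intro x
  have e : symb ξ (u * w) x =
      ∑ i, ∑ j, (c₀ i * c₀' j) * (restrict ξ (F i) * restrict ξ (F' j)) x := by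
    rw [map_mul, h2, h2', Pi.mul_apply, Finset.sum_apply, Finset.sum_apply, Finset.sum_mul_sum]
    refine Finset.sum_congr rfl fun i _ => Finset.sum_congr rfl fun j _ => ?_
    simp only [Pi.smul_apply, Pi.mul_apply, smul_eq_mul]
    ring
  rw [e]
  have h4 : Tendsto (fun s => ∑ i, ∑ j, (c s i * c' s j) *
      twistedProduct (W s) (restrict ξ (F i)) (restrict ξ (F' j)) x) atTop
      (𝓝 (∑ i, ∑ j, (c₀ i * c₀' j) * (restrict ξ (F i) * restrict ξ (F' j)) x)) :=
    tendsto_finsetSum _ fun i _ => tendsto_finsetSum _ fun j _ =>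
      ((hc i).mul (hc' j)).mul ((hP (F i) (F' j)).1.tendsto_at x)
  refine h4.congr' ?_
  filter_upwards [eventually_all.2 fun i => hrange _ ⟨F i, rfl⟩,
    eventually_all.2 fun j => hrange _ ⟨F' j, rfl⟩] with s hs hs'
  rw [raySymb_apply, map_mul, rayQuant_eq_sum_invFun hW (h1 s) hs,
    rayQuant_eq_sum_invFun hW (h1' s) hs', Finset.sum_mul_sum, map_sum, Finset.sum_apply]
  refine Finset.sum_congr rfl fun i _ => ?_
  rw [map_sum, Finset.sum_apply]
  refine Finset.sum_congr rfl fun j _ => ?_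
  rw [smul_mul_smul_comm, map_smul, Pi.smul_apply, smul_eq_mul]
  rfl

include hξ hω

/-- The coordinates of the symbol of Q_s(Z) solve a linear system: one equation for the integral,
and one for each bracket with a coordinate function at each point. The Poisson type gives the
convergence of the bracket rows, and equivariance makes their right hand sides constant for large s.
The limit system is injective, because a function whose brackets with all coordinates vanish is
constant on the orbit, and zero if its integral is. -/
theorem hasSymbolLimit_lin (Z : Mat3) : HasSymbolLimit π W (ncLin Z) := by
  obtain ⟨k, F, c, c₀, hli, h1, h2, h3⟩ := exists_coordinates hπ hW (ncLin Z)
  rw [h3]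
  let M : ℕ+ → Option (Fin 8 × adOrbit ξ) → Fin k → ℂ := fun s o i => match o with
    | none => orbitIntegral ξ (restrict ξ (F i))
    | some (l, x) => ((((s : ℝ) * integralRadius ξ : ℝ) : ℂ) •
        (twistedProduct (W s) (restrict ξ (F i)) (restrict ξ (MvPolynomial.X l)) -
          twistedProduct (W s) (restrict ξ (MvPolynomial.X l)) (restrict ξ (F i)))) x
  let M₀ : Option (Fin 8 × adOrbit ξ) → Fin k → ℂ := fun o i => match o with
    | none => orbitIntegral ξ (restrict ξ (F i))
    | some (l, x) => (Complex.I • restrict ξ (poissonBracket (F i) (MvPolynomial.X l))) x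
  have hcont : ∀ i, Continuous fun g => restrict ξ (F i) (orbitPt ξ g) := fun i =>
    continuous_orbitPt_of_mem ⟨F i, rfl⟩
  have hbr : ∀ (d : Fin k → ℂ) l x, ∑ i, d i * M₀ (some (l, x)) i =
      Complex.I * restrict ξ (poissonBracket (∑ i, d i • F i) (MvPolynomial.X l)) x := by
    intro d l x
    rw [poissonBracket_sum_left, map_sum, Finset.sum_apply, Finset.mul_sum]
    refine Finset.sum_congr rfl fun i _ => ?_
    simp only [M₀, map_smul, Pi.smul_apply, smul_eq_mul]
    ring
  refine tendsto_of_tendsto_linear (M := M) (M₀ := M₀) ?_ ?_ ?_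
  · rintro (_ | ⟨l, x⟩) i
    · exact tendsto_const_nhds
    · exact (hP (F i) (MvPolynomial.X l)).2.tendsto_at x
  · intro d hd
    have hconst := restrict_const_of_poissonBracket_eq_zero (ξ := ξ) (F := ∑ i, d i • F i)
      fun l x => by
        have := hd (some (l, x))
        rw [hbr] at this
        exact (mul_eq_zero.1 this).resolve_left Complex.I_ne_zero
    have hres : restrict ξ (∑ i, d i • F i) = ∑ i, d i • restrict ξ (F i) := by
      rw [map_sum]; simp only [map_smul]
    have hzero_integral : orbitIntegral ξ (restrict ξ (∑ i, d i • F i)) = 0 := by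
      rw [hres, orbitIntegral_sum_smul d hcont]
      exact hd none
    have hz : ∑ i, d i • restrict ξ (F i) = 0 := by
      rw [← hres]
      funext x
      rw [← orbitIntegral_of_const hconst x, hzero_integral]
      rfl
    exact funext (Fintype.linearIndependent_iff.1 hli d hz)
  · rintro (_ | ⟨l, x⟩)
    · change Tendsto (fun s => ∑ i, c s i * orbitIntegral ξ (restrict ξ (F i))) atTop
        (𝓝 (∑ i, c₀ i * orbitIntegral ξ (restrict ξ (F i))))
      -- The normalisation of W turns the integral into a normalised trace of Q_s(Z), whose limit is
      -- already known without any assumption on W.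
      simp only [← orbitIntegral_sum_smul _ hcont, ← h1, ← h2, raySymb_apply, (hW _).normalized]
      exact tendsto_opTrace_rayQuant hξ hω hπ _
    · have hres : restrict ξ (∑ i, c₀ i • F i) = restrict ξ (linPoly Z) := by
        rw [← ncAbel_lin, ← symb_eq, h2, map_sum]; simp only [map_smul]
      rw [hbr, restrict_poissonBracket_congr hres rfl, restrict_poissonBracket_linPoly_left]
      -- For large s, once the functions involved lie in the range, the left hand side does not
      -- depend on s: the factor s r(ξ) cancels against the semiclassical parameter, leaving -i
      -- times the exact bracket.
      refine tendsto_const_nhds.congr' ?_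
      filter_upwards [eventually_all.2 fun i => hrange _ ⟨F i, rfl⟩,
        hrange _ ⟨MvPolynomial.X l, rfl⟩] with s hs hl
      have hr := integralRadius_pos hξ
      have hs0 : (0 : ℝ) < (s : ℕ) := Nat.cast_pos.2 s.pos
      have hR : (((s : ℝ) * integralRadius ξ : ℝ) : ℂ) ≠ 0 :=
        Complex.ofReal_ne_zero.2 (mul_pos hs0 hr).ne'
      set R : ℂ := (((s : ℝ) * integralRadius ξ : ℝ) : ℂ) with hRdef
      set A := Function.invFun (W s) (restrict ξ (MvPolynomial.X l)) with hA
      have hWA : W s A = restrict ξ (MvPolynomial.X l) := Function.invFun_eq hl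
      have h4 := (hW s).apply_commutator (hπ s).continuous hWA Z x
      have h5 : rayQuant ξ π s (ncLin Z) = (-Complex.I / R) • lieD (π s) Z := quant_lin _ _ _
      have h6 := rayQuant_eq_sum_invFun hW (h1 s) hs
      have h7 : ∑ i, c s i * M s (some (l, x)) i =
          R * W s (rayQuant ξ π s (ncLin Z) * A - A * rayQuant ξ π s (ncLin Z)) x := by
        rw [h6, Finset.sum_mul, Finset.mul_sum, ← Finset.sum_sub_distrib, map_sum, Finset.sum_apply,
          Finset.mul_sum]
        refine Finset.sum_congr rfl fun i _ => ?_
        rw [smul_mul_assoc, mul_smul_comm, ← smul_sub, map_smul, map_sub]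
        simp only [M, twistedProduct, Pi.smul_apply, Pi.sub_apply, smul_eq_mul]
        ring
      rw [h7, h5, smul_mul_assoc, mul_smul_comm, ← smul_sub, map_smul, Pi.smul_apply, smul_eq_mul, h4]
      field_simp

theorem hasSymbolLimit_of_isPoissonType (u : NCPoly) : HasSymbolLimit π W u := by
  induction u using ncPoly_induction with
  | hs c => exact hasSymbolLimit_algebraMap hπ hW c
  | hl Z => exact hasSymbolLimit_lin hξ hω hπ hW hrange hP Z
  | hm u w hu hw => exact hu.mul hπ hW hrange hP hw
  | ha u w hu hw =>
    intro x
    simp only [map_add, Pi.add_apply]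
    exact (hu x).add (hw x)

end Ray

end Quark

end

open Quark
theorem theorem3p16 {ξ : Mat3} (hξ : ξ ∈ rationalArc)
    {p₁ q₁ : ℕ} (hω : domWeight p₁ q₁ = (integralRadius ξ : ℂ) • ξ)
    {H : ℕ+ → Type*} [∀ s, NormedAddCommGroup (H s)] [∀ s, InnerProductSpace ℂ (H s)]
    [∀ s, CompleteSpace (H s)] [∀ s, FiniteDimensional ℂ (H s)]
    (π : ∀ s, SU3 →* unitary (H s →L[ℂ] H s))
    (hπ : ∀ s : ℕ+, IsQuarkSystem (π s) (s * p₁) (s * q₁))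
    (W : ∀ s, (H s →L[ℂ] H s) →ₗ[ℂ] (adOrbit ξ → ℂ))
    (hW : ∀ s, IsSymbolCorrespondence ξ (π s) (W s))
    {m : ℕ × ℕ → ℕ} (X : ∀ a, Fin (m a) → adOrbit ξ → ℂ)
    (hX : ∀ a, IsHighestBasis (funRep ξ) (polyOrbit ξ) (orbitInner ξ) a (X a))
    {n : ℕ+ → ℕ × ℕ → ℕ} (e : ∀ s a, Fin (n s a) → (H s →L[ℂ] H s))
    (he : ∀ s a, IsHighestBasis (opRep (π s)) ⊤ opInner a (e s a)) :
    IsPoissonType ξ W ↔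
      ∀ a : ℕ × ℕ, Tendsto
        (fun s : ℕ+ => ∑ γ, ∑ σ, ‖(charMatrix (W s) (X a) (e s a) -
          charMatrix (berezin ξ (π s) (s * p₁) (s * q₁)) (X a) (e s a)) γ σ‖)
        atTop (𝓝 0) := by
  constructor
  · intro hP
    exact charMatrix_of_hasSymbolLimit hξ hω hπ hW hX he
      (hasSymbolLimit_of_isPoissonType hξ hω hπ hW
        -- Needed because `twistedProduct` carries information only for functions in the image of
        -- the correspondence.
        (fun f hf => eventually_mem_range hξ hω hπ hW hX he hf) hP)
  · intro h
    exact isPoissonType_of_hasSymbolLimit hξ hπ hW hX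
      (hasSymbolLimit_of_charMatrix hξ hω hπ hW hX he h)
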